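/- Let $d\ge 2$, $k>0$, and let $\Omega\subset\mathbb{R}^d$ be a bounded non-empty open set with Lipschitz boundary (not necessarily connected), with surface measure $dS$ and outward unit normal $n$ on $\partial\Omega$. Let $$K(x,t)=(4\pi kt)^{-d/2}\exp\!\big(-|x|^2/(4kt)\big)\ \text{ for } t>0,\qquad K(x,t)=0\ \text{ for } t\le 0.$$ Let $v\in C^2\big((\mathbb{R}^d\setminus\Omega)\times[0,\infty)\big)$ be real-valued and satisfy $\partial_t v=k\Delta v+h$ in $(\mathbb{R}^d\setminus\overline\Omega)\times(0,\infty)$, where the support of $h(\cdot,t)$ is contained in $\overline\Omega$ for every $t>0$, and $v(x,0)=0$ for $x\in\mathbb{R}^d\setminus\Omega$. Suppose that there are $r_0>0$, $C>0$, $a\ge 0$, $0\le b<2$ and $m\in\mathbb{Z}$ such that $$\Big|\frac{\partial v}{\partial n}(r\xi,t)+\frac{2r}{4kt}\,v(r\xi,t)\Big|\le C\,r^m e^{a r^b}\qquad\text{for all } r>r_0,\ t>0,\ |\xi|=1,$$ where $\partial v/\partial n$ is here the derivative in the radial direction $\xi$. Then for every $t>0$ and every $x\notin\partial\Omega$ the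 function $$(s,y)\mapsto \frac{\partial v}{\partial n}(y,s)\,K(x-y,t-s)-v(y,s)\,\frac{\partial}{\partial n(y)}\big[K(x-y,t-s)\big]$$ is integrable on $(0,t)\times\partial\Omega$, and $$-k\int_0^t ds\int_{\partial\Omega}dS(y)\,\Big[\frac{\partial v}{\partial n}(y,s)\,K(x-y,t-s)-v(y,s)\,\frac{\partial}{\partial n(y)}\big[K(x-y,t-s)\big]\Big]=\begin{cases}0,& x\in\Omega,\\ v(x,t),& x\notin\overline\Omega.\end{cases}$$ Here $\partial/\partial n(y)$ is the derivative in $y$ in the direction $n(y)$, and $\partial v/\partial n$ on $\partial\Omega$ is computed from outside $\Omega$. -/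

import Mathlib

open Set Filter Topology MeasureTheory InnerProductSpace
open scoped NNReal

/-- Lipschitz boundary: near each boundary point, after a rigid change of coordinates, the set is
the strict subgraph of a Lipschitz function of `d - 1` variables (here the coordinates are the
component along a unit vector `e` and the orthogonal projection onto the hyperplane `e^⊥`). -/
def HasLipschitzBoundary {d : ℕ} (Ω : Set (EuclideanSpace ℝ (Fin d))) : Prop :=
  ∀ y ∈ frontier Ω, ∃ (e : EuclideanSpace ℝ (Fin d)) (γ : (ℝ ∙ e)ᗮ → ℝ) (L : ℝ≥0),
    ‖e‖ = 1 ∧ LipschitzWith L γ ∧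
      ∀ᶠ z in 𝓝 y, (z ∈ Ω ↔ inner ℝ e z < γ ((ℝ ∙ e)ᗮ.orthogonalProjectionOnto z))

/-- `ν` is the outward unit normal of `Ω` at `y`: the set `Ω` is tangent at `y` to the half-space
`{z | ⟪z - y, ν⟫ < 0}`, that is, every cone strictly inside this half-space lies in `Ω` near `y`,
and every cone strictly inside the opposite half-space avoids `Ω` near `y`. -/
def IsOutwardUnitNormalAt {d : ℕ} (Ω : Set (EuclideanSpace ℝ (Fin d)))
    (y ν : EuclideanSpace ℝ (Fin d)) : Prop :=
  ‖ν‖ = 1 ∧ ∀ ε > (0 : ℝ), ∀ᶠ z in 𝓝 y,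
    (inner ℝ (z - y) ν < -(ε * ‖z - y‖) → z ∈ Ω) ∧
    (ε * ‖z - y‖ < inner ℝ (z - y) ν → z ∉ Ω)

/-- The outward unit normal at a point is unique. -/
theorem IsOutwardUnitNormalAt.unique {d : ℕ} {Ω : Set (EuclideanSpace ℝ (Fin d))} {y ν ν' : EuclideanSpace ℝ (Fin d)}
    (h : IsOutwardUnitNormalAt Ω y ν) (h' : IsOutwardUnitNormalAt Ω y ν') : ν = ν' := by
  by_contra hne
  obtain ⟨h1, h2⟩ := h
  obtain ⟨h1', h2'⟩ := h'
  set c : ℝ := inner ℝ ν ν'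
  have hc : c < 1 := by
    exact (inner_lt_one_iff_real_of_norm_eq_one h1 h1').2 hne
  set w := ν' - ν
  have hw1 : inner ℝ w ν = c - 1 := by
    simp [w, inner_sub_left, h1, c, real_inner_comm]
  have hw2 : inner ℝ w ν' = 1 - c := by
    simp [w, inner_sub_left, h1', c]
  have hw : 0 < ‖w‖ := norm_pos_iff.2 (sub_ne_zero.2 (Ne.symm hne))
  set ε := (1 - c) / (2 * ‖w‖)
  have hε : 0 < ε := by
    have : 0 < 1 - c := by linarith
    positivity
  have key := (h2 ε hε).and (h2' ε hε)
  have ht : Tendsto (fun s : ℝ => y + s • w) (𝓝[>] 0) (𝓝 y) := by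
    have : Continuous (fun s : ℝ => y + s • w) := by fun_prop
    have := this.tendsto 0
    simp only [zero_smul, add_zero] at this
    exact this.mono_left nhdsWithin_le_nhds
  obtain ⟨s, hs, hs0⟩ := ((ht.eventually key).and self_mem_nhdsWithin).exists
  have hs0 : 0 < s := hs0
  simp only [add_sub_cancel_left, inner_smul_left, norm_smul, Real.norm_eq_abs, abs_of_pos hs0,
    hw1, hw2, RCLike.conj_to_real] at hs
  have he : ε * (s * ‖w‖) = s * ((1 - c)/2) := by
    simp only [ε]; field_simp
  rw [he] at hs
  refine hs.2.2 ?_ (hs.1.1 ?_) <;> nlinarith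

open Classical in
/-- The outward unit normal field of `Ω`. For a Lipschitz boundary it exists almost everywhere
with respect to surface measure; it is set to `0` at the points without a normal. -/
noncomputable def outwardNormal {d : ℕ} (Ω : Set (EuclideanSpace ℝ (Fin d)))
    (y : EuclideanSpace ℝ (Fin d)) : EuclideanSpace ℝ (Fin d) :=
  if h : ∃ ν, IsOutwardUnitNormalAt Ω y ν then h.choose else 0

/-- The surface measure on `∂Ω`: the `(d - 1)`-dimensional Hausdorff measure, normalized to agree
with Lebesgue measure on hyperplanes. -/
noncomputable def surfaceMeasure {d : ℕ} (Ω : Set (EuclideanSpace ℝ (Fin d))) :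
    Measure (EuclideanSpace ℝ (Fin d)) :=
  (Measure.euclideanHausdorffMeasure (d - 1)).restrict (frontier Ω)

/-- The heat kernel of `∂ₜ - k Δ`. -/
noncomputable def heatKernel {d : ℕ} (k : ℝ) (x : EuclideanSpace ℝ (Fin d)) (t : ℝ) : ℝ :=
  if 0 < t then (4 * Real.pi * k * t) ^ (-(d : ℝ) / 2) * Real.exp (-‖x‖ ^ 2 / (4 * k * t)) else 0

/-- The growth condition: for some `r₀ > 0`, integer `m`, `C > 0`, `a ≥ 0` and `0 ≤ b < 2`,
`|∂v/∂n (r ξ, t) + (2 r / (4 k t)) v (r ξ, t)| ≤ C r ^ m exp (a r ^ b)`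
for all `r > r₀`, `t > 0` and unit vectors `ξ`, where `n = ξ` is the normal of the sphere. -/
def GrowthCondition {d : ℕ} (k : ℝ) (v : EuclideanSpace ℝ (Fin d) → ℝ → ℝ) : Prop :=
  ∃ (r₀ C a b : ℝ) (m : ℤ), 0 < r₀ ∧ 0 < C ∧ 0 ≤ a ∧ 0 ≤ b ∧ b < 2 ∧
    ∀ r > r₀, ∀ t > 0, ∀ ξ : EuclideanSpace ℝ (Fin d), ‖ξ‖ = 1 →
      |fderiv ℝ (fun z => v z t) (r • ξ) ξ + (2 * r / (4 * k * t)) * v (r • ξ) t|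
        ≤ C * r ^ m * Real.exp (a * r ^ b)

/-- `∂v/∂n (y, s) K (x - y, t - s) - v (y, s) ∂/∂n(y) [K (x - y, t - s)]`, for `y ∈ ∂Ω`, where `v`
lives on the complement of `Ω`, so that its normal derivative is the one-sided one from there. -/
noncomputable def layerIntegrand {d : ℕ} (k : ℝ) (Ω : Set (EuclideanSpace ℝ (Fin d)))
    (v : EuclideanSpace ℝ (Fin d) → ℝ → ℝ) (x : EuclideanSpace ℝ (Fin d)) (t s : ℝ)
    (y : EuclideanSpace ℝ (Fin d)) : ℝ :=
  fderivWithin ℝ (fun z => v z s) Ωᶜ y (outwardNormal Ω y) * heatKernel k (x - y) (t - s)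
    - v y s * fderiv ℝ (fun z => heatKernel k (x - z) (t - s)) y (outwardNormal Ω y)

/-- The field generated by the single and double layers on `∂Ω`. The factor `k` is
the one from the identity of Green for the operator `∂ₜ - k Δ`, whose fundamental solution is `K`. -/
noncomputable def exteriorLayerField {d : ℕ} (k : ℝ) (Ω : Set (EuclideanSpace ℝ (Fin d)))
    (v : EuclideanSpace ℝ (Fin d) → ℝ → ℝ) (x : EuclideanSpace ℝ (Fin d)) (t : ℝ) : ℝ :=
  -k * ∫ s in (0 : ℝ)..t, ∫ y, layerIntegrand k Ω v x t s y ∂(surfaceMeasure Ω)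

/-! As a function of the source point (y, s), s < t, the kernel K(x - y, t - s) solves the backward
heat equation. Integrate ∂ₛ(vK) over the exterior and over 0 < s < T with T < t. By Green's second
identity only boundary terms remain: the layer integral on ∂Ω, the slice s = T, and the slice s = 0,
where v vanishes. As T → t the kernel becomes an approximate identity at x, so the slice s = T tends
to the value at x of v extended by zero into Ω. This treats x inside and x outside at once
(`exteriorLayerField_eq_of_tendsto`).

The exterior is unbounded, so K is first multiplied by a cutoff χ that is 1 on the ball of radius R.
The operator ∂ₛ + kΔ applied to χK leaves only terms with a derivative on χ (`cutoffError`), which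
live on |y| ≥ R. They disappear as R → ∞ provided v grows more slowly than every Gaussian, and this
is what the growth condition yields: ∂v/∂r + (2r/4ks)v is exp(-r²/4ks) times the radial derivative
of exp(r²/4ks)v. Integrate outward from a fixed sphere. The weight at intermediate radii is at most
the weight at the end point, so it cancels, leaving |v| ≤ A exp(α|y|²) for each α > 0, uniformly for
small s (`GrowthCondition.exists_bound`).

Green's identity on a merely Lipschitz boundary rests on three facts. The area formula identifies
Hausdorff measure on a graph with √(1 + |∇γ|²) du, and Rademacher's theorem provides the normal
almost everywhere. Over one graph, the divergence theorem follows by integrating by parts against a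
Lipschitz clamp of height/ε and letting ε → 0. Finally, a function that is C¹ up to the boundary is
Lipschitz near each boundary point from outside, hence extends to a Lipschitz function on the whole
space; a partition of unity then glues the local statements (`hasExteriorFlux_of_contDiffOn`,
`green_second_identity_exterior`).

Integrability of the layer integrand is easier: x has positive distance from ∂Ω, where K(x - y, τ)/τ
stays bounded, and ∂Ω has finite measure. -/

open scoped ENNReal
open Module

/-! ### Hausdorff measure and the area formula for Lipschitz graphs -/

/-- If distances between values of `f` are controlled by distances between values of `g`, then so
are the Hausdorff measures of images. -/
theorem euclideanHausdorffMeasure_image_le_of_edist_le {X Y Z : Type*}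
    [EMetricSpace Y] [MeasurableSpace Y] [BorelSpace Y]
    [EMetricSpace Z] [MeasurableSpace Z] [BorelSpace Z] {f : X → Y} {g : X → Z} {s : Set X}
    {K : ℝ≥0} (n : ℕ) (h : ∀ x ∈ s, ∀ y ∈ s, edist (f x) (f y) ≤ K * edist (g x) (g y)) :
    μHE[n] (f '' s) ≤ (K : ℝ≥0∞) ^ n * μHE[n] (g '' s) := by
  rcases s.eq_empty_or_nonempty with rfl | ⟨x₀, hx₀⟩
  · simp
  have hX : Nonempty X := ⟨x₀⟩
  -- `G` plays the role of f ∘ g⁻¹. The hypothesis forces f to be constant on the fibres of g in s,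
  -- so the choice of preimage is harmless and `G` is Lipschitz on g(s).
  set G : Z → Y := fun z => f (Function.invFunOn g s z)
  have hG : ∀ x ∈ s, G (g x) = f x := fun x hx => by
    have hm := Function.invFunOn_mem (f := g) (s := s) (b := g x) ⟨x, hx, rfl⟩
    have he := Function.invFunOn_eq (f := g) (s := s) (b := g x) ⟨x, hx, rfl⟩
    have := h _ hm x hx
    rw [he] at this
    simpa [edist_eq_zero] using this
  have hL : LipschitzOnWith K G (g '' s) := by
    rintro _ ⟨x, hx, rfl⟩ _ ⟨y, hy, rfl⟩
    rw [hG x hx, hG y hy]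
    exact h x hx y hy
  have hI : f '' s = G '' (g '' s) := by
    rw [image_image]
    exact image_congr fun x hx => (hG x hx).symm
  have := hL.hausdorffMeasure_image_le (d := (n : ℝ)) (by positivity)
  rw [hI, Measure.euclideanHausdorffMeasure_def, Measure.euclideanHausdorffMeasure_def]
  simp only [Measure.smul_apply, ENNReal.smul_def, smul_eq_mul]
  rw [mul_left_comm]
  gcongr
  simpa using this

section Graph

variable {U E : Type*} [NormedAddCommGroup U] [InnerProductSpace ℝ U]
  [NormedAddCommGroup E] [InnerProductSpace ℝ E]

/-- The graph map `u ↦ ι u + γ u • e`. -/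
def graphMap (ι : U →ₗᵢ[ℝ] E) (e : E) (γ : U → ℝ) (u : U) : E := ι u + γ u • e

/-- The volume density `√(1 + ‖A‖ ^ 2)` of the graph of a linear form `A`. -/
noncomputable def graphDensity (A : U →L[ℝ] ℝ) : ℝ := √(1 + ‖A‖ ^ 2)

theorem one_le_graphDensity (A : U →L[ℝ] ℝ) : 1 ≤ graphDensity A := by
  rw [graphDensity, Real.one_le_sqrt]; nlinarith [sq_nonneg ‖A‖]

/-- The density is the Euclidean norm of the pair (1, ‖A‖), hence 1-Lipschitz in A. -/
theorem graphDensity_le_add (A B : U →L[ℝ] ℝ) :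
    graphDensity A ≤ graphDensity B + ‖A - B‖ := by
  have hB := one_le_graphDensity B
  have h1 : ‖A‖ ≤ ‖B‖ + ‖A - B‖ := by
    simpa using norm_add_le B (A - B)
  have h2 : ‖B‖ ≤ graphDensity B := Real.le_sqrt_of_sq_le (by linarith)
  have h3 : graphDensity B ^ 2 = 1 + ‖B‖ ^ 2 := Real.sq_sqrt (by positivity)
  refine Real.sqrt_le_iff.2 ⟨by positivity, ?_⟩
  have h4 : ‖A‖ ^ 2 ≤ (‖B‖ + ‖A - B‖) ^ 2 := by gcongr
  nlinarith [norm_nonneg (A - B), mul_le_mul_of_nonneg_right h2 (norm_nonneg (A - B))]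

theorem continuous_graphDensity : Continuous (graphDensity : (U →L[ℝ] ℝ) → ℝ) := by
  unfold graphDensity; fun_prop

theorem norm_sq_add_smul_of_orthogonal {ι : U →ₗᵢ[ℝ] E} {e : E} (he : ‖e‖ = 1)
    (ho : ∀ u, inner ℝ (ι u) e = 0) (u : U) (c : ℝ) : ‖ι u + c • e‖ ^ 2 = ‖u‖ ^ 2 + c ^ 2 := by
  rw [norm_add_sq_real, inner_smul_right, ho, norm_smul, he]
  simp

/-- In an orthonormal basis the Gram matrix is the identity plus a aᵀ, with a the coefficient vector
of A, and the matrix determinant lemma gives 1 + |a|². -/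
theorem normDet_linearGraph [FiniteDimensional ℝ U] (ι : U →ₗᵢ[ℝ] E) {e : E} (he : ‖e‖ = 1)
    (ho : ∀ u, inner ℝ (ι u) e = 0) (A : U →L[ℝ] ℝ) :
    (ι.toLinearMap + (A : U →ₗ[ℝ] ℝ).smulRight e).normDet = graphDensity A := by
  classical
  set L := ι.toLinearMap + (A : U →ₗ[ℝ] ℝ).smulRight e
  set b := stdOrthonormalBasis ℝ U
  have h := L.normDet_sq_eq_det_gram b
  have ho' : ∀ u, inner ℝ e (ι u) = 0 := fun u => by rw [real_inner_comm]; exact ho u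
  have hg : Matrix.gram ℝ (fun i => L (b i)) =
      1 + Matrix.replicateCol Unit (fun i => A (b i)) *
        Matrix.replicateRow Unit (fun i => A (b i)) := by
    ext i j
    rw [Matrix.gram_apply, Matrix.add_apply, Matrix.mul_apply, Matrix.one_apply]
    simp only [L, LinearMap.add_apply, LinearMap.smulRight_apply, ContinuousLinearMap.coe_coe,
      LinearIsometry.coe_toLinearMap, inner_add_left, inner_add_right, inner_smul_left,
      inner_smul_right, ho, ho', LinearIsometry.inner_map_map, b.inner_eq_ite,
      real_inner_self_eq_norm_sq, he]
    simp [mul_comm]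
  rw [hg, Matrix.det_one_add_replicateCol_mul_replicateRow] at h
  have hn : ‖A‖ ^ 2 = ∑ i, A (b i) ^ 2 := by
    have := (InnerProductSpace.toDual ℝ U).symm.norm_map A
    rw [← this, ← b.sum_sq_norm_inner_right]
    refine Finset.sum_congr rfl fun i _ => ?_
    rw [real_inner_comm, InnerProductSpace.toDual_symm_apply, Real.norm_eq_abs, sq_abs]
  rw [graphDensity, hn, ← Real.sqrt_sq L.normDet_nonneg]
  congr 1
  simpa [dotProduct, sq] using h

theorem antilipschitzWith_graphMap {ι : U →ₗᵢ[ℝ] E} {e : E} (he : ‖e‖ = 1)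
    (ho : ∀ u, inner ℝ (ι u) e = 0) (γ : U → ℝ) : AntilipschitzWith 1 (graphMap ι e γ) := by
  refine AntilipschitzWith.of_le_mul_dist fun x y => ?_
  rw [dist_eq_norm, dist_eq_norm, NNReal.coe_one, one_mul]
  have h : graphMap ι e γ x - graphMap ι e γ y = ι (x - y) + (γ x - γ y) • e := by
    simp only [graphMap, map_sub]; module
  rw [h]
  refine le_of_sq_le_sq ?_ (norm_nonneg _)
  rw [norm_sq_add_smul_of_orthogonal he ho]
  nlinarith [sq_nonneg (γ x - γ y)]

theorem lipschitzWith_graphMap {ι : U →ₗᵢ[ℝ] E} {e : E} (he : ‖e‖ = 1) {γ : U → ℝ} {C : ℝ≥0}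
    (hγ : LipschitzWith C γ) : LipschitzWith (1 + C) (graphMap ι e γ) := by
  refine LipschitzWith.add ι.lipschitz ?_
  refine LipschitzWith.of_dist_le_mul fun x y => ?_
  rw [dist_eq_norm, ← sub_smul, norm_smul, he, mul_one, ← dist_eq_norm]
  exact hγ.dist_le_mul x y

variable [FiniteDimensional ℝ U] [MeasurableSpace U] [BorelSpace U] [MeasurableSpace E]
  [BorelSpace E]

/-- On a piece where γ is δ-close to A, the graph map differs from the linear graph map by an
increment of size at most δ times the linear increment. Distances are therefore comparable up to l =
1/(1 - δ) ≥ 1 + δ, and measures up to a power of l. The measure of the linear image is known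
exactly. -/
theorem euclideanHausdorffMeasure_graph_image_comparable {ι : U →ₗᵢ[ℝ] E} {e : E} (he : ‖e‖ = 1)
    (ho : ∀ u, inner ℝ (ι u) e = 0) {γ : U → ℝ} {A : U →L[ℝ] ℝ} {P : Set U} {δ l : ℝ≥0}
    (hl : (l : ℝ) * (1 - δ) = 1) (hP : ApproximatesLinearOn γ A P δ) :
    μHE[finrank ℝ U] (graphMap ι e γ '' P) ≤
        (l : ℝ≥0∞) ^ finrank ℝ U * (ENNReal.ofReal (graphDensity A) * volume P) ∧
      ENNReal.ofReal (graphDensity A) * volume P ≤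
        (l : ℝ≥0∞) ^ finrank ℝ U * μHE[finrank ℝ U] (graphMap ι e γ '' P) := by
  set L := ι.toLinearMap + (A : U →ₗ[ℝ] ℝ).smulRight e with hL
  have hLim : μHE[finrank ℝ U] (L '' P) = ENNReal.ofReal (graphDensity A) * volume P := by
    rw [L.euclideanHausdorffMeasure_image_eq_normDet_mul_volume, normDet_linearGraph ι he ho]
  have hl0 : 0 < (l : ℝ) := by
    rcases l.coe_nonneg.lt_or_eq with h | h
    · exact h
    · rw [← h] at hl; simp at hl
  have hδ : (δ : ℝ) < 1 := by nlinarith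
  have key : ∀ x ∈ P, ∀ y ∈ P, dist (graphMap ι e γ x) (graphMap ι e γ y) ≤ l * dist (L x) (L y) ∧
      dist (L x) (L y) ≤ l * dist (graphMap ι e γ x) (graphMap ι e γ y) := by
    intro x hx y hy
    have h1 : ‖γ x - γ y - A (x - y)‖ ≤ δ * ‖x - y‖ := hP x hx y hy
    set r : E := (γ x - γ y - A (x - y)) • e with hr
    have hLxy : L x - L y = ι (x - y) + A (x - y) • e := by
      simp only [hL, LinearMap.add_apply, LinearMap.smulRight_apply, ContinuousLinearMap.coe_coe,
        LinearIsometry.coe_toLinearMap, map_sub]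
      module
    have h2 : graphMap ι e γ x - graphMap ι e γ y = (L x - L y) + r := by
      rw [hLxy, hr]
      simp only [graphMap, map_sub]
      module
    have h3 : ‖x - y‖ ≤ ‖L x - L y‖ := by
      rw [hLxy]
      refine le_of_sq_le_sq ?_ (norm_nonneg _)
      rw [norm_sq_add_smul_of_orthogonal he ho]
      nlinarith [sq_nonneg (A (x - y))]
    have h4 : ‖r‖ ≤ δ * ‖L x - L y‖ := by
      rw [hr, norm_smul, he, mul_one]
      exact h1.trans (by gcongr)
    rw [dist_eq_norm, dist_eq_norm, h2]
    set a := L x - L y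
    have hna := norm_nonneg a
    have h5 : ‖a‖ ≤ ‖a + r‖ + ‖r‖ := by
      simpa using norm_sub_le (a + r) r
    have h6 := norm_add_le a r
    have h7 : 1 + (δ : ℝ) ≤ l := by
      have : (1 + (δ : ℝ)) * (1 - δ) ≤ l * (1 - δ) := by nlinarith [sq_nonneg (δ : ℝ)]
      exact le_of_mul_le_mul_right this (by linarith)
    constructor
    · nlinarith
    · have : (1 - δ) * ‖a‖ ≤ ‖a + r‖ := by linarith
      calc ‖a‖ = l * ((1 - δ) * ‖a‖) := by rw [← mul_assoc, hl, one_mul]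
        _ ≤ _ := by gcongr
  have conv : ∀ {a b c d : E}, dist a b ≤ l * dist c d → edist a b ≤ l * edist c d := by
    intro a b c d h
    rw [edist_dist, edist_dist, ← ENNReal.ofReal_coe_nnreal, ← ENNReal.ofReal_mul (by positivity)]
    exact ENNReal.ofReal_le_ofReal h
  rw [← hLim]
  exact ⟨euclideanHausdorffMeasure_image_le_of_edist_le _ fun x hx y hy => conv (key x hx y hy).1,
    euclideanHausdorffMeasure_image_le_of_edist_le _ fun x hx y hy => conv (key x hx y hy).2⟩

/-- Because the density is at least 1, an additive error 2δ is also a relative error 1 + 2δ ≤ l². -/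
theorem lintegral_graphDensity_comparable {γ : U → ℝ} {A : U →L[ℝ] ℝ} {P : Set U}
    (hPm : MeasurableSet P) {δ l : ℝ≥0} (hl : (l : ℝ) * (1 - δ) = 1)
    (hA : ∀ x ∈ P, ‖fderiv ℝ γ x - A‖ ≤ 2 * δ) :
    (∫⁻ x in P, ENNReal.ofReal (graphDensity (fderiv ℝ γ x))) ≤
        (l : ℝ≥0∞) ^ 2 * (ENNReal.ofReal (graphDensity A) * volume P) ∧
      ENNReal.ofReal (graphDensity A) * volume P ≤
        (l : ℝ≥0∞) ^ 2 * ∫⁻ x in P, ENNReal.ofReal (graphDensity (fderiv ℝ γ x)) := by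
  have hl0 : 0 < (l : ℝ) := by
    rcases l.coe_nonneg.lt_or_eq with h | h
    · exact h
    · rw [← h] at hl; simp at hl
  have hδ : (δ : ℝ) < 1 := by nlinarith
  have h7 : 1 + (δ : ℝ) ≤ l := by
    have : (1 + (δ : ℝ)) * (1 - δ) ≤ l * (1 - δ) := by nlinarith [sq_nonneg (δ : ℝ)]
    exact le_of_mul_le_mul_right this (by linarith)
  have h8 : 1 + 2 * (δ : ℝ) ≤ l ^ 2 := by nlinarith [sq_nonneg (δ : ℝ), δ.coe_nonneg]
  have cmp : ∀ B C : U →L[ℝ] ℝ, ‖B - C‖ ≤ 2 * δ →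
      ENNReal.ofReal (graphDensity B) ≤ (l : ℝ≥0∞) ^ 2 * ENNReal.ofReal (graphDensity C) := by
    intro B C h
    rw [← ENNReal.ofReal_coe_nnreal, ← ENNReal.ofReal_pow (by positivity),
      ← ENNReal.ofReal_mul (by positivity)]
    refine ENNReal.ofReal_le_ofReal ?_
    have h1 := graphDensity_le_add B C
    have h2 := one_le_graphDensity C
    nlinarith [δ.coe_nonneg]
  constructor
  · calc _ ≤ ∫⁻ x in P, (l : ℝ≥0∞) ^ 2 * ENNReal.ofReal (graphDensity A) :=
        setLIntegral_mono' hPm fun x hx => cmp _ _ (hA x hx)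
      _ = _ := by rw [setLIntegral_const, mul_assoc]
  · have hm : Measurable fun x => ENNReal.ofReal (graphDensity (fderiv ℝ γ x)) :=
      (continuous_graphDensity.measurable.comp (measurable_fderiv ℝ γ)).ennreal_ofReal
    calc _ = ∫⁻ x in P, ENNReal.ofReal (graphDensity A) := by rw [setLIntegral_const]
      _ ≤ ∫⁻ x in P, (l : ℝ≥0∞) ^ 2 * ENNReal.ofReal (graphDensity (fderiv ℝ γ x)) :=
        setLIntegral_mono' hPm fun x hx => cmp _ _ (by rw [norm_sub_rev]; exact hA x hx)
      _ = _ := lintegral_const_mul _ hm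

theorem measurableEmbedding_graphMap {ι : U →ₗᵢ[ℝ] E} {e : E} (he : ‖e‖ = 1)
    (ho : ∀ u, inner ℝ (ι u) e = 0) {γ : U → ℝ} {C : ℝ≥0} (hγ : LipschitzWith C γ) :
    MeasurableEmbedding (graphMap ι e γ) :=
  have := FiniteDimensional.complete ℝ U
  ((antilipschitzWith_graphMap he ho γ).isClosedEmbedding
    (lipschitzWith_graphMap he hγ).uniformContinuous).measurableEmbedding

/-- Approximating linearly is not enough: the derivative itself must be close to A i on the piece.
The set is sliced first by which member of a dense sequence is δ-close to the derivative, then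
partitioned by linear approximation. The approximating form is the derivative at some point of the
same slice, hence the bound 2δ. -/
theorem exists_graph_partition {γ : U → ℝ} {s : Set U} (hs : MeasurableSet s)
    (hd : ∀ x ∈ s, DifferentiableAt ℝ γ x) {δ : ℝ≥0} (hδ : 0 < δ) :
    ∃ (P : ℕ × ℕ → Set U) (A : ℕ × ℕ → U →L[ℝ] ℝ), Pairwise (Function.onFun Disjoint P) ∧
      (∀ i, MeasurableSet (P i)) ∧ (⋃ i, P i) = s ∧
      ∀ i, ApproximatesLinearOn γ (A i) (P i) δ ∧ ∀ x ∈ P i, ‖fderiv ℝ γ x - A i‖ ≤ 2 * δ := by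
  have hsep : TopologicalSpace.SeparableSpace (U →L[ℝ] ℝ) := inferInstance
  set B := TopologicalSpace.denseSeq (U →L[ℝ] ℝ)
  set Q : ℕ → Set U := fun m => s ∩ {x | ‖fderiv ℝ γ x - B m‖ < δ}
  have hQm : ∀ m, MeasurableSet (Q m) := fun m =>
    hs.inter (measurableSet_lt ((measurable_fderiv ℝ γ).sub_const (B m)).norm measurable_const)
  have hQ : ⋃ m, Q m = s := by
    refine Subset.antisymm (iUnion_subset fun m => inter_subset_left) fun x hx => ?_
    obtain ⟨m, hm⟩ := (TopologicalSpace.denseRange_denseSeq (U →L[ℝ] ℝ)).exists_dist_lt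
      (fderiv ℝ γ x) (NNReal.coe_pos.2 hδ)
    exact mem_iUnion.2 ⟨m, hx, (dist_eq_norm (fderiv ℝ γ x) (B m)).symm.trans_lt hm⟩
  set R := disjointed Q
  have hRm : ∀ m, MeasurableSet (R m) := fun m => MeasurableSet.disjointed hQm m
  have hRQ : ∀ m, R m ⊆ Q m := disjointed_subset Q
  have hRs : ∀ m, R m ⊆ s := fun m => (hRQ m).trans inter_subset_left
  choose t A htd htm hts hta htA using fun m =>
    exists_partition_approximatesLinearOn_of_hasFDerivWithinAt γ (R m) (fderiv ℝ γ)
      (fun x hx => (hd x (hRs m hx)).hasFDerivAt.hasFDerivWithinAt) (fun _ => δ) (fun _ => hδ.ne')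
  refine ⟨fun i => R i.1 ∩ t i.1 i.2, fun i => A i.1 i.2, ?_, fun i => (hRm _).inter (htm _ _), ?_,
    fun i => ⟨hta _ _, fun x hx => ?_⟩⟩
  · rintro ⟨m, n⟩ ⟨m', n'⟩ hne
    by_cases hm : m = m'
    · subst hm
      have hn : n ≠ n' := fun h => hne (by rw [h])
      exact (htd m hn).mono inter_subset_right inter_subset_right
    · exact (disjoint_disjointed Q hm).mono inter_subset_left inter_subset_left
  · refine Subset.antisymm (iUnion_subset fun i => inter_subset_left.trans (hRs _)) fun x hx => ?_
    have : x ∈ ⋃ m, R m := by rw [iUnion_disjointed, hQ]; exact hx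
    obtain ⟨m, hm⟩ := mem_iUnion.1 this
    obtain ⟨n, hn⟩ := mem_iUnion.1 (hts m hm)
    exact mem_iUnion.2 ⟨(m, n), hm, hn⟩
  · obtain ⟨y, hy, hyA⟩ := htA i.1 ⟨x, hx.1⟩ i.2
    have h1 : ‖fderiv ℝ γ x - B i.1‖ < δ := (hRQ _ hx.1).2
    have h2 : ‖fderiv ℝ γ y - B i.1‖ < δ := (hRQ _ hy).2
    simp only [hyA]
    calc _ = ‖(fderiv ℝ γ x - B i.1) - (fderiv ℝ γ y - B i.1)‖ := by congr 1; abel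
      _ ≤ _ := by linarith [norm_sub_le (fderiv ℝ γ x - B i.1) (fderiv ℝ γ y - B i.1)]

/-- **Area formula** for the graph of a Lipschitz function, on measurable sets. -/
theorem euclideanHausdorffMeasure_graph_image {ι : U →ₗᵢ[ℝ] E} {e : E} (he : ‖e‖ = 1)
    (ho : ∀ u, inner ℝ (ι u) e = 0) {γ : U → ℝ} {C : ℝ≥0} (hγ : LipschitzWith C γ) {s : Set U}
    (hs : MeasurableSet s) :
    μHE[finrank ℝ U] (graphMap ι e γ '' s) =
      ∫⁻ x in s, ENNReal.ofReal (graphDensity (fderiv ℝ γ x)) := by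
  have hemb := measurableEmbedding_graphMap he ho hγ
  set n := finrank ℝ U with hn
  set ν : Measure U := Measure.comap (graphMap ι e γ) μHE[n] with hν
  set κ : Measure U := volume.withDensity fun x => ENNReal.ofReal (graphDensity (fderiv ℝ γ x))
    with hκ
  have hνa : ∀ s, ν s = μHE[n] (graphMap ι e γ '' s) := fun s => hemb.comap_apply _ s
  have hκa : ∀ s, MeasurableSet s →
      κ s = ∫⁻ x in s, ENNReal.ofReal (graphDensity (fderiv ℝ γ x)) :=
    fun s hs => withDensity_apply _ hs
  rw [← hνa, ← hκa s hs]
  have hνac : ν ≪ volume := fun t ht => by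
    have h := euclideanHausdorffMeasure_image_le_of_edist_le (f := graphMap ι e γ) (g := id)
      (s := t) n fun x _ y _ => lipschitzWith_graphMap (ι := ι) he hγ x y
    rw [image_id, hn, InnerProductSpace.euclideanHausdorffMeasure_eq_volume, ht, mul_zero] at h
    rw [hνa]
    exact le_antisymm h zero_le
  have hκac : κ ≪ volume := withDensity_absolutelyContinuous _ _
  set D := {x | DifferentiableAt ℝ γ x}
  have hDm : MeasurableSet D := measurableSet_of_differentiableAt ℝ γ
  have hD : volume Dᶜ = 0 := hγ.ae_differentiableAt
  have red : ∀ {μ : Measure U}, μ ≪ volume → μ s = μ (s ∩ D) := fun {μ} h => by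
    refine (measure_inter_conull ?_).symm
    exact h hD
  rw [red hνac, red hκac]
  -- For each j the two measures agree up to the factor l^(n + 2): the exponent n comes from
  -- Hausdorff measure, 2 from the density. With δ = 1/(j + 2) and l = (j + 2)/(j + 1) the relation
  -- l(1 - δ) = 1 holds, and l → 1 as j → ∞.
  have key : ∀ j : ℕ, ν (s ∩ D) ≤ ENNReal.ofReal (1 + 1 / (j + 1)) ^ (n + 2) * κ (s ∩ D) ∧
      κ (s ∩ D) ≤ ENNReal.ofReal (1 + 1 / (j + 1)) ^ (n + 2) * ν (s ∩ D) := by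
    intro j
    set l : ℝ≥0 := 1 + 1 / (j + 1) with hl
    set δ : ℝ≥0 := 1 / (j + 2)
    have hδ : 0 < δ := by positivity
    have hlδ : (l : ℝ) * (1 - δ) = 1 := by
      simp only [l, δ]; push_cast; field_simp; ring
    have hl' : ENNReal.ofReal (1 + 1 / (j + 1)) = l := by
      rw [← ENNReal.ofReal_coe_nnreal]; simp [l]
    obtain ⟨P, A, hPd, hPm, hPU, hPA⟩ :=
      exists_graph_partition (hs.inter hDm) (fun x hx => hx.2) hδ
    rw [hl', ← hPU, measure_iUnion hPd hPm, measure_iUnion hPd hPm, ← ENNReal.tsum_mul_left,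
      ← ENNReal.tsum_mul_left]
    have both : ∀ i, ν (P i) ≤ (l : ℝ≥0∞) ^ (n + 2) * κ (P i) ∧
        κ (P i) ≤ (l : ℝ≥0∞) ^ (n + 2) * ν (P i) := fun i => by
      have h1 := euclideanHausdorffMeasure_graph_image_comparable he ho hlδ (hPA i).1 (ι := ι)
      have h2 := lintegral_graphDensity_comparable (hPm i) hlδ (hPA i).2
      rw [hνa, hκa _ (hPm i), pow_add]
      constructor
      · refine h1.1.trans ?_
        rw [mul_assoc]
        exact mul_le_mul_right h2.2 _
      · refine h2.1.trans ?_
        rw [mul_comm ((l : ℝ≥0∞) ^ n), mul_assoc]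
        exact mul_le_mul_right h1.2 _
    exact ⟨ENNReal.tsum_le_tsum fun i => (both i).1, ENNReal.tsum_le_tsum fun i => (both i).2⟩
  have lim : ∀ a : ℝ≥0∞, Tendsto
      (fun j : ℕ => ENNReal.ofReal (1 + 1 / ((j : ℝ) + 1)) ^ (n + 2) * a) atTop (𝓝 a) := by
    intro a
    have h1 : Tendsto (fun j : ℕ => (1 : ℝ) + 1 / ((j : ℝ) + 1)) atTop (𝓝 (1 + 0)) :=
      tendsto_const_nhds.add tendsto_one_div_add_atTop_nhds_zero_nat
    have h2 := ((ENNReal.continuous_pow (n + 2)).tendsto _).comp (ENNReal.tendsto_ofReal h1)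
    have h3 := ENNReal.Tendsto.mul_const (b := a) h2 (by simp)
    simpa using h3
  exact le_antisymm (ge_of_tendsto' (lim _) fun j => (key j).1)
    (ge_of_tendsto' (lim _) fun j => (key j).2)

/-- **Area formula** for the graph of a Lipschitz function: the Hausdorff measure on the graph. -/
theorem euclideanHausdorffMeasure_restrict_range_graphMap {ι : U →ₗᵢ[ℝ] E} {e : E} (he : ‖e‖ = 1)
    (ho : ∀ u, inner ℝ (ι u) e = 0) {γ : U → ℝ} {C : ℝ≥0} (hγ : LipschitzWith C γ) :
    (μHE[finrank ℝ U] : Measure E).restrict (range (graphMap ι e γ)) =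
      (volume.withDensity fun x => ENNReal.ofReal (graphDensity (fderiv ℝ γ x))).map
        (graphMap ι e γ) := by
  have hemb := measurableEmbedding_graphMap he ho hγ
  ext t ht
  rw [Measure.restrict_apply ht, hemb.map_apply, withDensity_apply _ (hemb.measurable ht),
    ← euclideanHausdorffMeasure_graph_image he ho hγ (hemb.measurable ht),
    image_preimage_eq_inter_range]

end Graph

/-! ### Orthogonal splittings of the space along a unit vector -/

/-- An orthogonal splitting `E = U ⊕ ℝ e` of an inner product space, with `e` a unit vector. -/
structure HyperplaneSplitting (U E : Type*) [NormedAddCommGroup U] [InnerProductSpace ℝ U]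
    [NormedAddCommGroup E] [InnerProductSpace ℝ E] where
  /-- the unit vector -/
  e : E
  /-- the inclusion of the hyperplane -/
  ι : U →ₗᵢ[ℝ] E
  /-- the orthogonal projection to the hyperplane -/
  π : E →L[ℝ] U
  norm_e : ‖e‖ = 1
  inner_ι_e : ∀ u, inner ℝ (ι u) e = 0
  decomp : ∀ z, ι (π z) + inner ℝ e z • e = z

/-- The splitting of a space along a unit vector. -/
noncomputable def HyperplaneSplitting.ofUnit {E : Type*} [NormedAddCommGroup E]
    [InnerProductSpace ℝ E] (e : E) (he : ‖e‖ = 1) :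
    HyperplaneSplitting (ℝ ∙ e)ᗮ E where
  e := e
  ι := (ℝ ∙ e)ᗮ.subtypeₗᵢ
  π := (ℝ ∙ e)ᗮ.orthogonalProjectionOnto
  norm_e := he
  inner_ι_e u := Submodule.mem_orthogonal_singleton_iff_inner_left.1 u.2
  decomp z := by
    have h := (ℝ ∙ e).starProjection_add_starProjection_orthogonal z
    rw [Submodule.starProjection_unit_singleton ℝ he] at h
    rw [add_comm]
    exact h

namespace HyperplaneSplitting

section Algebra

variable {U E : Type*} [NormedAddCommGroup U] [InnerProductSpace ℝ U]
  [NormedAddCommGroup E] [InnerProductSpace ℝ E] (S : HyperplaneSplitting U E)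

theorem inner_e_ι (u : U) : inner ℝ S.e (S.ι u) = 0 := by
  rw [real_inner_comm]; exact S.inner_ι_e u

theorem inner_e_e : inner ℝ S.e S.e = 1 := by
  rw [real_inner_self_eq_norm_sq, S.norm_e, one_pow]

theorem inner_e_add (u : U) (s : ℝ) : inner ℝ S.e (S.ι u + s • S.e) = s := by
  rw [inner_add_right, S.inner_e_ι, inner_smul_right, S.inner_e_e]; ring

theorem π_add (u : U) (s : ℝ) : S.π (S.ι u + s • S.e) = u := by
  have h := S.decomp (S.ι u + s • S.e)
  rw [S.inner_e_add] at h
  exact S.ι.injective (add_right_cancel h)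

theorem π_e : S.π S.e = 0 := by
  simpa using S.π_add 0 1

theorem norm_sq_decomp (z : E) : ‖z‖ ^ 2 = ‖S.π z‖ ^ 2 + inner ℝ S.e z ^ 2 := by
  conv_lhs => rw [← S.decomp z]
  exact norm_sq_add_smul_of_orthogonal S.norm_e S.inner_ι_e _ _

theorem norm_π_le (z : E) : ‖S.π z‖ ≤ ‖z‖ := by
  refine le_of_sq_le_sq ?_ (norm_nonneg _)
  rw [S.norm_sq_decomp z]; nlinarith [sq_nonneg (inner ℝ S.e z)]

theorem abs_inner_le (z : E) : |inner ℝ S.e z| ≤ ‖z‖ := by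
  simpa [S.norm_e] using abs_real_inner_le_norm S.e z

theorem inner_ι_eq (u : U) (z : E) : inner ℝ (S.ι u) z = inner ℝ u (S.π z) := by
  conv_lhs => rw [← S.decomp z]
  rw [inner_add_right, inner_smul_right, S.inner_ι_e, S.ι.inner_map_map]; ring

/-- The graph of `γ` as a parametrized hypersurface. -/
def graph (γ : U → ℝ) : U → E := graphMap S.ι S.e γ

theorem graph_apply (γ : U → ℝ) (u : U) : S.graph γ u = S.ι u + γ u • S.e := rfl

/-- The height of a point over the graph of `γ`. -/
noncomputable def height (γ : U → ℝ) (z : E) : ℝ := inner ℝ S.e z - γ (S.π z)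

theorem height_add (γ : U → ℝ) (u : U) (s : ℝ) : S.height γ (S.ι u + s • S.e) = s - γ u := by
  rw [height, S.inner_e_add, S.π_add]

theorem height_eq_zero_iff (γ : U → ℝ) (z : E) : S.height γ z = 0 ↔ z ∈ range (S.graph γ) := by
  constructor
  · intro h
    refine ⟨S.π z, ?_⟩
    rw [graph_apply, ← sub_eq_zero.1 h, S.decomp]
  · rintro ⟨u, rfl⟩
    rw [graph_apply, S.height_add, sub_self]

theorem lipschitzWith_height {γ : U → ℝ} {C : ℝ≥0} (hγ : LipschitzWith C γ) :
    LipschitzWith (1 + C) (S.height γ) := by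
  refine LipschitzWith.of_dist_le_mul fun x y => ?_
  rw [Real.dist_eq, dist_eq_norm]
  have h1 := hγ.dist_le_mul (S.π x) (S.π y)
  rw [Real.dist_eq, dist_eq_norm, ← map_sub] at h1
  have h2 := S.norm_π_le (x - y)
  have h3 := S.abs_inner_le (x - y)
  have h4 : S.height γ x - S.height γ y = inner ℝ S.e (x - y) - (γ (S.π x) - γ (S.π y)) := by
    rw [height, height, inner_sub_right]; ring
  rw [h4]
  push_cast
  have := abs_sub (inner ℝ S.e (x - y)) (γ (S.π x) - γ (S.π y))
  nlinarith [C.coe_nonneg]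

end Algebra

section Measure

variable {U E : Type*} [NormedAddCommGroup U] [InnerProductSpace ℝ U] 
  [MeasurableSpace U] [BorelSpace U]
  [NormedAddCommGroup E] [InnerProductSpace ℝ E]
  [MeasurableSpace E] [BorelSpace E] (S : HyperplaneSplitting U E)

/-- The splitting as a linear isometry. -/
noncomputable def isometryEquiv : WithLp 2 (U × ℝ) ≃ₗᵢ[ℝ] E where
  toFun p := S.ι p.fst + p.snd • S.e
  invFun z := WithLp.toLp 2 (S.π z, inner ℝ S.e z)
  map_add' p q := by simp [add_smul]; abel
  map_smul' c p := by simp [mul_smul]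
  left_inv p := by
    simp only [S.π_add, S.inner_e_add]
    rfl
  right_inv z := S.decomp z
  norm_map' p := by
    refine (sq_eq_sq₀ (norm_nonneg _) (norm_nonneg _)).1 ?_
    rw [WithLp.prod_norm_sq_eq_of_L2]
    change ‖S.ι p.fst + p.snd • S.e‖ ^ 2 = _
    rw [norm_sq_add_smul_of_orthogonal S.norm_e S.inner_ι_e, Real.norm_eq_abs, sq_abs]

theorem measurableEmbedding_add :
    MeasurableEmbedding (fun p : U × ℝ => S.ι p.1 + p.2 • S.e) :=
  S.isometryEquiv.toHomeomorph.measurableEmbedding.comp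
    (MeasurableEquiv.toLp 2 (U × ℝ)).measurableEmbedding

theorem measurePreserving_add [FiniteDimensional ℝ U] [FiniteDimensional ℝ E] :
    MeasurePreserving (fun p : U × ℝ => S.ι p.1 + p.2 • S.e) (volume.prod volume) volume :=
  S.isometryEquiv.measurePreserving.comp (WithLp.volume_preserving_toLp U ℝ)

end Measure

end HyperplaneSplitting

/-! ### The divergence theorem above a Lipschitz graph -/

theorem lineDeriv_eq_zero_of_notMem_tsupport {E : Type*} [NormedAddCommGroup E] [NormedSpace ℝ E]
    {g : E → ℝ} {z : E} (hz : z ∉ tsupport g) (a : E) : lineDeriv ℝ g z a = 0 := by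
  have h : g =ᶠ[𝓝 z] fun _ => 0 := notMem_tsupport_iff_eventuallyEq.1 hz
  rw [h.lineDeriv_eq]
  simp [lineDeriv]

theorem LipschitzWith.integrable_lineDeriv {E : Type*} [NormedAddCommGroup E] [NormedSpace ℝ E]
    [FiniteDimensional ℝ E] [MeasurableSpace E] [BorelSpace E] {μ : Measure E}
    [IsLocallyFiniteMeasure μ] {g : E → ℝ} {K : ℝ≥0}
    (hg : LipschitzWith K g) (hs : HasCompactSupport g) (a : E) :
    Integrable (fun z => lineDeriv ℝ g z a) μ := by
  refine (integrable_indicator_iff hs.measurableSet).2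
    (IntegrableOn.of_bound hs.measure_lt_top
      (aestronglyMeasurable_lineDeriv hg.continuous _) (K * ‖a‖)
      (.of_forall fun z => norm_lineDeriv_le_of_lipschitz ℝ hg)) |>.congr (.of_forall fun z => ?_)
  by_cases hz : z ∈ tsupport g
  · simp [hz]
  · simp [hz, lineDeriv_eq_zero_of_notMem_tsupport hz]

theorem IsCompact.integrable_indicator_const {X : Type*} [TopologicalSpace X] [T2Space X]
    [MeasurableSpace X] [OpensMeasurableSpace X] {μ : Measure X} [IsFiniteMeasureOnCompacts μ]
    {s : Set X} (hs : IsCompact s) (M : ℝ) :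
    Integrable (s.indicator fun _ => M) μ :=
  (integrable_indicator_iff hs.measurableSet).2 (integrableOn_const hs.measure_lt_top.ne)

namespace HyperplaneSplitting

variable {U E : Type*} [NormedAddCommGroup U] [InnerProductSpace ℝ U]
  [NormedAddCommGroup E] [InnerProductSpace ℝ E] (S : HyperplaneSplitting U E)

/-- The derivative of the height over the graph of `γ` in the direction `a`. -/
noncomputable def slope (γ : U → ℝ) (a : E) (u : U) : ℝ := inner ℝ S.e a - fderiv ℝ γ u (S.π a)

theorem hasFDerivAt_height {γ : U → ℝ} {z : E} (h : DifferentiableAt ℝ γ (S.π z)) :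
    HasFDerivAt (S.height γ) (innerSL ℝ S.e - (fderiv ℝ γ (S.π z)).comp S.π) z :=
  (innerSL ℝ S.e).hasFDerivAt.sub (h.hasFDerivAt.comp z S.π.hasFDerivAt)

/-- The clamp is 0 below the graph, 1 above height ε and affine in the height between, so it is a
Lipschitz substitute for the indicator of the region above the graph. The two corners are one point
each on a vertical line and may be excluded. -/
theorem lineDeriv_clamp_height {γ : U → ℝ} (hγ : Continuous γ) {u : U}
    (h : DifferentiableAt ℝ γ u) {ε s : ℝ} (hε : 0 < ε) (h0 : s ≠ γ u) (h1 : s ≠ γ u + ε) (a : E) :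
    lineDeriv ℝ (fun z => max 0 (min 1 (S.height γ z / ε))) (S.ι u + s • S.e) a =
      (Ioc (γ u) (γ u + ε)).indicator (fun _ => S.slope γ a u / ε) s := by
  set z := S.ι u + s • S.e with hz
  have hhz : S.height γ z = s - γ u := S.height_add γ u s
  have hc : Continuous (S.height γ) := by unfold height; fun_prop
  rcases lt_or_gt_of_ne h0 with hlt | hgt
  · have : (fun z => max 0 (min 1 (S.height γ z / ε))) =ᶠ[𝓝 z] fun _ => 0 := by
      filter_upwards [hc.continuousAt.eventually_lt_const (show S.height γ z < 0 by linarith)]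
        with y hy
      have : S.height γ y / ε ≤ 0 := div_nonpos_of_nonpos_of_nonneg hy.le hε.le
      exact max_eq_left ((min_le_right _ _).trans this)
    rw [this.lineDeriv_eq, indicator_of_notMem (by simp [hlt.le])]
    simp [lineDeriv]
  rcases lt_or_gt_of_ne h1 with hlt' | hgt'
  · have : (fun z => max 0 (min 1 (S.height γ z / ε))) =ᶠ[𝓝 z] fun y => S.height γ y / ε := by
      filter_upwards [hc.continuousAt.eventually_const_lt (show 0 < S.height γ z by linarith),
        hc.continuousAt.eventually_lt_const (show S.height γ z < ε by linarith)] with y hy hy'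
      rw [min_eq_right ((div_le_one hε).2 hy'.le), max_eq_right (by positivity)]
    rw [this.lineDeriv_eq, indicator_of_mem (show s ∈ Ioc (γ u) (γ u + ε) from ⟨hgt, hlt'.le⟩)]
    have hd := S.hasFDerivAt_height (γ := γ) (z := z) (by rwa [hz, S.π_add])
    have hd' := hd.mul_const ε⁻¹
    simp only [← div_eq_mul_inv] at hd'
    rw [(hd'.hasLineDerivAt a).lineDeriv]
    simp only [hz, S.π_add, slope]
    simp [div_eq_inv_mul]
  · have : (fun z => max 0 (min 1 (S.height γ z / ε))) =ᶠ[𝓝 z] fun _ => 1 := by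
      filter_upwards [hc.continuousAt.eventually_const_lt (show ε < S.height γ z by linarith)]
        with y hy
      rw [min_eq_left ((one_le_div hε).2 hy.le), max_eq_right zero_le_one]
    rw [this.lineDeriv_eq, indicator_of_notMem (by simp [hgt'])]
    simp [lineDeriv]

theorem integral_lineDeriv_clamp_mul {γ : U → ℝ} {C : ℝ≥0} (hγ : LipschitzWith C γ)
    {g : E → ℝ} {ε : ℝ} (hε : 0 < ε) (a : E) {u : U} (hu : DifferentiableAt ℝ γ u) :
    ∫ s : ℝ, lineDeriv ℝ (fun z => max 0 (min 1 (S.height γ z / ε))) (S.ι u + s • S.e) a *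
        g (S.ι u + s • S.e) =
      S.slope γ a u * (ε⁻¹ * ∫ s in (γ u)..(γ u + ε), g (S.ι u + s • S.e)) := by
  have h : ∀ᵐ s : ℝ, lineDeriv ℝ (fun z => max 0 (min 1 (S.height γ z / ε)))
      (S.ι u + s • S.e) a * g (S.ι u + s • S.e) = (Ioc (γ u) (γ u + ε)).indicator
        (fun s => S.slope γ a u * ε⁻¹ * g (S.ι u + s • S.e)) s := by
    have h1 : ∀ c : ℝ, ∀ᵐ s : ℝ, s ≠ c := fun c => by simp [ae_iff]
    filter_upwards [h1 (γ u), h1 (γ u + ε)] with s hs hs'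
    rw [S.lineDeriv_clamp_height hγ.continuous hu hε hs hs']
    by_cases hm : s ∈ Ioc (γ u) (γ u + ε)
    · rw [indicator_of_mem hm, indicator_of_mem hm, div_eq_mul_inv]
    · rw [indicator_of_notMem hm, indicator_of_notMem hm, zero_mul]
  rw [integral_congr_ae h, integral_indicator measurableSet_Ioc, integral_const_mul,
    intervalIntegral.integral_of_le (by linarith), mul_assoc]

theorem lipschitzWith_clamp_height {γ : U → ℝ} {C : ℝ≥0} (hγ : LipschitzWith C γ) (ε : ℝ) :
    ∃ K, LipschitzWith K fun z => max 0 (min 1 (S.height γ z / ε)) := by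
  have h1 : LipschitzWith (‖ε⁻¹‖₊ * (1 + C)) fun z => S.height γ z / ε := by
    have := (lipschitzWith_smul ε⁻¹).comp (S.lipschitzWith_height hγ)
    convert! this using 2
    simp [div_eq_inv_mul]
  exact ⟨_, (h1.const_min 1).const_max 0⟩

/-- The average of a Lipschitz function over a short vertical segment. -/
theorem abs_average_sub_le {γ : U → ℝ} {g : E → ℝ} {K : ℝ≥0} (hg : LipschitzWith K g) {ε : ℝ}
    (hε : 0 < ε) (u : U) :
    |ε⁻¹ * (∫ s in (γ u)..(γ u + ε), g (S.ι u + s • S.e)) - g (S.graph γ u)| ≤ K * ε := by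
  have hgc := hg.continuous
  have h1 : ε⁻¹ * (∫ s in (γ u)..(γ u + ε), g (S.ι u + s • S.e)) - g (S.graph γ u) =
      ε⁻¹ * ∫ s in (γ u)..(γ u + ε), (g (S.ι u + s • S.e) - g (S.graph γ u)) := by
    rw [intervalIntegral.integral_sub (Continuous.intervalIntegrable (by fun_prop) _ _) (by simp),
      intervalIntegral.integral_const]
    simp
    field_simp
  have h2 : ‖∫ s in (γ u)..(γ u + ε), (g (S.ι u + s • S.e) - g (S.graph γ u))‖ ≤
      K * ε * |γ u + ε - γ u| := by
    refine intervalIntegral.norm_integral_le_of_norm_le_const fun s hs => ?_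
    rw [uIoc_of_le (by linarith)] at hs
    rw [← dist_eq_norm]
    refine (hg.dist_le_mul _ _).trans ?_
    gcongr
    rw [graph_apply, dist_eq_norm, add_sub_add_left_eq_sub, ← sub_smul, norm_smul, S.norm_e,
      mul_one, Real.norm_eq_abs, abs_of_pos (by linarith [hs.1])]
    linarith [hs.2]
  rw [h1, abs_mul, abs_of_pos (inv_pos.2 hε), ← Real.norm_eq_abs]
  rw [add_sub_cancel_left, abs_of_pos hε] at h2
  calc _ ≤ ε⁻¹ * (K * ε * ε) := by gcongr
    _ = _ := by field_simp

theorem abs_slope_le {γ : U → ℝ} {C : ℝ≥0} (hγ : LipschitzWith C γ) (a : E) (u : U) :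
    |S.slope γ a u| ≤ (1 + C) * ‖a‖ := by
  have h1 := S.abs_inner_le a
  have h2 : |fderiv ℝ γ u (S.π a)| ≤ C * ‖a‖ := by
    refine ((fderiv ℝ γ u).le_opNorm _).trans ?_
    gcongr
    · exact norm_fderiv_le_of_lipschitz ℝ hγ
    · exact S.norm_π_le a
  have := abs_sub (inner ℝ S.e a) (fderiv ℝ γ u (S.π a))
  rw [slope]; linarith

variable [FiniteDimensional ℝ U] [MeasurableSpace U] [BorelSpace U]
  [FiniteDimensional ℝ E] [MeasurableSpace E] [BorelSpace E]

/-- **Divergence theorem** over a Lipschitz graph, for compactly supported Lipschitz functions. -/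
theorem integral_lineDeriv_above_graph {γ : U → ℝ} {C : ℝ≥0} (hγ : LipschitzWith C γ)
    {g : E → ℝ} {K : ℝ≥0} (hg : LipschitzWith K g) (hs : HasCompactSupport g) (a : E) :
    ∫ z in {z | 0 < S.height γ z}, lineDeriv ℝ g z a =
      -∫ u, S.slope γ a u * g (S.graph γ u) := by
  set φ : ℕ → E → ℝ := fun n z => max 0 (min 1 (S.height γ z / (1 / ((n : ℝ) + 1)))) with hφ
  have hε : ∀ n : ℕ, 0 < 1 / ((n : ℝ) + 1) := fun n => by positivity
  have hε0 : Tendsto (fun n : ℕ => 1 / ((n : ℝ) + 1)) atTop (𝓝 0) :=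
    tendsto_one_div_add_atTop_nhds_zero_nat
  have hhc : Continuous (S.height γ) := (S.lipschitzWith_height hγ).continuous
  have hφc : ∀ n, Continuous (φ n) := fun n => by simp only [hφ]; fun_prop
  have hφ1 : ∀ n z, |φ n z| ≤ 1 := fun n z => by
    rw [abs_of_nonneg (le_max_left _ _)]
    exact max_le zero_le_one (min_le_left _ _)
  -- Both factors are Lipschitz and g has compact support, so integration by parts has no boundary
  -- term. The right side tends to the volume integral, the left side to the integral over the
  -- graph.
  have hparts : ∀ n, ∫ z, lineDeriv ℝ (φ n) z a * g z = -∫ z, lineDeriv ℝ g z a * φ n z := by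
    intro n
    obtain ⟨L, hL⟩ := S.lipschitzWith_clamp_height hγ (1 / ((n : ℝ) + 1))
    rw [hL.integral_lineDeriv_mul_eq hg hs a, ← integral_neg]
    simp only [lineDeriv_neg, neg_mul]
    rfl
  have hlim1 : Tendsto (fun n => ∫ z, lineDeriv ℝ g z a * φ n z) atTop
      (𝓝 (∫ z in {z | 0 < S.height γ z}, lineDeriv ℝ g z a)) := by
    have hm : MeasurableSet {z | 0 < S.height γ z} :=
      (isOpen_lt continuous_const hhc).measurableSet
    rw [← integral_indicator hm]
    refine tendsto_integral_of_dominated_convergence (fun z => ‖lineDeriv ℝ g z a‖)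
      (fun n => (aestronglyMeasurable_lineDeriv hg.continuous _).mul (hφc n).aestronglyMeasurable)
      (hg.integrable_lineDeriv hs a).norm (fun n => .of_forall fun z => ?_)
      (.of_forall fun z => ?_)
    · rw [norm_mul]
      exact mul_le_of_le_one_right (norm_nonneg _) (hφ1 n z)
    · by_cases hz : 0 < S.height γ z
      · rw [indicator_of_mem (show z ∈ {z | 0 < S.height γ z} from hz)]
        refine tendsto_const_nhds.congr' ?_
        filter_upwards [hε0.eventually_lt_const hz] with n hn
        have : φ n z = 1 := by
          simp only [hφ]
          rw [min_eq_left ((one_le_div (hε n)).2 hn.le), max_eq_right zero_le_one]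
        rw [this, mul_one]
      · rw [indicator_of_notMem (show z ∉ {z | 0 < S.height γ z} from hz)]
        refine tendsto_const_nhds.congr fun n => ?_
        have : φ n z = 0 := max_eq_left ((min_le_right _ _).trans
          (div_nonpos_of_nonpos_of_nonneg (not_lt.1 hz) (hε n).le))
        rw [this, mul_zero]
  have hintg : ∀ n, Integrable (fun z => lineDeriv ℝ (φ n) z a * g z) := fun n => by
    obtain ⟨L, hL⟩ := S.lipschitzWith_clamp_height hγ (1 / ((n : ℝ) + 1))
    exact (hL.locallyIntegrable_lineDeriv a).integrable_smul_right_of_hasCompactSupport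
      hg.continuous hs
  have hintg' : ∀ n, Integrable (fun p : U × ℝ => lineDeriv ℝ (φ n) (S.ι p.1 + p.2 • S.e) a *
      g (S.ι p.1 + p.2 • S.e)) (volume.prod volume) := fun n =>
    (S.measurePreserving_add.integrable_comp_emb S.measurableEmbedding_add).2 (hintg n)
  have hfub : ∀ n, ∫ z, lineDeriv ℝ (φ n) z a * g z =
      ∫ u, ∫ s, lineDeriv ℝ (φ n) (S.ι u + s • S.e) a * g (S.ι u + s • S.e) := fun n => by
    rw [← integral_prod _ (hintg' n),
      ← S.measurePreserving_add.integral_comp S.measurableEmbedding_add]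
  have hdiff : ∀ᵐ u : U, DifferentiableAt ℝ γ u := hγ.ae_differentiableAt
  obtain ⟨M, hM⟩ := hs.exists_bound_of_continuous hg.continuous
  have hM0 : 0 ≤ M := (norm_nonneg _).trans (hM 0)
  -- The projected support is compact and carries all the vertical integrals, which gives an
  -- integrable majorant independent of n.
  set T : Set U := S.π '' tsupport g
  have hT : IsCompact T := hs.isCompact.image S.π.continuous
  have hzero : ∀ u ∉ T, ∀ s : ℝ, g (S.ι u + s • S.e) = 0 := fun u hu s => by
    refine image_eq_zero_of_notMem_tsupport fun h => hu ⟨_, h, S.π_add u s⟩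
  have hlim2 : Tendsto (fun n => ∫ z, lineDeriv ℝ (φ n) z a * g z) atTop
      (𝓝 (∫ u, S.slope γ a u * g (S.graph γ u))) := by
    simp only [hfub]
    refine tendsto_integral_of_dominated_convergence
      (T.indicator fun _ => (1 + C) * ‖a‖ * M)
      (fun n => (hintg' n).integral_prod_left.aestronglyMeasurable)
      (hT.integrable_indicator_const _) (fun n => ?_) ?_
    · filter_upwards [hdiff] with u hu
      rw [S.integral_lineDeriv_clamp_mul hγ (hε n) a hu]
      by_cases huT : u ∈ T
      · rw [indicator_of_mem huT, norm_mul]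
        gcongr
        · exact S.abs_slope_le hγ a u
        · have := intervalIntegral.norm_integral_le_of_norm_le_const (a := γ u)
            (b := γ u + 1 / ((n : ℝ) + 1)) (f := fun s => g (S.ι u + s • S.e)) (C := M)
            fun s _ => hM _
          rw [add_sub_cancel_left, abs_of_pos (hε n)] at this
          rw [norm_mul, Real.norm_of_nonneg (inv_pos.2 (hε n)).le, inv_mul_le_iff₀ (hε n), mul_comm]
          exact this
      · simp [hzero u huT, indicator_of_notMem huT]
    · filter_upwards [hdiff] with u hu
      simp only [hφ, S.integral_lineDeriv_clamp_mul hγ (hε _) a hu]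
      refine Tendsto.const_mul _ ?_
      rw [tendsto_iff_dist_tendsto_zero]
      refine squeeze_zero (fun _ => dist_nonneg) (fun n => S.abs_average_sub_le hg (hε n) u) ?_
      simpa using hε0.const_mul (K : ℝ)
  simp only [hparts] at hlim2
  have := tendsto_nhds_unique hlim2 hlim1.neg
  rw [this, neg_neg]

end HyperplaneSplitting

/-! ### The unit normal of a graph -/

namespace HyperplaneSplitting

section Normal

variable {U E : Type*} [NormedAddCommGroup U] [InnerProductSpace ℝ U] [FiniteDimensional ℝ U]
  [NormedAddCommGroup E] [InnerProductSpace ℝ E] (S : HyperplaneSplitting U E)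

/-- The upward unit normal of the graph of `γ`. -/
noncomputable def normal (γ : U → ℝ) (u : U) : E :=
  (graphDensity (fderiv ℝ γ u))⁻¹ • (S.e - S.ι ((toDual ℝ U).symm (fderiv ℝ γ u)))

/-- Surface density times normal component is the `slope` weight in the divergence theorem over a
graph; the square root in the normal cancels the one in the density. -/
theorem graphDensity_mul_inner_normal (γ : U → ℝ) (u : U) (a : E) :
    graphDensity (fderiv ℝ γ u) * inner ℝ (S.normal γ u) a = S.slope γ a u := by
  have h := one_le_graphDensity (fderiv ℝ γ u)
  rw [normal, real_inner_smul_left, inner_sub_left, S.inner_ι_eq, toDual_symm_apply, slope,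
    mul_inv_cancel_left₀ (by positivity)]

theorem norm_normal (γ : U → ℝ) (u : U) : ‖S.normal γ u‖ = 1 := by
  have h := one_le_graphDensity (fderiv ℝ γ u)
  have h1 : ‖S.e - S.ι ((toDual ℝ U).symm (fderiv ℝ γ u))‖ = graphDensity (fderiv ℝ γ u) := by
    rw [graphDensity]
    symm
    rw [Real.sqrt_eq_iff_eq_sq (by positivity) (norm_nonneg _)]
    have := norm_sq_add_smul_of_orthogonal S.norm_e S.inner_ι_e
      ((toDual ℝ U).symm (fderiv ℝ γ u)) (-1)
    rw [LinearIsometryEquiv.norm_map] at this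
    rw [norm_sub_rev, sub_eq_add_neg, ← neg_one_smul ℝ S.e, this]
    ring
  rw [normal, norm_smul, h1, norm_inv, Real.norm_of_nonneg (by positivity),
    inv_mul_cancel₀ (by positivity)]

theorem measurable_normal [MeasurableSpace U] [BorelSpace U] [MeasurableSpace E] [BorelSpace E]
    (γ : U → ℝ) : Measurable (S.normal γ) := by
  have h1 : Measurable (fderiv ℝ γ) := measurable_fderiv ℝ γ
  have h2 : Continuous fun A : U →L[ℝ] ℝ =>
      (graphDensity A)⁻¹ • (S.e - S.ι ((toDual ℝ U).symm A)) := by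
    refine (continuous_graphDensity.inv₀ fun A => ?_).smul ?_
    · have := one_le_graphDensity A; positivity
    · exact continuous_const.sub (S.ι.continuous.comp (toDual ℝ U).symm.continuous)
  exact h2.measurable.comp h1

end Normal

theorem finrank_eq {U E : Type*} [NormedAddCommGroup U] [InnerProductSpace ℝ U]
    [FiniteDimensional ℝ U] [NormedAddCommGroup E] [InnerProductSpace ℝ E]
    (S : HyperplaneSplitting U E) :
    finrank ℝ E = finrank ℝ U + 1 := by
  rw [← S.isometryEquiv.toLinearEquiv.finrank_eq,
    (WithLp.linearEquiv 2 ℝ (U × ℝ)).finrank_eq, Module.finrank_prod, finrank_self]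

end HyperplaneSplitting

/-! ### Surface measure, normal and divergence theorem in a boundary chart -/

/-- In the open set `O`, the set `Ω` is the strict subgraph of `γ`. -/
structure IsGraphChart {U E : Type*} [NormedAddCommGroup U] [InnerProductSpace ℝ U]
    [NormedAddCommGroup E] [InnerProductSpace ℝ E] (S : HyperplaneSplitting U E) (γ : U → ℝ)
    (Ω O : Set E) : Prop where
  isOpen : IsOpen O
  mem_iff : ∀ z ∈ O, (z ∈ Ω ↔ S.height γ z < 0)

namespace IsGraphChart

section Topology

variable {U E : Type*} [NormedAddCommGroup U] [InnerProductSpace ℝ U]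
  [NormedAddCommGroup E] [InnerProductSpace ℝ E] {S : HyperplaneSplitting U E} {γ : U → ℝ}
  {Ω O : Set E}

theorem mono (h : IsGraphChart S γ Ω O) {O' : Set E} (hO' : IsOpen O') (hsub : O' ⊆ O) :
    IsGraphChart S γ Ω O' :=
  ⟨hO', fun z hz => h.mem_iff z (hsub hz)⟩

/-- A point on the graph is the limit of points pushed down along -e, which lie in Ω; a point
strictly above it has a neighbourhood that avoids Ω. -/
theorem mem_closure_iff (h : IsGraphChart S γ Ω O) (hγ : Continuous γ) {z : E} (hz : z ∈ O) :
    z ∈ closure Ω ↔ S.height γ z ≤ 0 := by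
  have hc : Continuous (S.height γ) := by unfold HyperplaneSplitting.height; fun_prop
  constructor
  · intro hcl
    by_contra hpos
    rw [not_le] at hpos
    have h1 : ∀ᶠ y in 𝓝 z, y ∈ O ∧ 0 < S.height γ y :=
      (h.isOpen.eventually_mem hz).and (hc.continuousAt.eventually_const_lt hpos)
    obtain ⟨y, hy, hyΩ⟩ := ((mem_closure_iff_frequently.1 hcl).and_eventually h1).exists
    exact absurd ((h.mem_iff y hyΩ.1).1 hy) (not_lt.2 hyΩ.2.le)
  · intro hle
    have ht : Tendsto (fun s : ℝ => z - s • S.e) (𝓝[>] 0) (𝓝 z) := by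
      have : Continuous fun s : ℝ => z - s • S.e := by fun_prop
      have := this.tendsto 0
      simp only [zero_smul, sub_zero] at this
      exact this.mono_left nhdsWithin_le_nhds
    refine mem_closure_of_tendsto ht ?_
    filter_upwards [ht.eventually (h.isOpen.mem_nhds hz), self_mem_nhdsWithin] with s hs hs0
    refine (h.mem_iff _ hs).2 ?_
    have : S.height γ (z - s • S.e) = S.height γ z - s := by
      simp only [HyperplaneSplitting.height, inner_sub_right, inner_smul_right, map_sub, map_smul,
        S.inner_e_e, S.π_e]
      simp; ring
    rw [this]
    have : (0 : ℝ) < s := hs0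
    linarith

theorem mem_frontier_iff (h : IsGraphChart S γ Ω O) (hγ : Continuous γ) (hΩ : IsOpen Ω) {z : E}
    (hz : z ∈ O) : z ∈ frontier Ω ↔ z ∈ range (S.graph γ) := by
  rw [hΩ.frontier_eq, Set.mem_sdiff, h.mem_closure_iff hγ hz, h.mem_iff z hz, not_lt,
    ← S.height_eq_zero_iff]
  exact le_antisymm_iff.symm

theorem inter_frontier (h : IsGraphChart S γ Ω O) (hγ : Continuous γ) (hΩ : IsOpen Ω) :
    O ∩ frontier Ω = O ∩ range (S.graph γ) := by
  ext z
  exact and_congr_right fun hz => h.mem_frontier_iff hγ hΩ hz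

end Topology

variable {d : ℕ} {U : Type*} [NormedAddCommGroup U] [InnerProductSpace ℝ U] [FiniteDimensional ℝ U]
  {S : HyperplaneSplitting U (EuclideanSpace ℝ (Fin d))} {γ : U → ℝ}
  {Ω O : Set (EuclideanSpace ℝ (Fin d))}

/-- To first order, the height of z is J⟨z - y, ν⟩ with J ≥ 1 the graph density. As soon as |⟨z - y,
ν⟩| exceeds ε‖z - y‖, this term beats the remainder near y and decides on which side of the graph z
lies. -/
theorem isOutwardUnitNormalAt (h : IsGraphChart S γ Ω O) {u : U} (hu : DifferentiableAt ℝ γ u)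
    (hO : S.graph γ u ∈ O) : IsOutwardUnitNormalAt Ω (S.graph γ u) (S.normal γ u) := by
  refine ⟨S.norm_normal γ u, fun ε hε => ?_⟩
  set y := S.graph γ u with hy
  have hπ : S.π y = u := S.π_add u _
  have h0 : S.height γ y = 0 := (S.height_eq_zero_iff γ y).2 ⟨u, rfl⟩
  have hd := S.hasFDerivAt_height (γ := γ) (z := y) (by rwa [hπ])
  have hJ := one_le_graphDensity (fderiv ℝ γ u)
  filter_upwards [hd.isLittleO.def hε, h.isOpen.mem_nhds hO] with z hz hzO
  rw [h0, hπ, sub_zero] at hz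
  have h1 : (innerSL ℝ S.e - (fderiv ℝ γ u).comp S.π) (z - y) =
      graphDensity (fderiv ℝ γ u) * inner ℝ (z - y) (S.normal γ u) := by
    rw [real_inner_comm, S.graphDensity_mul_inner_normal]
    rfl
  rw [h1, Real.norm_eq_abs, abs_le] at hz
  have hn := norm_nonneg (z - y)
  rw [h.mem_iff z hzO, not_lt]
  have h3 : ε * ‖z - y‖ ≤ graphDensity (fderiv ℝ γ u) * (ε * ‖z - y‖) :=
    le_mul_of_one_le_left (by positivity) hJ
  constructor
  · intro hlt
    have h2 : graphDensity (fderiv ℝ γ u) * inner ℝ (z - y) (S.normal γ u) <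
      graphDensity (fderiv ℝ γ u) * -(ε * ‖z - y‖) := mul_lt_mul_of_pos_left hlt (by linarith)
    linarith
  · intro hlt
    have h2 : graphDensity (fderiv ℝ γ u) * (ε * ‖z - y‖) <
      graphDensity (fderiv ℝ γ u) * inner ℝ (z - y) (S.normal γ u) :=
      mul_lt_mul_of_pos_left hlt (by linarith)
    linarith

theorem outwardNormal_eq (h : IsGraphChart S γ Ω O) {u : U} (hu : DifferentiableAt ℝ γ u)
    (hO : S.graph γ u ∈ O) : outwardNormal Ω (S.graph γ u) = S.normal γ u := by
  have hex : ∃ ν, IsOutwardUnitNormalAt Ω (S.graph γ u) ν := ⟨_, h.isOutwardUnitNormalAt hu hO⟩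
  rw [outwardNormal, dif_pos hex]
  exact hex.choose_spec.unique (h.isOutwardUnitNormalAt hu hO)

variable [MeasurableSpace U] [BorelSpace U]

theorem surfaceMeasure_restrict (h : IsGraphChart S γ Ω O) {C : ℝ≥0} (hγ : LipschitzWith C γ)
    (hΩ : IsOpen Ω) :
    (surfaceMeasure Ω).restrict O =
      ((volume.withDensity fun x => ENNReal.ofReal (graphDensity (fderiv ℝ γ x))).map
        (S.graph γ)).restrict O := by
  have hd : d - 1 = finrank ℝ U := by
    have := S.finrank_eq
    rw [finrank_euclideanSpace_fin] at this
    omega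
  have harea := euclideanHausdorffMeasure_restrict_range_graphMap S.norm_e S.inner_ι_e hγ
  rw [surfaceMeasure, Measure.restrict_restrict h.isOpen.measurableSet,
    h.inter_frontier hγ.continuous hΩ, ← Measure.restrict_restrict h.isOpen.measurableSet, hd]
  exact congrArg (fun μ => Measure.restrict μ O) harea

/-- Rademacher's theorem, transported to the graph by the area formula. It makes `outwardNormal`,
which is defined by choice, agree almost everywhere with a measurable formula. -/
theorem ae_outwardNormal_eq (h : IsGraphChart S γ Ω O) {C : ℝ≥0} (hγ : LipschitzWith C γ)
    (hΩ : IsOpen Ω) :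
    ∀ᵐ y ∂(surfaceMeasure Ω).restrict O, outwardNormal Ω y = S.normal γ (S.π y) := by
  have hemb : MeasurableEmbedding (S.graph γ) :=
    measurableEmbedding_graphMap S.norm_e S.inner_ι_e hγ
  rw [h.surfaceMeasure_restrict hγ hΩ, ae_restrict_iff' h.isOpen.measurableSet, hemb.ae_map_iff]
  have hac : (volume.withDensity fun x => ENNReal.ofReal (graphDensity (fderiv ℝ γ x))) ≪
      (volume : Measure U) := withDensity_absolutelyContinuous _ _
  filter_upwards [hac.ae_le hγ.ae_differentiableAt] with u hu hO
  rw [h.outwardNormal_eq hu hO, S.graph_apply, S.π_add]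

theorem aestronglyMeasurable_outwardNormal (h : IsGraphChart S γ Ω O) {C : ℝ≥0}
    (hγ : LipschitzWith C γ) (hΩ : IsOpen Ω) :
    AEStronglyMeasurable (outwardNormal Ω) ((surfaceMeasure Ω).restrict O) :=
  ((S.measurable_normal γ).comp S.π.continuous.measurable).aestronglyMeasurable.congr
    ((h.ae_outwardNormal_eq hγ hΩ).mono fun _ hy => hy.symm)

theorem surfaceMeasure_lt_top (h : IsGraphChart S γ Ω O) {C : ℝ≥0} (hγ : LipschitzWith C γ)
    (hΩ : IsOpen Ω) (hO : Bornology.IsBounded O) : surfaceMeasure Ω O < ∞ := by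
  have hemb : MeasurableEmbedding (S.graph γ) :=
    measurableEmbedding_graphMap S.norm_e S.inner_ι_e hγ
  have hm := hemb.measurable h.isOpen.measurableSet
  rw [← Measure.restrict_apply_self, h.surfaceMeasure_restrict hγ hΩ, Measure.restrict_apply_self,
    hemb.map_apply, withDensity_apply _ hm]
  have hb : Bornology.IsBounded (S.graph γ ⁻¹' O) := by
    refine (S.π.lipschitz.isBounded_image hO).subset fun u hu => ⟨_, hu, S.π_add u _⟩
  refine setLIntegral_lt_top_of_le_nnreal hb.measure_lt_top.ne
    ⟨Real.toNNReal √(1 + (C : ℝ) ^ 2), fun u _ => ?_⟩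
  refine ENNReal.ofReal_le_ofReal (Real.sqrt_le_sqrt ?_)
  gcongr
  exact norm_fderiv_le_of_lipschitz ℝ hγ

theorem integral_surfaceMeasure (h : IsGraphChart S γ Ω O) {C : ℝ≥0} (hγ : LipschitzWith C γ)
    (hΩ : IsOpen Ω) {g : EuclideanSpace ℝ (Fin d) → ℝ} (hg : ∀ z ∉ O, g z = 0)
    (a : EuclideanSpace ℝ (Fin d)) :
    ∫ y, g y * inner ℝ (outwardNormal Ω y) a ∂surfaceMeasure Ω =
      ∫ u, S.slope γ a u * g (S.graph γ u) := by
  have hemb : MeasurableEmbedding (S.graph γ) :=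
    measurableEmbedding_graphMap S.norm_e S.inner_ι_e hγ
  have hm : Measurable fun x => Real.toNNReal (graphDensity (fderiv ℝ γ x)) :=
    (continuous_graphDensity.measurable.comp (measurable_fderiv ℝ γ)).real_toNNReal
  have hz : ∀ z ∉ O, g z * inner ℝ (outwardNormal Ω z) a = 0 := fun z hz => by
    rw [hg z hz, zero_mul]
  rw [← setIntegral_eq_integral_of_forall_compl_eq_zero hz, h.surfaceMeasure_restrict hγ hΩ,
    setIntegral_eq_integral_of_forall_compl_eq_zero hz, hemb.integral_map]
  change ∫ u, _ ∂(volume.withDensity fun x =>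
    ((Real.toNNReal (graphDensity (fderiv ℝ γ x)) : ℝ≥0) : ℝ≥0∞)) = _
  rw [integral_withDensity_eq_integral_smul hm]
  refine integral_congr_ae ?_
  filter_upwards [hγ.ae_differentiableAt] with u hu
  by_cases hO : S.graph γ u ∈ O
  · rw [h.outwardNormal_eq hu hO, NNReal.smul_def, Real.coe_toNNReal _ (by
      linarith [one_le_graphDensity (fderiv ℝ γ u)]), smul_eq_mul,
      ← S.graphDensity_mul_inner_normal]
    ring
  · simp [hg _ hO]

/-- The divergence theorem in a chart. -/
theorem integral_lineDeriv (h : IsGraphChart S γ Ω O) {C : ℝ≥0} (hγ : LipschitzWith C γ)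
    (hΩ : IsOpen Ω) {g : EuclideanSpace ℝ (Fin d) → ℝ} {K : ℝ≥0} (hg : LipschitzWith K g)
    (hs : HasCompactSupport g) (hsO : tsupport g ⊆ O) (a : EuclideanSpace ℝ (Fin d)) :
    ∫ z in (closure Ω)ᶜ, lineDeriv ℝ g z a =
      -∫ y, g y * inner ℝ (outwardNormal Ω y) a ∂surfaceMeasure Ω := by
  rw [h.integral_surfaceMeasure hγ hΩ fun z hz => image_eq_zero_of_notMem_tsupport
    fun hz' => hz (hsO hz'), ← S.integral_lineDeriv_above_graph hγ hg hs,
    ← integral_indicator isClosed_closure.measurableSet.compl, ← integral_indicator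
    (isOpen_lt continuous_const (S.lipschitzWith_height hγ).continuous).measurableSet]
  congr 1
  ext z
  by_cases hz : z ∈ tsupport g
  · simp only [indicator, mem_compl_iff, mem_ofPred_eq, h.mem_closure_iff hγ.continuous (hsO hz),
      not_le]
  · simp [indicator, lineDeriv_eq_zero_of_notMem_tsupport hz]

end IsGraphChart

/-! ### From charts to the whole compact boundary -/

theorem HasLipschitzBoundary.exists_isGraphChart {d : ℕ} {Ω : Set (EuclideanSpace ℝ (Fin d))}
    (h : HasLipschitzBoundary Ω) {y : EuclideanSpace ℝ (Fin d)} (hy : y ∈ frontier Ω) :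
    ∃ (e : EuclideanSpace ℝ (Fin d)) (he : ‖e‖ = 1) (γ : (ℝ ∙ e)ᗮ → ℝ) (C : ℝ≥0) (r : ℝ), 0 < r ∧
      LipschitzWith C γ ∧
        IsGraphChart (HyperplaneSplitting.ofUnit e he) γ Ω (Metric.ball y r) := by
  obtain ⟨e, γ, C, he, hγ, hev⟩ := h y hy
  obtain ⟨r, hr, hball⟩ := Metric.eventually_nhds_iff_ball.1 hev
  refine ⟨e, he, γ, C, r, hr, hγ, Metric.isOpen_ball, fun z hz => ?_⟩
  rw [hball z hz]
  exact sub_neg.symm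

theorem norm_outwardNormal_le {d : ℕ} (Ω : Set (EuclideanSpace ℝ (Fin d)))
    (y : EuclideanSpace ℝ (Fin d)) : ‖outwardNormal Ω y‖ ≤ 1 := by
  unfold outwardNormal
  split_ifs with h
  · exact h.choose_spec.1.le
  · simp

theorem isCompact_frontier {E : Type*} [NormedAddCommGroup E] [NormedSpace ℝ E]
    [FiniteDimensional ℝ E] {Ω : Set E} (hb : Bornology.IsBounded Ω) : IsCompact (frontier Ω) :=
  have := FiniteDimensional.proper_real E
  Metric.isCompact_of_isClosed_isBounded isClosed_frontier
    (hb.closure.subset frontier_subset_closure)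

section Surface

variable {d : ℕ} {Ω : Set (EuclideanSpace ℝ (Fin d))}

theorem isFiniteMeasure_surfaceMeasure (hΩ : IsOpen Ω) (hb : Bornology.IsBounded Ω)
    (hl : HasLipschitzBoundary Ω) : IsFiniteMeasure (surfaceMeasure Ω) := by
  have h1 : surfaceMeasure Ω (frontier Ω) < ∞ := by
    refine (isCompact_frontier hb).measure_lt_top_of_nhdsWithin fun y hy => ?_
    obtain ⟨e, he, γ, C, r, hr, hγ, hc⟩ := hl.exists_isGraphChart hy
    exact ⟨_, mem_nhdsWithin_of_mem_nhds (Metric.ball_mem_nhds y hr),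
      hc.surfaceMeasure_lt_top hγ hΩ Metric.isBounded_ball⟩
  refine ⟨?_⟩
  rwa [surfaceMeasure, Measure.restrict_apply_self, ← Measure.restrict_apply_univ] at h1

theorem aestronglyMeasurable_outwardNormal (hΩ : IsOpen Ω) (hb : Bornology.IsBounded Ω)
    (hl : HasLipschitzBoundary Ω) :
    AEStronglyMeasurable (outwardNormal Ω) (surfaceMeasure Ω) := by
  have h1 : AEStronglyMeasurable (outwardNormal Ω) ((surfaceMeasure Ω).restrict (frontier Ω)) := by
    refine (isCompact_frontier hb).induction_on
      (p := fun s => AEStronglyMeasurable (outwardNormal Ω) ((surfaceMeasure Ω).restrict s))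
      (by simp) (fun s t hst ht => ht.mono_set hst)
      (fun s t hs ht => aestronglyMeasurable_union_iff.2 ⟨hs, ht⟩) fun y hy => ?_
    obtain ⟨e, he, γ, C, r, hr, hγ, hc⟩ := hl.exists_isGraphChart hy
    exact ⟨_, mem_nhdsWithin_of_mem_nhds (Metric.ball_mem_nhds y hr),
      hc.aestronglyMeasurable_outwardNormal hγ hΩ⟩
  rwa [surfaceMeasure, Measure.restrict_restrict isClosed_frontier.measurableSet, inter_self] at h1

theorem ae_surfaceMeasure_mem_frontier (Ω : Set (EuclideanSpace ℝ (Fin d))) :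
    ∀ᵐ y ∂surfaceMeasure Ω, y ∈ frontier Ω :=
  ae_restrict_mem isClosed_frontier.measurableSet

theorem integrable_mul_inner_outwardNormal (hΩ : IsOpen Ω)
    (hb : Bornology.IsBounded Ω) (hl : HasLipschitzBoundary Ω)
    {f : EuclideanSpace ℝ (Fin d) → ℝ} (hf : ContinuousOn f (frontier Ω))
    (a : EuclideanSpace ℝ (Fin d)) :
    Integrable (fun y => f y * inner ℝ (outwardNormal Ω y) a) (surfaceMeasure Ω) := by
  have := isFiniteMeasure_surfaceMeasure hΩ hb hl
  obtain ⟨M, hM⟩ := (isCompact_frontier hb).exists_bound_of_continuousOn hf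
  refine Integrable.of_bound (C := M * ‖a‖) ?_ ?_
  · exact (hf.aestronglyMeasurable isClosed_frontier.measurableSet).mul
      ((aestronglyMeasurable_outwardNormal hΩ hb hl).inner aestronglyMeasurable_const)
  · filter_upwards [ae_surfaceMeasure_mem_frontier Ω] with y hy
    rw [norm_mul]
    have h1 : ‖inner ℝ (outwardNormal Ω y) a‖ ≤ ‖a‖ :=
      (norm_inner_le_norm _ _).trans (mul_le_of_le_one_left (norm_nonneg _)
        (norm_outwardNormal_le Ω y))
    exact mul_le_mul (hM y hy) h1 (norm_nonneg _) ((norm_nonneg _).trans (hM y hy))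

end Surface

/-! ### Regularity up to the boundary from outside -/

/-- A continuous function on a closed set which vanishes off a compact set is integrable. -/
theorem ContinuousOn.integrableOn_of_eq_zero_off_compact {X : Type*} [TopologicalSpace X]
    [T2Space X] [TopologicalSpace.PseudoMetrizableSpace X] [MeasurableSpace X]
    [BorelSpace X] {μ : Measure X} [IsFiniteMeasureOnCompacts μ] {A K : Set X} {F : X → ℝ}
    (hA : IsClosed A) (hK : IsCompact K) (hF : ContinuousOn F A)
    (h0 : ∀ z ∈ A, z ∉ K → F z = 0) : IntegrableOn F A μ := by
  have h1 : IntegrableOn F (A ∩ K) μ :=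
    (hF.mono inter_subset_left).integrableOn_compact (hK.inter_left hA)
  refine h1.of_forall_sdiff_eq_zero hA.measurableSet fun z hz =>
    h0 z hz.1 fun hzK => hz.2 ⟨hz.1, hzK⟩

/-- The factor g may be unbounded, but only its values on the support of f are needed: the product
increment is split so that g is evaluated at whichever of the two points lies in that support. -/
theorem LipschitzWith.mul_of_hasCompactSupport {X : Type*} [PseudoMetricSpace X] {f g : X → ℝ}
    {K L : ℝ≥0} (hf : LipschitzWith K f) (hg : LipschitzWith L g) (hs : HasCompactSupport f) :
    ∃ M, LipschitzWith M fun x => f x * g x := by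
  obtain ⟨A, hA⟩ := hs.exists_bound_of_continuous hf.continuous
  obtain ⟨B, hB⟩ := hs.isCompact.exists_bound_of_continuousOn hg.continuous.continuousOn
  have key : ∀ x y, x ∈ tsupport f → |f x * g x - f y * g y| ≤ (K * |B| + |A| * L) * dist x y := by
    intro x y hx
    have h1 := hf.dist_le_mul x y
    have h2 := hg.dist_le_mul x y
    rw [Real.dist_eq] at h1 h2
    have h3 : |g x| ≤ |B| := (hB x hx).trans (le_abs_self B)
    have h4 : |f y| ≤ |A| := (hA y).trans (le_abs_self A)
    calc _ = |(f x - f y) * g x + f y * (g x - g y)| := by congr 1; ring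
      _ ≤ |f x - f y| * |g x| + |f y| * |g x - g y| := by
        rw [← abs_mul, ← abs_mul]; exact abs_add_le _ _
      _ ≤ K * dist x y * |B| + |A| * (L * dist x y) := by gcongr
      _ = _ := by ring
  refine ⟨Real.toNNReal (K * |B| + |A| * L), LipschitzWith.of_dist_le_mul fun x y => ?_⟩
  rw [Real.coe_toNNReal _ (by positivity), Real.dist_eq]
  by_cases hx : x ∈ tsupport f
  · exact key x y hx
  by_cases hy : y ∈ tsupport f
  · rw [abs_sub_comm, dist_comm]; exact key y x hy
  · rw [image_eq_zero_of_notMem_tsupport hx, image_eq_zero_of_notMem_tsupport hy]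
    simp only [zero_mul, sub_zero, abs_zero]
    positivity

namespace IsGraphChart

variable {U E : Type*} [NormedAddCommGroup U] [InnerProductSpace ℝ U]
  [NormedAddCommGroup E] [InnerProductSpace ℝ E] {S : HyperplaneSplitting U E} {γ : U → ℝ}
  {Ω : Set E}

/-- This is the cone condition: the region above a C-Lipschitz graph contains, with each point, the
upward cone of slope C at that point. -/
theorem _root_.HyperplaneSplitting.height_add_inner_sub_le (S : HyperplaneSplitting U E)
    {C : ℝ≥0} (hγ : LipschitzWith C γ) (y z : E) :
    S.height γ y + (inner ℝ S.e (z - y) - C * ‖S.π (z - y)‖) ≤ S.height γ z := by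
  have h := hγ.dist_le_mul (S.π z) (S.π y)
  rw [Real.dist_eq, dist_eq_norm, ← map_sub] at h
  have := (abs_le.1 h).2
  rw [HyperplaneSplitting.height, HyperplaneSplitting.height, inner_sub_right]
  linarith

/-- The upward cone at y, cut off by the ball, is an open convex subset of the complement with y in
its closure. Hence one-sided derivatives at boundary points are well determined. -/
theorem uniqueDiffWithinAt_compl {y : E} {r : ℝ} (h : IsGraphChart S γ Ω (Metric.ball y r))
    (hr : 0 < r) {C : ℝ≥0} (hγ : LipschitzWith C γ) (hy : y ∉ Ω) : UniqueDiffWithinAt ℝ Ωᶜ y := by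
  have hy0 : 0 ≤ S.height γ y := by
    rw [← not_lt, ← h.mem_iff y (Metric.mem_ball_self hr)]; exact hy
  set Q : Set E := {z | C * ‖S.π (z - y)‖ < inner ℝ S.e (z - y)} ∩ Metric.ball y r with hQ
  have hQo : IsOpen Q := (isOpen_lt (by fun_prop) (by fun_prop)).inter Metric.isOpen_ball
  have hQΩ : Q ⊆ Ωᶜ := fun z hz => by
    rw [mem_compl_iff, h.mem_iff z hz.2, not_lt]
    have h1 : C * ‖S.π (z - y)‖ < inner ℝ S.e (z - y) := hz.1
    linarith [S.height_add_inner_sub_le hγ y z]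
  have hQm : ∀ s : ℝ, 0 < s → s < r → y + s • S.e ∈ Q := fun s h0 hs => by
    refine ⟨?_, ?_⟩
    · change C * ‖S.π (y + s • S.e - y)‖ < inner ℝ S.e (y + s • S.e - y)
      simp only [add_sub_cancel_left, map_smul, S.π_e, smul_zero, norm_zero, mul_zero,
        inner_smul_right, S.inner_e_e, mul_one]
      exact h0
    · simp [dist_eq_norm, norm_smul, S.norm_e, abs_of_pos h0, hs]
  have hQc : Convex ℝ Q := by
    refine Convex.inter ?_ (convex_ball y r)
    have : ConvexOn ℝ univ fun z => C * ‖S.π (z - y)‖ - inner ℝ S.e (z - y) := by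
      refine ⟨convex_univ, fun z _ w _ a b ha hb hab => ?_⟩
      have e1 : a • z + b • w - y = a • (z - y) + b • (w - y) := by
        have : y = (a + b) • y := by rw [hab, one_smul]
        conv_lhs => rw [this]
        module
      beta_reduce
      rw [e1]
      have n1 : ‖S.π (a • (z - y) + b • (w - y))‖ ≤ a * ‖S.π (z - y)‖ + b * ‖S.π (w - y)‖ := by
        rw [map_add, map_smul, map_smul]
        refine (norm_add_le _ _).trans ?_
        rw [norm_smul, norm_smul, Real.norm_of_nonneg ha, Real.norm_of_nonneg hb]
      simp only [inner_add_right, inner_smul_right, smul_eq_mul]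
      nlinarith [mul_le_mul_of_nonneg_left n1 C.coe_nonneg]
    have h2 := this.convex_lt 0
    convert! h2 using 1
    ext z
    simp [sub_neg]
  have hcl : y ∈ closure Q := by
    have ht : Tendsto (fun s : ℝ => y + s • S.e) (𝓝[>] 0) (𝓝 y) := by
      have : Continuous fun s : ℝ => y + s • S.e := by fun_prop
      have := this.tendsto 0
      simp only [zero_smul, add_zero] at this
      exact this.mono_left nhdsWithin_le_nhds
    refine mem_closure_of_tendsto ht ?_
    filter_upwards [self_mem_nhdsWithin, mem_nhdsWithin_of_mem_nhds (Iio_mem_nhds hr)] with s h0 hs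
    exact hQm s h0 hs
  refine (uniqueDiffWithinAt_convex hQc ?_ hcl).mono hQΩ
  rw [hQo.interior_eq]
  exact ⟨_, hQm (r / 2) (by linarith) (by linarith)⟩

end IsGraphChart

theorem HasLipschitzBoundary.uniqueDiffOn_compl {d : ℕ} {Ω : Set (EuclideanSpace ℝ (Fin d))}
    (hl : HasLipschitzBoundary Ω) : UniqueDiffOn ℝ Ωᶜ := by
  intro y hy
  by_cases hcl : y ∈ closure Ω
  · obtain ⟨e, he, γ, C, r, hr, hγ, hc⟩ :=
      hl.exists_isGraphChart (y := y) ⟨hcl, fun h => hy (interior_subset h)⟩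
    exact hc.uniqueDiffWithinAt_compl hr hγ hy
  · exact (uniqueDiffWithinAt_of_mem_nhds (isClosed_closure.isOpen_compl.mem_nhds hcl)).mono
      (compl_subset_compl.2 subset_closure)

/-- A gradient bound gives a Lipschitz bound only along paths, and the segment from z to w may cross
Ω. The detour goes up by M = C‖π(z - w)‖, across, and down again; its length is at most (1 + 2C)‖z -
w‖. The radius r' is small enough to keep the detour in the ball. -/
theorem IsGraphChart.exists_lipschitzOnWith {U E : Type*} [NormedAddCommGroup U]
    [InnerProductSpace ℝ U] [NormedAddCommGroup E] [InnerProductSpace ℝ E]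
    {S : HyperplaneSplitting U E} {γ : U → ℝ} {Ω : Set E} {y : E} {r : ℝ}
    (h : IsGraphChart S γ Ω (Metric.ball y r)) (hr : 0 < r) {C : ℝ≥0} (hγ : LipschitzWith C γ)
    {f : E → ℝ} {B : ℝ} (hB : 0 ≤ B) (hf : DifferentiableOn ℝ f Ωᶜ)
    (hfB : ∀ z ∈ Metric.ball y r, z ∈ Ωᶜ → ‖fderivWithin ℝ f Ωᶜ z‖ ≤ B) :
    ∃ (K : ℝ≥0) (r' : ℝ), 0 < r' ∧ r' ≤ r ∧ LipschitzOnWith K f (Ωᶜ ∩ Metric.ball y r') := by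
  have hC := C.coe_nonneg
  have hseg : ∀ z w : E, segment ℝ z w ⊆ Metric.ball y r → (∀ x ∈ segment ℝ z w, x ∈ Ωᶜ) →
      ‖f w - f z‖ ≤ B * ‖w - z‖ := fun z w hb hΩ =>
    (convex_segment z w).norm_image_sub_le_of_norm_hasFDerivWithin_le
      (f' := fun x => fderivWithin ℝ f Ωᶜ x)
      (fun x hx => ((hf x (hΩ x hx)).hasFDerivWithinAt).mono hΩ)
      (fun x hx => hfB x (hb hx) (hΩ x hx)) (left_mem_segment ℝ z w) (right_mem_segment ℝ z w)
  have hmem : ∀ z ∈ Metric.ball y r, (z ∈ Ωᶜ ↔ 0 ≤ S.height γ z) := fun z hz => by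
    rw [mem_compl_iff, h.mem_iff z hz, not_lt]
  set r' := r / (2 * (1 + C)) with hr'
  have hr'0 : 0 < r' := by positivity
  have hrr : r' * (2 * (1 + C)) = r := by rw [hr']; field_simp
  have hle : r' ≤ r := by nlinarith
  refine ⟨Real.toNNReal (B * (1 + 2 * C)), r', hr'0, hle, LipschitzOnWith.of_dist_le_mul ?_⟩
  rintro z ⟨hzΩ, hz⟩ w ⟨hwΩ, hw⟩
  have hzb := Metric.ball_subset_ball hle hz
  have hwb := Metric.ball_subset_ball hle hw
  rw [Real.coe_toNNReal _ (by positivity), Real.dist_eq, dist_eq_norm]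
  set M : ℝ := C * ‖S.π (z - w)‖ with hM
  have hM0 : 0 ≤ M := by positivity
  have hzw : ‖S.π (z - w)‖ ≤ ‖z - w‖ := S.norm_π_le _
  have hzw2 : ‖z - w‖ < 2 * r' := by
    rw [← dist_eq_norm]
    have := dist_triangle_right z w y
    rw [Metric.mem_ball] at hz hw
    linarith
  have hMr : M ≤ C * (2 * r') := by rw [hM]; gcongr; linarith
  have hup : ∀ x ∈ Metric.ball y r', ∀ s, 0 ≤ s → s ≤ M → x + s • S.e ∈ Metric.ball y r := by
    intro x hx s hs0 hs
    rw [Metric.mem_ball, dist_eq_norm] at hx ⊢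
    have : ‖x + s • S.e - y‖ ≤ ‖x - y‖ + s := by
      have e1 : x + s • S.e - y = (x - y) + s • S.e := by abel
      rw [e1]
      refine (norm_add_le _ _).trans ?_
      rw [norm_smul, S.norm_e, mul_one, Real.norm_of_nonneg hs0]
    nlinarith
  have hheight : ∀ x s, S.height γ (x + s • S.e) = S.height γ x + s := fun x s => by
    simp only [HyperplaneSplitting.height, inner_add_right, inner_smul_right, map_add, map_smul,
      S.inner_e_e, S.π_e, smul_zero, add_zero]
    ring
  have hvert : ∀ x ∈ Metric.ball y r', x ∈ Ωᶜ → ‖f (x + M • S.e) - f x‖ ≤ B * M := by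
    intro x hx hxΩ
    have hxs : ∀ p ∈ segment ℝ x (x + M • S.e), ∃ s, 0 ≤ s ∧ s ≤ M ∧ p = x + s • S.e := by
      rintro p ⟨a, b, ha, hb, hab, rfl⟩
      refine ⟨b * M, by positivity, by nlinarith, ?_⟩
      have : a = 1 - b := by linarith
      rw [this]; module
    have h1 : ∀ p ∈ segment ℝ x (x + M • S.e), p ∈ Metric.ball y r := fun p hp => by
      obtain ⟨s, h0, hs, rfl⟩ := hxs p hp
      exact hup x hx s h0 hs
    have := hseg x (x + M • S.e) h1 fun p hp => by
      rw [hmem p (h1 p hp)]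
      obtain ⟨s, h0, hs, rfl⟩ := hxs p hp
      rw [hheight]
      have := (hmem x (Metric.ball_subset_ball hle hx)).1 hxΩ
      linarith
    rwa [add_sub_cancel_left, norm_smul, S.norm_e, mul_one, Real.norm_of_nonneg hM0] at this
  have hhor : ‖f (w + M • S.e) - f (z + M • S.e)‖ ≤ B * ‖w - z‖ := by
    have hb : segment ℝ (z + M • S.e) (w + M • S.e) ⊆ Metric.ball y r :=
      (convex_ball y r).segment_subset (hup z hz M hM0 le_rfl) (hup w hw M hM0 le_rfl)
    have := hseg _ _ hb fun p hp => by
      rw [hmem p (hb hp)]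
      obtain ⟨a, b, ha, hb', hab, rfl⟩ := hp
      have hzh := (hmem z hzb).1 hzΩ
      have hwh := (hmem w hwb).1 hwΩ
      have e1 : a • (z + M • S.e) + b • (w + M • S.e) = (a • z + b • w) + M • S.e := by
        have : M = (a + b) * M := by rw [hab, one_mul]
        conv_rhs => rw [this]
        module
      rw [e1, hheight]
      -- Averaging the cone estimates at z and w with weights a and b, the inner products cancel and
      -- the height of q is at least -2abM ≥ -M/2. After lifting by M the segment therefore lies
      -- above the graph.
      set q := a • z + b • w
      have hq1 := S.height_add_inner_sub_le hγ z q
      have hq2 := S.height_add_inner_sub_le hγ w q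
      have ha' : a = 1 - b := by linarith
      have d1 : q - z = (-b) • (z - w) := by simp only [q, ha']; module
      have d2 : q - w = a • (z - w) := by
        have : b = 1 - a := by linarith
        simp only [q, this]; module
      rw [d1, map_smul, norm_smul, norm_neg, Real.norm_of_nonneg hb', inner_smul_right] at hq1
      rw [d2, map_smul, norm_smul, Real.norm_of_nonneg ha, inner_smul_right] at hq2
      have hc1 := mul_le_mul_of_nonneg_left hq1 ha
      have hc2 := mul_le_mul_of_nonneg_left hq2 hb'
      have hab1 : a * b ≤ 1 / 4 := by nlinarith [sq_nonneg (a - b)]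
      have hsum : a * S.height γ q + b * S.height γ q = S.height γ q := by
        rw [← add_mul, hab, one_mul]
      have : 2 * (a * b) * M ≤ M := by nlinarith
      have p1 := mul_nonneg ha hzh
      have p2 := mul_nonneg hb' hwh
      nlinarith
    rwa [add_sub_add_right_eq_sub] at this
  have v1 := hvert z hz hzΩ
  have v2 := hvert w hw hwΩ
  rw [norm_sub_rev w z] at hhor
  simp only [Real.norm_eq_abs] at hhor v1 v2
  have tri : |f z - f w| ≤ |f (z + M • S.e) - f z| + |f (w + M • S.e) - f (z + M • S.e)| +
      |f (w + M • S.e) - f w| := by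
    have e1 : f z - f w = -(f (z + M • S.e) - f z) - (f (w + M • S.e) - f (z + M • S.e)) +
      (f (w + M • S.e) - f w) := by ring
    rw [e1]
    refine (abs_add_le _ _).trans ?_
    gcongr
    refine (abs_sub _ _).trans ?_
    rw [abs_neg]
  have hMz : M ≤ C * ‖z - w‖ := by rw [hM]; gcongr
  nlinarith [mul_le_mul_of_nonneg_left hMz hB]

/-! ### The divergence theorem in the exterior domain -/

section Divergence

variable {d : ℕ} {Ω : Set (EuclideanSpace ℝ (Fin d))}

theorem compl_closure_subset_compl {X : Type*} [TopologicalSpace X] (Ω : Set X) :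
    (closure Ω)ᶜ ⊆ Ωᶜ :=
  compl_subset_compl.2 subset_closure

theorem frontier_subset_compl {X : Type*} [TopologicalSpace X] {Ω : Set X} (hΩ : IsOpen Ω) :
    frontier Ω ⊆ Ωᶜ := fun _ hy => by
  rw [hΩ.frontier_eq] at hy; exact hy.2

theorem compl_mem_nhds_of_notMem_closure {X : Type*} [TopologicalSpace X] {Ω : Set X} {z : X}
    (hz : z ∉ closure Ω) : Ωᶜ ∈ 𝓝 z :=
  mem_of_superset (isClosed_closure.isOpen_compl.mem_nhds hz) (compl_closure_subset_compl Ω)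

/-- The flux identity for the function `p` in the direction `a`. -/
def HasExteriorFlux (Ω : Set (EuclideanSpace ℝ (Fin d))) (a : EuclideanSpace ℝ (Fin d))
    (p : EuclideanSpace ℝ (Fin d) → ℝ) : Prop :=
  ∫ z in (closure Ω)ᶜ, fderiv ℝ p z a = -∫ y, p y * inner ℝ (outwardNormal Ω y) a ∂surfaceMeasure Ω

theorem ContDiffOn.integrableOn_fderiv_exterior (hΩ : IsOpen Ω) (hl : HasLipschitzBoundary Ω)
    {p : EuclideanSpace ℝ (Fin d) → ℝ} (hp : ContDiffOn ℝ 1 p Ωᶜ) (hs : HasCompactSupport p)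
    (a : EuclideanSpace ℝ (Fin d)) :
    IntegrableOn (fun z => fderiv ℝ p z a) (closure Ω)ᶜ := by
  have hu := hl.uniqueDiffOn_compl
  have h1 : ContinuousOn (fun z => fderivWithin ℝ p Ωᶜ z a) Ωᶜ :=
    (hp.continuousOn_fderivWithin hu le_rfl).clm_apply continuousOn_const
  have h3 : IntegrableOn (fun z => (tsupport p).indicator (fun z => fderivWithin ℝ p Ωᶜ z a) z)
      Ωᶜ := by
    have := (h1.mono inter_subset_left).integrableOn_compact (μ := volume)
      (hs.isCompact.inter_left hΩ.isClosed_compl)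
    rw [IntegrableOn, integrable_indicator_iff hs.measurableSet, IntegrableOn,
      Measure.restrict_restrict hs.measurableSet, inter_comm]
    exact this
  refine (h3.mono_set (compl_closure_subset_compl Ω)).congr_fun (fun z hz => ?_)
    isClosed_closure.measurableSet.compl
  by_cases hzs : z ∈ tsupport p
  · simp only [indicator_of_mem hzs, fderivWithin_of_mem_nhds (compl_mem_nhds_of_notMem_closure hz)]
  · simp only [indicator_of_notMem hzs]
    rw [(notMem_tsupport_iff_eventuallyEq.1 hzs).fderiv_eq]
    simp

theorem hasExteriorFlux_of_tsupport_subset_exterior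
    {p : EuclideanSpace ℝ (Fin d) → ℝ} (hp : ContDiff ℝ 1 p) (hs : HasCompactSupport p)
    (hsub : tsupport p ⊆ (closure Ω)ᶜ) (a : EuclideanSpace ℝ (Fin d)) : HasExteriorFlux Ω a p := by
  obtain ⟨K, hK⟩ := hp.lipschitzWith_of_hasCompactSupport hs one_ne_zero
  have h1 := (LipschitzWith.const (α := EuclideanSpace ℝ (Fin d)) (1 : ℝ)).integral_lineDeriv_mul_eq
    (μ := volume) hK hs a
  have h2 : ∫ z, fderiv ℝ p z a = 0 := by
    simp only [map_neg, (hp.differentiable one_ne_zero _).lineDeriv_eq_fderiv, mul_one,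
      integral_neg] at h1
    rw [eq_comm, neg_eq_iff_eq_neg] at h1
    rw [h1]
    simp [lineDeriv]
  rw [HasExteriorFlux, setIntegral_eq_integral_of_forall_compl_eq_zero, h2, eq_comm, neg_eq_zero]
  · refine integral_eq_zero_of_ae ?_
    filter_upwards [ae_surfaceMeasure_mem_frontier Ω] with y hy
    have : p y = 0 := image_eq_zero_of_notMem_tsupport fun h =>
      hsub h (frontier_subset_closure hy)
    simp [this]
  · intro z hz
    have : z ∉ tsupport p := fun h => hz (hsub h)
    rw [(notMem_tsupport_iff_eventuallyEq.1 this).fderiv_eq]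
    simp

theorem hasExteriorFlux_of_tsupport_subset (hΩ : IsOpen Ω)
    {p : EuclideanSpace ℝ (Fin d) → ℝ} (hsub : tsupport p ⊆ Ω) (a : EuclideanSpace ℝ (Fin d)) :
    HasExteriorFlux Ω a p := by
  have h1 : ∫ z in (closure Ω)ᶜ, fderiv ℝ p z a = 0 := by
    refine setIntegral_eq_zero_of_forall_eq_zero fun z hz => ?_
    have : z ∉ tsupport p := fun h => hz (subset_closure (hsub h))
    rw [(notMem_tsupport_iff_eventuallyEq.1 this).fderiv_eq]
    simp
  rw [HasExteriorFlux, h1, eq_comm, neg_eq_zero]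
  refine integral_eq_zero_of_ae ?_
  filter_upwards [ae_surfaceMeasure_mem_frontier Ω] with y hy
  have : p y = 0 := image_eq_zero_of_notMem_tsupport fun h => frontier_subset_compl hΩ hy (hsub h)
  simp [this]

/-- The local statement in the form a partition of unity needs. Only a boundary point y is delicate:
f may be arbitrary in Ω, so near y it is replaced by a Lipschitz extension of its restriction to the
complement. Neither side of the flux identity sees the values in Ω, and the chart version needs only
Lipschitz functions. -/
theorem exists_hasExteriorFlux_nhds (hΩ : IsOpen Ω) (hl : HasLipschitzBoundary Ω)
    {f : EuclideanSpace ℝ (Fin d) → ℝ} (hf : ContDiffOn ℝ 1 f Ωᶜ) (hfs : HasCompactSupport f)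
    (a y : EuclideanSpace ℝ (Fin d)) :
    ∃ W, IsOpen W ∧ y ∈ W ∧ ∀ χ : EuclideanSpace ℝ (Fin d) → ℝ, ContDiff ℝ 1 χ →
      tsupport χ ⊆ W → HasExteriorFlux Ω a fun z => χ z * f z := by
  have hu := hl.uniqueDiffOn_compl
  by_cases hyΩ : y ∈ Ω
  · exact ⟨Ω, hΩ, hyΩ, fun χ _ hsub => hasExteriorFlux_of_tsupport_subset hΩ
      ((tsupport_mul_subset_left (f := χ) (g := f)).trans hsub) a⟩
  by_cases hcl : y ∈ closure Ω
  swap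
  · refine ⟨(closure Ω)ᶜ, isClosed_closure.isOpen_compl, hcl, fun χ hχ hsub => ?_⟩
    have hts : tsupport (fun z => χ z * f z) ⊆ (closure Ω)ᶜ :=
      (tsupport_mul_subset_left (f := χ) (g := f)).trans hsub
    refine hasExteriorFlux_of_tsupport_subset_exterior ?_ (hfs.mul_left (f := χ)) hts a
    rw [contDiff_iff_contDiffAt]
    intro z
    by_cases hz : z ∈ tsupport fun z => χ z * f z
    · exact hχ.contDiffAt.mul (hf.contDiffAt (compl_mem_nhds_of_notMem_closure (hts hz)))
    · exact contDiffAt_const.congr_of_eventuallyEq (notMem_tsupport_iff_eventuallyEq.1 hz)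
  obtain ⟨e, he, γ, C, r, hr, hγ, hc⟩ :=
    hl.exists_isGraphChart (y := y) ⟨hcl, fun h => hyΩ (interior_subset h)⟩
  have hcont : ContinuousOn (fderivWithin ℝ f Ωᶜ) Ωᶜ := hf.continuousOn_fderivWithin hu le_rfl
  set B : ℝ := ‖fderivWithin ℝ f Ωᶜ y‖ + 1 with hB
  have hev : ∀ᶠ z in 𝓝[Ωᶜ] y, ‖fderivWithin ℝ f Ωᶜ z‖ < B :=
    (hcont y hyΩ).norm.eventually_lt_const (lt_add_one _)
  rw [eventually_nhdsWithin_iff] at hev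
  obtain ⟨r₁, hr₁, hball⟩ := Metric.eventually_nhds_iff_ball.1 hev
  have hc' := hc.mono (Metric.isOpen_ball (x := y) (ε := min r r₁))
    (Metric.ball_subset_ball (min_le_left _ _))
  obtain ⟨K, r', hr', hr'r, hLip⟩ := hc'.exists_lipschitzOnWith (lt_min hr hr₁) hγ (B := B)
    (by positivity) (hf.differentiableOn one_ne_zero)
    fun z hz hzΩ => (hball z (Metric.ball_subset_ball (min_le_right _ _) hz) hzΩ).le
  have hc'' := hc'.mono (Metric.isOpen_ball (x := y) (ε := r')) (Metric.ball_subset_ball hr'r)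
  obtain ⟨g, hg, hgf⟩ := hLip.extend_real
  refine ⟨Metric.ball y r', Metric.isOpen_ball, Metric.mem_ball_self hr', fun χ hχ hsub => ?_⟩
  have hχs : HasCompactSupport χ := Metric.isCompact_of_isClosed_isBounded (isClosed_tsupport χ)
    (Metric.isBounded_ball.subset hsub)
  obtain ⟨L, hL⟩ := hχ.lipschitzWith_of_hasCompactSupport hχs one_ne_zero
  obtain ⟨M, hM⟩ := hL.mul_of_hasCompactSupport hg hχs
  have hkey := hc''.integral_lineDeriv hγ hΩ hM (hχs.mul_right (f' := g))
    ((tsupport_mul_subset_left (f := χ) (g := g)).trans hsub) a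
  have heq : ∀ z ∈ Ωᶜ, χ z * g z = χ z * f z := fun z hz => by
    by_cases hzb : z ∈ Metric.ball y r'
    · rw [hgf ⟨hz, hzb⟩]
    · rw [image_eq_zero_of_notMem_tsupport fun h => hzb (hsub h), zero_mul, zero_mul]
  rw [HasExteriorFlux]
  calc _ = ∫ z in (closure Ω)ᶜ, lineDeriv ℝ (fun z => χ z * g z) z a := by
        refine setIntegral_congr_fun isClosed_closure.measurableSet.compl fun z hz => ?_
        have hn := compl_mem_nhds_of_notMem_closure hz
        have hd : DifferentiableAt ℝ (fun z => χ z * f z) z :=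
          (hχ.differentiable one_ne_zero z).mul
            ((hf.contDiffAt hn).differentiableAt one_ne_zero)
        have hee : (fun z => χ z * g z) =ᶠ[𝓝 z] fun z => χ z * f z := by
          filter_upwards [hn] with w hw using heq w hw
        beta_reduce
        rw [hee.lineDeriv_eq, hd.lineDeriv_eq_fderiv]
    _ = _ := hkey
    _ = _ := by
        congr 1
        refine integral_congr_ae ?_
        filter_upwards [ae_surfaceMeasure_mem_frontier Ω] with w hw
        rw [heq w (frontier_subset_compl hΩ hw)]

/-- **Divergence theorem** in the exterior of a bounded Lipschitz domain. -/
theorem hasExteriorFlux_of_contDiffOn (hΩ : IsOpen Ω) (hb : Bornology.IsBounded Ω)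
    (hl : HasLipschitzBoundary Ω) {f : EuclideanSpace ℝ (Fin d) → ℝ} (hf : ContDiffOn ℝ 1 f Ωᶜ)
    (hfs : HasCompactSupport f) (a : EuclideanSpace ℝ (Fin d)) : HasExteriorFlux Ω a f := by
  choose W hWo hyW hW using exists_hasExteriorFlux_nhds hΩ hl hf hfs a
  obtain ⟨t, -, ht⟩ := hfs.isCompact.elim_nhds_subcover W fun y _ => (hWo y).mem_nhds (hyW y)
  obtain ⟨ρ, hρ⟩ := SmoothPartitionOfUnity.exists_isSubordinate (modelWithCornersSelf ℝ
    (EuclideanSpace ℝ (Fin d))) (isClosed_tsupport f) (fun i : t => W i) (fun i => hWo i)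
    (ht.trans fun z hz => by
      obtain ⟨i, hi, hzi⟩ := mem_iUnion₂.1 hz
      exact mem_iUnion.2 ⟨⟨i, hi⟩, hzi⟩)
  have hρs : ∀ i, ContDiff ℝ 1 (ρ i) := fun i =>
    (ρ i).contMDiff.contDiff.of_le (by exact_mod_cast le_top)
  have hsum : ∀ z, f z = ∑ i, ρ i z * f z := fun z => by
    by_cases hz : z ∈ tsupport f
    · rw [← Finset.sum_mul, ← finsum_eq_sum_of_fintype, ρ.sum_eq_one hz, one_mul]
    · simp [image_eq_zero_of_notMem_tsupport hz]
  have hpi : ∀ i, ContDiffOn ℝ 1 (fun z => ρ i z * f z) Ωᶜ := fun i =>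
    (hρs i).contDiffOn.mul hf
  have hps : ∀ i, HasCompactSupport (fun z => ρ i z * f z) := fun i => hfs.mul_left
  have hfd : ∀ z ∈ (closure Ω)ᶜ, fderiv ℝ f z a = ∑ i, fderiv ℝ (fun z => ρ i z * f z) z a := by
    intro z hz
    have hn := compl_mem_nhds_of_notMem_closure hz
    conv_lhs => rw [funext hsum]
    rw [fderiv_fun_sum fun i _ => ((hpi i).contDiffAt hn).differentiableAt one_ne_zero]
    simp
  rw [HasExteriorFlux, setIntegral_congr_fun isClosed_closure.measurableSet.compl hfd,
    integral_finsetSum _ fun i _ => (hpi i).integrableOn_fderiv_exterior hΩ hl (hps i) a]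
  have hsurf : ∫ y, f y * inner ℝ (outwardNormal Ω y) a ∂surfaceMeasure Ω =
      ∑ i, ∫ y, ρ i y * f y * inner ℝ (outwardNormal Ω y) a ∂surfaceMeasure Ω := by
    rw [← integral_finsetSum _ fun i _ => integrable_mul_inner_outwardNormal hΩ hb hl
      ((hpi i).continuousOn.mono (frontier_subset_compl hΩ)) a]
    congr 1
    ext y
    rw [← Finset.sum_mul, ← hsum]
  rw [hsurf, ← Finset.sum_neg_distrib]
  exact Finset.sum_congr rfl fun i _ => hW i (ρ i) (hρs i) (hρ i)

end Divergence

/-! ### Green's second identity and the product rule for the Laplacian -/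

theorem ContDiffAt.hasFDerivAt_fderiv_apply {E : Type*} [NormedAddCommGroup E] [NormedSpace ℝ E]
    {u : E → ℝ} {z : E} (hu : ContDiffAt ℝ 2 u z) (c : E) :
    HasFDerivAt (fun z => fderiv ℝ u z c) ((fderiv ℝ (fderiv ℝ u) z).flip c) z := by
  have h : DifferentiableAt ℝ (fderiv ℝ u) z :=
    (hu.fderiv_right (m := 1) (by norm_num)).differentiableAt one_ne_zero
  simpa using h.hasFDerivAt.clm_apply (hasFDerivAt_const c z)

theorem laplacian_eq_sum_fderiv {d : ℕ} (u : EuclideanSpace ℝ (Fin d) → ℝ)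
    (z : EuclideanSpace ℝ (Fin d)) :
    Laplacian.laplacian u z = ∑ i, fderiv ℝ (fderiv ℝ u) z (EuclideanSpace.basisFun (Fin d) ℝ i)
      (EuclideanSpace.basisFun (Fin d) ℝ i) := by
  rw [laplacian_eq_iteratedFDeriv_orthonormalBasis u (EuclideanSpace.basisFun (Fin d) ℝ)]
  simp [iteratedFDeriv_two_apply]

section Green

variable {d : ℕ} {Ω : Set (EuclideanSpace ℝ (Fin d))}

theorem sum_apply_basis_mul_inner {d : ℕ} (A : EuclideanSpace ℝ (Fin d) →L[ℝ] ℝ)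
    (n : EuclideanSpace ℝ (Fin d)) :
    ∑ i, A (EuclideanSpace.basisFun (Fin d) ℝ i) *
      inner ℝ n (EuclideanSpace.basisFun (Fin d) ℝ i) = A n := by
  conv_rhs => rw [← (EuclideanSpace.basisFun (Fin d) ℝ).sum_repr' n, map_sum]
  refine Finset.sum_congr rfl fun i _ => ?_
  rw [map_smul, smul_eq_mul, mul_comm, real_inner_comm]

/-- **Green's second identity** in the exterior of a bounded Lipschitz domain. -/
theorem green_second_identity_exterior (hΩ : IsOpen Ω) (hb : Bornology.IsBounded Ω)
    (hl : HasLipschitzBoundary Ω) {u w : EuclideanSpace ℝ (Fin d) → ℝ}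
    (hu : ContDiffOn ℝ 2 u Ωᶜ) (hw : ContDiff ℝ 2 w) (hws : HasCompactSupport w) :
    ∫ z in (closure Ω)ᶜ, (w z * Laplacian.laplacian u z - u z * Laplacian.laplacian w z) =
      -∫ y, (fderivWithin ℝ u Ωᶜ y (outwardNormal Ω y) * w y
        - u y * fderiv ℝ w y (outwardNormal Ω y)) ∂surfaceMeasure Ω := by
  set b := EuclideanSpace.basisFun (Fin d) ℝ with hbdef
  have hud := hl.uniqueDiffOn_compl
  -- These are the components of w∇u - u∇w. The derivative of u is taken within the complement so
  -- that `f i` is C¹ up to the boundary. In the divergence the products of first derivatives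
  -- cancel.
  set f : Fin d → EuclideanSpace ℝ (Fin d) → ℝ := fun i z =>
    w z * fderivWithin ℝ u Ωᶜ z (b i) - u z * fderiv ℝ w z (b i) with hf
  have hfc : ∀ i, ContDiffOn ℝ 1 (f i) Ωᶜ := fun i => by
    have h1 : ContDiffOn ℝ 1 (fun z => fderivWithin ℝ u Ωᶜ z (b i)) Ωᶜ :=
      (hu.fderivWithin hud (m := 1) (by norm_num)).clm_apply contDiffOn_const
    have h2 : ContDiff ℝ 1 (fun z => fderiv ℝ w z (b i)) :=
      (hw.fderiv_right (m := 1) (by norm_num)).clm_apply contDiff_const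
    exact ((hw.of_le (by norm_num)).contDiffOn.mul h1).sub
      ((hu.of_le (by norm_num)).mul h2.contDiffOn)
  have hfs : ∀ i, HasCompactSupport (f i) := fun i =>
    hws.mul_right.sub ((hws.fderiv_apply ℝ (b i)).mul_left)
  have hfd : ∀ z ∈ (closure Ω)ᶜ, w z * Laplacian.laplacian u z - u z * Laplacian.laplacian w z =
      ∑ i, fderiv ℝ (f i) z (b i) := fun z hz => by
    have hn := compl_mem_nhds_of_notMem_closure hz
    have huz : ContDiffAt ℝ 2 u z := hu.contDiffAt hn
    rw [laplacian_eq_sum_fderiv, laplacian_eq_sum_fderiv, Finset.mul_sum, Finset.mul_sum,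
      ← Finset.sum_sub_distrib]
    refine Finset.sum_congr rfl fun i _ => ?_
    have hee : f i =ᶠ[𝓝 z] fun z => w z * fderiv ℝ u z (b i) - u z * fderiv ℝ w z (b i) := by
      filter_upwards [isClosed_closure.isOpen_compl.mem_nhds hz] with y hy
      simp only [hf, fderivWithin_of_mem_nhds (compl_mem_nhds_of_notMem_closure hy)]
    have hwz := (hw.differentiable two_ne_zero z).hasFDerivAt
    have huz' := (huz.differentiableAt two_ne_zero).hasFDerivAt
    have hd := (hwz.fun_mul (huz.hasFDerivAt_fderiv_apply (b i))).fun_sub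
      (huz'.fun_mul (hw.contDiffAt.hasFDerivAt_fderiv_apply (b i)))
    rw [hee.fderiv_eq, HasFDerivAt.fderiv hd]
    simp [hbdef]
    ring
  rw [setIntegral_congr_fun isClosed_closure.measurableSet.compl hfd,
    integral_finsetSum _ fun i _ => (hfc i).integrableOn_fderiv_exterior hΩ hl (hfs i) (b i)]
  have hsurf : ∫ y, (fderivWithin ℝ u Ωᶜ y (outwardNormal Ω y) * w y
        - u y * fderiv ℝ w y (outwardNormal Ω y)) ∂surfaceMeasure Ω =
      ∑ i, ∫ y, f i y * inner ℝ (outwardNormal Ω y) (b i) ∂surfaceMeasure Ω := by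
    rw [← integral_finsetSum _ fun i _ => integrable_mul_inner_outwardNormal hΩ hb hl
      ((hfc i).continuousOn.mono (frontier_subset_compl hΩ)) (b i)]
    congr 1
    ext y
    rw [← sum_apply_basis_mul_inner (fderivWithin ℝ u Ωᶜ y) (outwardNormal Ω y),
      ← sum_apply_basis_mul_inner (fderiv ℝ w y) (outwardNormal Ω y), Finset.sum_mul,
      Finset.mul_sum, ← Finset.sum_sub_distrib]
    refine Finset.sum_congr rfl fun i _ => ?_
    simp only [hf]
    ring
  rw [hsurf, ← Finset.sum_neg_distrib]
  exact Finset.sum_congr rfl fun i _ => hasExteriorFlux_of_contDiffOn hΩ hb hl (hfc i) (hfs i) (b i)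

end Green

theorem laplacian_mul {d : ℕ} {p q : EuclideanSpace ℝ (Fin d) → ℝ} (hp : ContDiff ℝ 2 p)
    (hq : ContDiff ℝ 2 q) (z : EuclideanSpace ℝ (Fin d)) :
    Laplacian.laplacian (fun z => p z * q z) z = p z * Laplacian.laplacian q z +
      2 * (∑ i, fderiv ℝ p z (EuclideanSpace.basisFun (Fin d) ℝ i) *
        fderiv ℝ q z (EuclideanSpace.basisFun (Fin d) ℝ i)) + q z * Laplacian.laplacian p z := by
  rw [laplacian_eq_sum_fderiv, laplacian_eq_sum_fderiv, laplacian_eq_sum_fderiv, Finset.mul_sum,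
    Finset.mul_sum, Finset.mul_sum, ← Finset.sum_add_distrib, ← Finset.sum_add_distrib]
  refine Finset.sum_congr rfl fun i _ => ?_
  set c := EuclideanSpace.basisFun (Fin d) ℝ i
  have h1 := ((hp.mul hq).contDiffAt (x := z)).hasFDerivAt_fderiv_apply c
  have h2 : (fun z => fderiv ℝ (fun z => p z * q z) z c) =
      fun z => p z * fderiv ℝ q z c + q z * fderiv ℝ p z c := by
    ext y
    rw [fderiv_fun_mul (hp.differentiable two_ne_zero y) (hq.differentiable two_ne_zero y)]
    simp
  have hpz := (hp.differentiable two_ne_zero z).hasFDerivAt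
  have hqz := (hq.differentiable two_ne_zero z).hasFDerivAt
  have h3 := (hpz.fun_mul (hq.contDiffAt.hasFDerivAt_fderiv_apply c)).fun_add
    (hqz.fun_mul (hp.contDiffAt.hasFDerivAt_fderiv_apply c))
  rw [← h2] at h3
  have h4 := congrArg (fun A => A c) (h1.unique h3)
  simp only [ContinuousLinearMap.flip_apply, add_apply,
    smul_apply, smul_eq_mul] at h4
  rw [h4]
  ring

/-! ### The heat kernel: derivatives, decay and approximate identity -/

section HeatKernel

variable {d : ℕ} {k : ℝ}

theorem heatKernel_of_pos (k : ℝ) (z : EuclideanSpace ℝ (Fin d)) {τ : ℝ} (hτ : 0 < τ) :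
    heatKernel k z τ =
      (4 * Real.pi * k * τ) ^ (-(d : ℝ) / 2) * Real.exp (-‖z‖ ^ 2 / (4 * k * τ)) := by
  rw [heatKernel, if_pos hτ]

theorem heatKernel_nonneg (hk : 0 < k) (z : EuclideanSpace ℝ (Fin d)) (τ : ℝ) :
    0 ≤ heatKernel k z τ := by
  unfold heatKernel
  split_ifs
  · positivity
  · exact le_rfl

theorem contDiff_heatKernel (k : ℝ) (x : EuclideanSpace ℝ (Fin d)) (τ : ℝ) {n : WithTop ℕ∞} :
    ContDiff ℝ n fun y => heatKernel k (x - y) τ := by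
  unfold heatKernel
  split_ifs
  · have : ContDiff ℝ n fun y : EuclideanSpace ℝ (Fin d) => ‖x - y‖ ^ 2 :=
      (contDiff_const.sub contDiff_id).norm_sq ℝ
    exact contDiff_const.mul ((this.neg.div_const _).exp)
  · exact contDiff_const

theorem hasFDerivAt_heatKernel (hk : 0 < k) (x y : EuclideanSpace ℝ (Fin d)) {τ : ℝ}
    (hτ : 0 < τ) :
    HasFDerivAt (fun y => heatKernel k (x - y) τ)
      ((heatKernel k (x - y) τ / (2 * k * τ)) • innerSL ℝ (x - y)) y := by
  simp only [heatKernel_of_pos k _ hτ]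
  have h1 : HasFDerivAt (fun y : EuclideanSpace ℝ (Fin d) => ‖x - y‖ ^ 2)
      (2 • (innerSL ℝ (x - y)).comp (-ContinuousLinearMap.id ℝ _)) y :=
    ((hasFDerivAt_id y).const_sub x).norm_sq
  have h2 := ((h1.neg.mul_const (4 * k * τ)⁻¹).exp.const_mul
    ((4 * Real.pi * k * τ) ^ (-(d : ℝ) / 2)))
  simp only [← div_eq_mul_inv] at h2
  refine h2.congr_fderiv ?_
  ext c
  simp
  field_simp
  ring

theorem fderiv_heatKernel_apply (hk : 0 < k) (x y c : EuclideanSpace ℝ (Fin d)) {τ : ℝ}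
    (hτ : 0 < τ) :
    fderiv ℝ (fun y => heatKernel k (x - y) τ) y c =
      heatKernel k (x - y) τ / (2 * k * τ) * inner ℝ (x - y) c := by
  rw [(hasFDerivAt_heatKernel hk x y hτ).fderiv]
  rfl

theorem laplacian_heatKernel (hk : 0 < k) (x y : EuclideanSpace ℝ (Fin d)) {τ : ℝ} (hτ : 0 < τ) :
    Laplacian.laplacian (fun y : EuclideanSpace ℝ (Fin d) => heatKernel k (x - y) τ) y =
      (-d / (2 * k * τ) + ‖x - y‖ ^ 2 / (2 * k * τ) ^ 2) * heatKernel k (x - y) τ := by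
  rw [laplacian_eq_sum_fderiv]
  set b := EuclideanSpace.basisFun (Fin d) ℝ
  have hterm : ∀ i, fderiv ℝ (fderiv ℝ fun y => heatKernel k (x - y) τ) y (b i) (b i) =
      (-1 / (2 * k * τ) + (inner ℝ (x - y) (b i)) ^ 2 / (2 * k * τ) ^ 2) *
        heatKernel k (x - y) τ := fun i => by
    have h1 := (contDiff_heatKernel k x τ).contDiffAt.hasFDerivAt_fderiv_apply (z := y) (b i)
    have h2 : (fun y => fderiv ℝ (fun y => heatKernel k (x - y) τ) y (b i)) =
        fun y => heatKernel k (x - y) τ * (inner ℝ (x - y) (b i) * (2 * k * τ)⁻¹) := by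
      ext y
      rw [fderiv_heatKernel_apply hk x y _ hτ]
      ring
    rw [h2] at h1
    have h3 : HasFDerivAt (fun y : EuclideanSpace ℝ (Fin d) => inner ℝ (x - y) (b i))
        (-(innerSL ℝ (b i))) y := by
      have := ((innerSL ℝ (b i)).hasFDerivAt (x := x - y)).comp y
        ((hasFDerivAt_id y).const_sub x)
      have e1 : (fun y : EuclideanSpace ℝ (Fin d) => inner ℝ (x - y) (b i)) =
          (innerSL ℝ (b i)) ∘ fun y => x - id y := by
        ext y
        simp [real_inner_comm]
      rw [e1]
      refine this.congr_fderiv ?_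
      ext c
      simp
    have h4 := (hasFDerivAt_heatKernel hk x y hτ).fun_mul (h3.mul_const (2 * k * τ)⁻¹)
    have h5 := congrArg (fun A => A (b i)) (h1.unique h4)
    simp only [ContinuousLinearMap.flip_apply] at h5
    rw [h5]
    have hbi : inner ℝ (b i) (b i) = (1 : ℝ) := by
      rw [real_inner_self_eq_norm_sq, b.norm_eq_one, one_pow]
    simp only [add_apply, smul_apply,
      neg_apply, innerSL_apply_apply, smul_eq_mul, hbi]
    field_simp
  rw [Finset.sum_congr rfl fun i _ => hterm i, ← Finset.sum_mul, Finset.sum_add_distrib]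
  congr 2
  · simp [div_eq_mul_inv]
  · rw [← b.sum_sq_norm_inner_left (x - y)]
    simp [Finset.sum_div]

/-- Compared with `laplacian_heatKernel`, this is the backward equation ∂ₛK = -kΔK in the source
variables. -/
theorem hasDerivAt_heatKernel_time (hk : 0 < k) (z : EuclideanSpace ℝ (Fin d)) {t s : ℝ}
    (hs : s < t) :
    HasDerivAt (fun s => heatKernel k z (t - s))
      (-(k * ((-d / (2 * k * (t - s)) + ‖z‖ ^ 2 / (2 * k * (t - s)) ^ 2) *
        heatKernel k z (t - s)))) s := by
  have hτ : 0 < t - s := sub_pos.2 hs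
  have hee : (fun s => heatKernel k z (t - s)) =ᶠ[𝓝 s] fun s =>
      (4 * Real.pi * k * (t - s)) ^ (-(d : ℝ) / 2) * Real.exp (-‖z‖ ^ 2 / (4 * k * (t - s))) := by
    filter_upwards [Iio_mem_nhds hs] with r hr
    exact heatKernel_of_pos k z (sub_pos.2 hr)
  refine HasDerivAt.congr_of_eventuallyEq ?_ hee
  rw [heatKernel_of_pos k z hτ]
  have h0 : HasDerivAt (fun s => t - s) (-1) s := (hasDerivAt_id s).const_sub t
  have h1 : HasDerivAt (fun s => (4 * Real.pi * k * (t - s)) ^ (-(d : ℝ) / 2)) _ s :=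
    (h0.const_mul (4 * Real.pi * k)).rpow_const (Or.inl (by positivity))
  have h2 : HasDerivAt (fun s => Real.exp (-‖z‖ ^ 2 / (4 * k * (t - s)))) _ s :=
    ((hasDerivAt_const s (-‖z‖ ^ 2)).fun_div (h0.const_mul (4 * k)) (by positivity)).exp
  refine (h1.fun_mul h2).congr_deriv ?_
  rw [Real.rpow_sub_one (by positivity)]
  field_simp
  ring

/-- The Gaussian exponent is split into two halves. For ‖z‖ ≥ δ one half is at most exp(-a/τ) and
defeats every negative power of τ; the other keeps Gaussian decay in z, with τ replaced by T. -/
theorem exists_heatKernel_div_le (hk : 0 < k) {T δ : ℝ} (hT : 0 < T) (hδ : 0 < δ) :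
    ∃ C, 0 < C ∧ ∀ τ, 0 < τ → τ ≤ T → ∀ z : EuclideanSpace ℝ (Fin d), δ ≤ ‖z‖ →
      heatKernel k z τ / τ ≤ C * Real.exp (-(‖z‖ ^ 2 / (8 * k * T))) := by
  set a := δ ^ 2 / (8 * k) with ha
  have ha0 : 0 < a := by positivity
  have hpi := Real.pi_pos
  set c := 4 * Real.pi * k with hc
  have hc0 : 0 < c := by positivity
  clear_value c
  -- From the exponential series, exp(-a/τ) ≤ (d + 1)! (τ/a)^(d + 1). One power of τ cancels the
  -- division by τ; the other d turn τ^(-d/2) into τ^(d/2) ≤ T^(d/2).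
  refine ⟨(d + 1).factorial / a ^ (d + 1) * (c ^ d)⁻¹ * (c * T) ^ ((d : ℝ) / 2), by positivity,
    fun τ hτ hτT z hz => ?_⟩
  rw [heatKernel_of_pos k z hτ, ← hc]
  have h1 : Real.exp (-‖z‖ ^ 2 / (4 * k * τ)) ≤
      Real.exp (-(a / τ)) * Real.exp (-(‖z‖ ^ 2 / (8 * k * T))) := by
    rw [← Real.exp_add]
    refine Real.exp_le_exp.2 ?_
    have e1 : -‖z‖ ^ 2 / (4 * k * τ) = -(‖z‖ ^ 2 / (8 * k) / τ) - ‖z‖ ^ 2 / (8 * k * τ) := by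
      field_simp; ring
    have e2 : a / τ ≤ ‖z‖ ^ 2 / (8 * k) / τ := by rw [ha]; gcongr
    have e3 : ‖z‖ ^ 2 / (8 * k * T) ≤ ‖z‖ ^ 2 / (8 * k * τ) := by gcongr
    rw [e1]; linarith
  have h2 : Real.exp (-(a / τ)) ≤ (d + 1).factorial / a ^ (d + 1) * τ ^ (d + 1) := by
    have := Real.pow_div_factorial_le_exp (a / τ) (by positivity) (d + 1)
    rw [Real.exp_neg, inv_le_comm₀ (Real.exp_pos _) (by positivity)]
    refine le_trans (le_of_eq ?_) this
    clear_value a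
    rw [div_pow]
    field_simp
  have h3 : (c * τ) ^ (-(d : ℝ) / 2) * (c * τ) ^ d ≤ (c * T) ^ ((d : ℝ) / 2) := by
    rw [← Real.rpow_natCast (c * τ) d, ← Real.rpow_add (by positivity)]
    have : -(d : ℝ) / 2 + d = d / 2 := by ring
    rw [this]
    gcongr
  calc (c * τ) ^ (-(d : ℝ) / 2) * Real.exp (-‖z‖ ^ 2 / (4 * k * τ)) / τ
      ≤ (c * τ) ^ (-(d : ℝ) / 2) * ((d + 1).factorial / a ^ (d + 1) * τ ^ (d + 1) *
        Real.exp (-(‖z‖ ^ 2 / (8 * k * T)))) / τ := by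
        gcongr
        exact h1.trans (by gcongr)
    _ = (d + 1).factorial / a ^ (d + 1) * (c ^ d)⁻¹ * ((c * τ) ^ (-(d : ℝ) / 2) * (c * τ) ^ d) *
        Real.exp (-(‖z‖ ^ 2 / (8 * k * T))) := by
        clear_value a
        rw [mul_pow, pow_succ τ d]
        field_simp
    _ ≤ _ := by gcongr

/-- The integral of a non-integrable function is 0 by convention, whereas the Gaussian integral
formula gives a positive value. -/
theorem integrable_exp_neg_mul_sq_norm {V : Type*} [NormedAddCommGroup V] [InnerProductSpace ℝ V]
    [FiniteDimensional ℝ V] [MeasurableSpace V] [BorelSpace V] {b : ℝ} (hb : 0 < b) :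
    Integrable fun v : V => Real.exp (-b * ‖v‖ ^ 2) := by
  by_contra h
  have h1 := GaussianFourier.integral_rexp_neg_mul_sq_norm (V := V) hb
  rw [integral_undef h] at h1
  have : 0 < (Real.pi / b) ^ (finrank ℝ V / 2 : ℝ) := by positivity
  linarith

theorem integral_heatKernel_one (hk : 0 < k) :
    ∫ z : EuclideanSpace ℝ (Fin d), heatKernel k z 1 = 1 := by
  have h := GaussianFourier.integral_rexp_neg_mul_sq_norm (V := EuclideanSpace ℝ (Fin d))
    (b := 1 / (4 * k)) (by positivity)
  have h2 : ∀ z : EuclideanSpace ℝ (Fin d), heatKernel k z 1 =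
      (4 * Real.pi * k) ^ (-(d : ℝ) / 2) * Real.exp (-(1 / (4 * k)) * ‖z‖ ^ 2) := fun z => by
    rw [heatKernel_of_pos k z one_pos]
    congr 2
    · ring
    · ring
  simp_rw [h2]
  rw [integral_const_mul, h, finrank_euclideanSpace_fin]
  have : Real.pi / (1 / (4 * k)) = 4 * Real.pi * k := by field_simp
  rw [this, ← Real.rpow_add (by positivity)]
  simp [neg_div]

theorem heatKernel_scaling (hk : 0 < k) (z : EuclideanSpace ℝ (Fin d)) {ε : ℝ} (hε : 0 < ε) :
    √ε ^ d * heatKernel k (-(√ε • z)) ε = heatKernel k z 1 := by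
  rw [heatKernel_of_pos k _ hε, heatKernel_of_pos k _ one_pos, norm_neg, norm_smul, mul_pow,
    Real.norm_of_nonneg (Real.sqrt_nonneg _), Real.sq_sqrt hε.le,
    Real.mul_rpow (by positivity) hε.le, ← Real.rpow_natCast (√ε) d, Real.sqrt_eq_rpow,
    ← Real.rpow_mul hε.le]
  have h1 : ε ^ (1 / 2 * (d : ℝ)) * ε ^ (-(d : ℝ) / 2) = 1 := by
    rw [← Real.rpow_add hε]; ring_nf; simp
  have h2 : -(ε * ‖z‖ ^ 2) / (4 * k * ε) = -‖z‖ ^ 2 / (4 * k * 1) := by field_simp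
  rw [h2, mul_one (4 * Real.pi * k)]
  generalize Real.exp (-‖z‖ ^ 2 / (4 * k * 1)) = X
  linear_combination ((4 * Real.pi * k) ^ (-(d : ℝ) / 2) * X) * h1

theorem integral_mul_heatKernel (hk : 0 < k) (F : EuclideanSpace ℝ (Fin d) → ℝ)
    (x : EuclideanSpace ℝ (Fin d)) {ε : ℝ} (hε : 0 < ε) :
    ∫ y, F y * heatKernel k (x - y) ε = ∫ z, F (x + √ε • z) * heatKernel k z 1 := by
  have h1 := integral_add_left_eq_self (μ := (volume : Measure (EuclideanSpace ℝ (Fin d))))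
    (fun y => F y * heatKernel k (x - y) ε) x
  have h2 := Measure.integral_comp_smul (volume : Measure (EuclideanSpace ℝ (Fin d)))
    (fun y => F (x + y) * heatKernel k (x - (x + y)) ε) √ε
  have hs : 0 < √ε := Real.sqrt_pos.2 hε
  rw [finrank_euclideanSpace_fin, abs_of_pos (by positivity), smul_eq_mul, h1,
    eq_inv_mul_iff_mul_eq₀ (by positivity)] at h2
  rw [← h2, ← integral_const_mul]
  congr 1
  ext z
  rw [← heatKernel_scaling hk z hε, sub_add_cancel_left]
  ring

theorem measurable_heatKernel (k : ℝ) :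
    Measurable fun p : EuclideanSpace ℝ (Fin d) × ℝ => heatKernel k p.1 p.2 := by
  unfold heatKernel
  refine Measurable.ite (measurableSet_lt measurable_const measurable_snd) ?_ measurable_const
  exact ((measurable_const.mul measurable_snd).pow_const _).mul
    (((measurable_fst.norm.pow_const 2).neg.div (measurable_const.mul measurable_snd)).exp)

/-- The heat kernel is an approximate identity for functions of Gaussian growth. -/
theorem tendsto_integral_mul_heatKernel (hk : 0 < k) {F : ℕ → EuclideanSpace ℝ (Fin d) → ℝ}
    {ε : ℕ → ℝ} (hε : ∀ n, 0 < ε n) (hε1 : ∀ n, ε n ≤ 1) {A α L : ℝ} (hα : 0 ≤ α)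
    (hαk : α ≤ 1 / (16 * k)) (x : EuclideanSpace ℝ (Fin d)) (hm : ∀ n, Measurable (F n))
    (hb : ∀ n y, |F n y| ≤ A * Real.exp (α * ‖y‖ ^ 2))
    (hL : ∀ z, Tendsto (fun n => F n (x + √(ε n) • z)) atTop (𝓝 L)) :
    Tendsto (fun n => ∫ y, F n y * heatKernel k (x - y) (ε n)) atTop (𝓝 L) := by
  simp_rw [fun n => integral_mul_heatKernel hk (F n) x (hε n)]
  have hlim : ∫ z : EuclideanSpace ℝ (Fin d), L * heatKernel k z 1 = L := by
    rw [integral_const_mul, integral_heatKernel_one hk, mul_one]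
  have hA : 0 ≤ A := by
    have := (abs_nonneg _).trans (hb 0 0)
    simpa using this
  have hKm : Measurable fun z : EuclideanSpace ℝ (Fin d) => heatKernel k z 1 :=
    (measurable_heatKernel k).comp (measurable_id.prodMk measurable_const)
  rw [← hlim]
  -- After the substitution y = x + √ε z, the bound ‖x + √ε z‖² ≤ 2‖x‖² + 2‖z‖² makes the growth
  -- cost at most 1/(8k) in the exponent, half of the 1/(4k) that the kernel at time 1 provides.
  refine tendsto_integral_of_dominated_convergence
    (fun z => A * Real.exp (2 * α * ‖x‖ ^ 2) * (4 * Real.pi * k * 1) ^ (-(d : ℝ) / 2) *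
      Real.exp (-(1 / (8 * k)) * ‖z‖ ^ 2))
    (fun n => ?_) ((integrable_exp_neg_mul_sq_norm (by positivity)).const_mul _)
    (fun n => .of_forall fun z => ?_) (.of_forall fun z => (hL z).mul_const _)
  · exact (((hm n).comp (by fun_prop)).mul hKm).aestronglyMeasurable
  · have hs0 : 0 ≤ √(ε n) := Real.sqrt_nonneg _
    have hs1 : √(ε n) ≤ 1 := Real.sqrt_le_one.2 (hε1 n)
    have h1 : ‖x + √(ε n) • z‖ ≤ ‖x‖ + ‖z‖ := by
      refine (norm_add_le _ _).trans ?_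
      rw [norm_smul, Real.norm_of_nonneg hs0]
      nlinarith [norm_nonneg z]
    have h2 : ‖x + √(ε n) • z‖ ^ 2 ≤ 2 * ‖x‖ ^ 2 + 2 * ‖z‖ ^ 2 := by
      have : ‖x + √(ε n) • z‖ ^ 2 ≤ (‖x‖ + ‖z‖) ^ 2 := by gcongr
      nlinarith [sq_nonneg (‖x‖ - ‖z‖)]
    rw [norm_mul, Real.norm_eq_abs, Real.norm_of_nonneg (heatKernel_nonneg hk z 1),
      heatKernel_of_pos k z one_pos]
    have h3 : α * ‖x + √(ε n) • z‖ ^ 2 + -‖z‖ ^ 2 / (4 * k * 1) ≤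
        2 * α * ‖x‖ ^ 2 + -(1 / (8 * k)) * ‖z‖ ^ 2 := by
      have e1 : -‖z‖ ^ 2 / (4 * k * 1) = -(1 / (8 * k)) * ‖z‖ ^ 2 - 2 * (1 / (16 * k)) * ‖z‖ ^ 2 := by
        field_simp; ring
      have e2 := mul_le_mul_of_nonneg_left h2 hα
      have e3 := mul_le_mul_of_nonneg_right hαk (sq_nonneg ‖z‖)
      rw [e1]
      linarith
    calc _ ≤ A * Real.exp (α * ‖x + √(ε n) • z‖ ^ 2) *
          ((4 * Real.pi * k * 1) ^ (-(d : ℝ) / 2) * Real.exp (-‖z‖ ^ 2 / (4 * k * 1))) := by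
          gcongr
          exact hb n _
      _ = A * (4 * Real.pi * k * 1) ^ (-(d : ℝ) / 2) *
          Real.exp (α * ‖x + √(ε n) • z‖ ^ 2 + -‖z‖ ^ 2 / (4 * k * 1)) := by
          rw [Real.exp_add]; ring
      _ ≤ A * (4 * Real.pi * k * 1) ^ (-(d : ℝ) / 2) *
          Real.exp (2 * α * ‖x‖ ^ 2 + -(1 / (8 * k)) * ‖z‖ ^ 2) := by gcongr
      _ = _ := by rw [Real.exp_add]; ring

end HeatKernel

/-! ### The growth condition implies sub-Gaussian growth -/

theorem le_exp_add_mul_sq {α : ℝ} (hα : 0 < α) (r : ℝ) : r ≤ 1 / (2 * α) + α / 2 * r ^ 2 := by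
  have : 0 ≤ (α * r - 1) ^ 2 / (2 * α) := by positivity
  have e : (α * r - 1) ^ 2 / (2 * α) = α / 2 * r ^ 2 - r + 1 / (2 * α) := by field_simp; ring
  linarith

theorem exists_zpow_mul_exp_rpow_le {C a b α : ℝ} (hC : 0 < C) (ha : 0 ≤ a) (hb0 : 0 ≤ b)
    (hb : b < 2) (m : ℤ) (hα : 0 < α) :
    ∃ A, 0 < A ∧ ∀ r : ℝ, 1 ≤ r → C * r ^ m * Real.exp (a * r ^ b) ≤ A * Real.exp (α * r ^ 2) := by
  -- The radius at which a r^b = (α/2) r². Since b < 2, the quadratic term dominates beyond it, and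
  -- before it a r^b is at most its value at `r₁`.
  set r₁ : ℝ := (2 * a / α) ^ (1 / (2 - b)) with hr₁
  have hb' : 0 < 2 - b := by linarith
  have h1 : ∀ r : ℝ, 1 ≤ r → a * r ^ b ≤ α / 2 * r ^ 2 + a * r₁ ^ b := by
    intro r hr
    have hr0 : 0 < r := by linarith
    have hr₁0 : 0 ≤ r₁ := by positivity
    rcases le_total r₁ r with h | h
    · have h2 : 2 * a / α ≤ r ^ (2 - b) := by
        have := Real.rpow_le_rpow hr₁0 h hb'.le
        rwa [hr₁, ← Real.rpow_mul (by positivity), one_div_mul_cancel hb'.ne', Real.rpow_one] at this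
      have h3 : a ≤ α / 2 * r ^ (2 - b) := by
        rw [div_le_iff₀ hα] at h2; linarith
      have h4 : r ^ (2 - b) * r ^ b = r ^ 2 := by
        rw [← Real.rpow_add hr0, sub_add_cancel, Real.rpow_two]
      have h5 : a * r ^ b ≤ α / 2 * r ^ (2 - b) * r ^ b := by gcongr
      have h6 : 0 ≤ a * r₁ ^ b := by positivity
      rw [mul_assoc, h4] at h5
      linarith
    · have : a * r ^ b ≤ a * r₁ ^ b := by gcongr
      nlinarith [sq_nonneg r]
  have h2 : ∀ r : ℝ, 1 ≤ r → r ^ m ≤ m.natAbs.factorial * Real.exp (1 / (2 * α)) *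
      Real.exp (α / 2 * r ^ 2) := by
    intro r hr
    have e1 : r ^ m ≤ r ^ m.natAbs := by
      rw [← zpow_natCast]
      exact zpow_le_zpow_right₀ hr (by omega)
    have e2 := Real.pow_div_factorial_le_exp r (by linarith) m.natAbs
    rw [div_le_iff₀ (by positivity)] at e2
    have e3 : Real.exp r ≤ Real.exp (1 / (2 * α)) * Real.exp (α / 2 * r ^ 2) := by
      rw [← Real.exp_add]
      exact Real.exp_le_exp.2 (le_exp_add_mul_sq hα r)
    calc _ ≤ _ := e1.trans e2
      _ ≤ Real.exp (1 / (2 * α)) * Real.exp (α / 2 * r ^ 2) * m.natAbs.factorial := by gcongr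
      _ = _ := by ring
  refine ⟨C * (m.natAbs.factorial * Real.exp (1 / (2 * α))) * Real.exp (a * r₁ ^ b), by positivity,
    fun r hr => ?_⟩
  have h3 : Real.exp (a * r ^ b) ≤ Real.exp (α / 2 * r ^ 2) * Real.exp (a * r₁ ^ b) := by
    rw [← Real.exp_add]
    exact Real.exp_le_exp.2 (h1 r hr)
  calc _ ≤ C * (m.natAbs.factorial * Real.exp (1 / (2 * α)) * Real.exp (α / 2 * r ^ 2)) *
        (Real.exp (α / 2 * r ^ 2) * Real.exp (a * r₁ ^ b)) := by
        gcongr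
        exact h2 r hr
    _ = _ := by
        have : Real.exp (α * r ^ 2) = Real.exp (α / 2 * r ^ 2) * Real.exp (α / 2 * r ^ 2) := by
          rw [← Real.exp_add]; ring_nf
        rw [this]; ring

/-- The growth condition forces sub-Gaussian growth, locally uniformly in time. -/
theorem GrowthCondition.exists_bound {d : ℕ} {k : ℝ} (hk : 0 < k)
    {Ω : Set (EuclideanSpace ℝ (Fin d))} (hΩ : IsOpen Ω) (hb : Bornology.IsBounded Ω)
    {v : EuclideanSpace ℝ (Fin d) → ℝ → ℝ}
    (hv : ContDiffOn ℝ 2 (fun p : EuclideanSpace ℝ (Fin d) × ℝ => v p.1 p.2) (Ωᶜ ×ˢ Ici (0 : ℝ)))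
    (hg : GrowthCondition k v) (T : ℝ) {α : ℝ} (hα : 0 < α) :
    ∃ A, 0 < A ∧ ∀ y ∈ Ωᶜ, ∀ s, 0 < s → s ≤ T → |v y s| ≤ A * Real.exp (α * ‖y‖ ^ 2) := by
  obtain ⟨r₀, C, a, b, m, hr₀, hC, ha, hb0, hb2, hgr⟩ := hg
  -- Only half of α is used here; the other half absorbs the length r of the radial segment of
  -- integration.
  obtain ⟨A₁, hA₁, hA⟩ := exists_zpow_mul_exp_rpow_le hC ha hb0 hb2 m (half_pos hα)
  obtain ⟨R₁, hR₁⟩ := hb.closure.subset_closedBall 0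
  set R := max (max r₀ R₁) 0 + 1 with hR
  have hRr₀ : r₀ < R := by
    have := (le_max_left r₀ R₁).trans (le_max_left _ (0 : ℝ)); linarith
  have hRR₁ : R₁ < R := by
    have := (le_max_right r₀ R₁).trans (le_max_left _ (0 : ℝ)); linarith
  have hR1 : 1 ≤ R := by have := le_max_right (max r₀ R₁) (0 : ℝ); linarith
  clear_value R
  have hout : ∀ y, R ≤ ‖y‖ → y ∉ closure Ω := fun y hy hyc => by
    have := hR₁ hyc
    rw [mem_closedBall_zero_iff] at this
    linarith
  have hK : IsCompact ((Ωᶜ ∩ Metric.closedBall 0 R) ×ˢ Icc 0 T) :=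
    ((isCompact_closedBall 0 R).inter_left hΩ.isClosed_compl).prod isCompact_Icc
  obtain ⟨M, hM⟩ := hK.exists_bound_of_continuousOn (f := fun p => v p.1 p.2)
    (hv.continuousOn.mono (prod_mono inter_subset_left Icc_subset_Ici_self))
  refine ⟨|M| + A₁ * Real.exp (1 / (2 * α)), by positivity, fun y hy s hs hsT => ?_⟩
  have hexp1 : 1 ≤ Real.exp (α * ‖y‖ ^ 2) := Real.one_le_exp (by positivity)
  by_cases hyR : ‖y‖ ≤ R
  · have h1 : |v y s| ≤ |M| :=
      (hM (y, s) ⟨⟨hy, mem_closedBall_zero_iff.2 hyR⟩, hs.le, hsT⟩).trans (le_abs_self M)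
    have h2 : 0 ≤ A₁ * Real.exp (1 / (2 * α)) := by positivity
    nlinarith [abs_nonneg M]
  rw [not_le] at hyR
  set r := ‖y‖ with hr
  have hr0 : 0 < r := by linarith
  set ξ := r⁻¹ • y with hξ
  have hξ1 : ‖ξ‖ = 1 := by
    rw [hξ, norm_smul, norm_inv, Real.norm_of_nonneg hr0.le, ← hr, inv_mul_cancel₀ hr0.ne']
  have hrξ : r • ξ = y := by rw [hξ, smul_smul, mul_inv_cancel₀ hr0.ne', one_smul]
  have hnorm : ∀ ρ : ℝ, 0 ≤ ρ → ‖ρ • ξ‖ = ρ := fun ρ hρ => by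
    rw [norm_smul, hξ1, mul_one, Real.norm_of_nonneg hρ]
  -- The Gaussian is the integrating factor: the derivative of `p` is the Gaussian times the very
  -- expression bounded by the growth condition.
  set p : ℝ → ℝ := fun ρ => Real.exp (ρ ^ 2 / (4 * k * s)) * v (ρ • ξ) s with hp
  have hder : ∀ ρ ∈ Icc R r, HasDerivWithinAt p (Real.exp (ρ ^ 2 / (4 * k * s)) *
      (fderiv ℝ (fun z => v z s) (ρ • ξ) ξ + (2 * ρ / (4 * k * s)) * v (ρ • ξ) s)) (Icc R r) ρ := by
    intro ρ hρ
    have hρ0 : 0 ≤ ρ := by linarith [hρ.1]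
    have hn : (Ωᶜ ×ˢ Ici (0 : ℝ)) ∈ 𝓝 (ρ • ξ, s) :=
      prod_mem_nhds (compl_mem_nhds_of_notMem_closure (hout _ (by rw [hnorm ρ hρ0]; exact hρ.1)))
        (Ici_mem_nhds hs)
    have hd : DifferentiableAt ℝ (fun z => v z s) (ρ • ξ) := by
      have h1 := (hv.contDiffAt hn).differentiableAt two_ne_zero
      exact h1.comp (ρ • ξ) (f := fun z => (z, s))
        (differentiableAt_id.prodMk (differentiableAt_const s))
    have h2 : HasDerivAt (fun ρ : ℝ => ρ • ξ) ξ ρ := by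
      simpa using (hasDerivAt_id ρ).smul_const ξ
    have h3 : HasDerivAt (fun ρ : ℝ => v (ρ • ξ) s) (fderiv ℝ (fun z => v z s) (ρ • ξ) ξ) ρ :=
      HasFDerivAt.comp_hasDerivAt (l := fun z => v z s) ρ hd.hasFDerivAt h2
    have h4 : HasDerivAt (fun ρ : ℝ => Real.exp (ρ ^ 2 / (4 * k * s))) _ ρ :=
      ((hasDerivAt_pow 2 ρ).div_const (4 * k * s)).exp
    refine ((h4.fun_mul h3).congr_deriv ?_).hasDerivWithinAt
    simp
    ring
  -- Since ρ ≤ r, the weight is replaced by its value at r. The same factor multiplies v on the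
  -- left, so it cancels, and the final bound does not degenerate as s → 0.
  set B := Real.exp (r ^ 2 / (4 * k * s)) * (A₁ * Real.exp (α / 2 * r ^ 2)) with hB
  have hbound : ∀ ρ ∈ Icc R r, ‖Real.exp (ρ ^ 2 / (4 * k * s)) *
      (fderiv ℝ (fun z => v z s) (ρ • ξ) ξ + (2 * ρ / (4 * k * s)) * v (ρ • ξ) s)‖ ≤ B := by
    intro ρ hρ
    have hρ0 : 0 ≤ ρ := by linarith [hρ.1]
    rw [norm_mul, Real.norm_of_nonneg (Real.exp_pos _).le, hB]
    have h1 := hgr ρ (by linarith [hρ.1]) s hs ξ hξ1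
    have h2 := hA ρ (by linarith [hρ.1])
    have hρr : ρ ≤ r := hρ.2
    gcongr
    refine (h1.trans h2).trans ?_
    gcongr
  have hmv := (convex_Icc R r).norm_image_sub_le_of_norm_hasDerivWithin_le hder hbound
    (left_mem_Icc.2 hyR.le) (right_mem_Icc.2 hyR.le)
  have hR0 : 0 ≤ R := by linarith
  have hvR : |v (R • ξ) s| ≤ |M| := by
    refine (hM (R • ξ, s) ⟨⟨fun h => hout _ (by rw [hnorm R hR0]) (subset_closure h), ?_⟩,
      hs.le, hsT⟩).trans (le_abs_self M)
    rw [mem_closedBall_zero_iff, hnorm R hR0]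
  have hmv' : |p r| ≤ |p R| + B * r := by
    have h1 : ‖r - R‖ ≤ r := by rw [Real.norm_of_nonneg (by linarith)]; linarith
    have h2 : B * ‖r - R‖ ≤ B * r := by gcongr
    have h3 : |p r| ≤ |p R| + |p r - p R| := by
      have := abs_add_le (p R) (p r - p R)
      rwa [add_sub_cancel] at this
    rw [Real.norm_eq_abs] at hmv
    linarith
  have hpR : |p R| ≤ Real.exp (r ^ 2 / (4 * k * s)) * |M| := by
    rw [hp]
    beta_reduce
    rw [abs_mul, abs_of_pos (Real.exp_pos _)]
    gcongr
  have hpr : |p r| = Real.exp (r ^ 2 / (4 * k * s)) * |v y s| := by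
    rw [hp]
    beta_reduce
    rw [abs_mul, abs_of_pos (Real.exp_pos _), hrξ]
  have hfin : |v y s| ≤ |M| + A₁ * Real.exp (α / 2 * r ^ 2) * r := by
    have hE := Real.exp_pos (r ^ 2 / (4 * k * s))
    refine le_of_mul_le_mul_left ?_ hE
    rw [← hpr]
    calc _ ≤ _ := hmv'
      _ ≤ Real.exp (r ^ 2 / (4 * k * s)) * |M| + B * r := by gcongr
      _ = _ := by rw [hB]; ring
  have hre : r ≤ Real.exp (1 / (2 * α)) * Real.exp (α / 2 * r ^ 2) := by
    rw [← Real.exp_add]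
    exact (le_exp_add_mul_sq hα r).trans (by linarith [Real.add_one_le_exp (1 / (2 * α) + α / 2 * r ^ 2)])
  have hE2 : Real.exp (α * r ^ 2) = Real.exp (α / 2 * r ^ 2) * Real.exp (α / 2 * r ^ 2) := by
    rw [← Real.exp_add]; ring_nf
  calc _ ≤ _ := hfin
    _ ≤ |M| * Real.exp (α * r ^ 2) + A₁ * Real.exp (α / 2 * r ^ 2) *
        (Real.exp (1 / (2 * α)) * Real.exp (α / 2 * r ^ 2)) := by
        gcongr
        exact le_mul_of_one_le_right (abs_nonneg M) hexp1
    _ = _ := by rw [hE2]; ring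

/-! ### Exterior solutions and integrability of the layer integrand -/

/-- A solution of the heat equation in the exterior of a bounded Lipschitz domain, of class `C²` up
to the boundary and with vanishing initial value. -/
structure IsExteriorHeatSolution {d : ℕ} (k : ℝ) (Ω : Set (EuclideanSpace ℝ (Fin d)))
    (v : EuclideanSpace ℝ (Fin d) → ℝ → ℝ) : Prop where
  pos : 0 < k
  isOpen : IsOpen Ω
  isBounded : Bornology.IsBounded Ω
  lipschitz : HasLipschitzBoundary Ω
  contDiffOn : ContDiffOn ℝ 2 (fun p : EuclideanSpace ℝ (Fin d) × ℝ => v p.1 p.2)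
    (Ωᶜ ×ˢ Ici (0 : ℝ))
  heat : ∀ x ∉ closure Ω, ∀ t > 0,
    deriv (fun s => v x s) t = k * Laplacian.laplacian (fun z => v z t) x
  initial_eq_zero : ∀ x ∉ Ω, v x 0 = 0

namespace IsExteriorHeatSolution

variable {d : ℕ} {k : ℝ} {Ω : Set (EuclideanSpace ℝ (Fin d))}
  {v : EuclideanSpace ℝ (Fin d) → ℝ → ℝ}

theorem uniqueDiffOn (h : IsExteriorHeatSolution k Ω v) : UniqueDiffOn ℝ (Ωᶜ ×ˢ Ici (0 : ℝ)) :=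
  h.lipschitz.uniqueDiffOn_compl.prod (uniqueDiffOn_Ici 0)

theorem contDiffOn_slice (h : IsExteriorHeatSolution k Ω v) {s : ℝ} (hs : 0 ≤ s) :
    ContDiffOn ℝ 2 (fun z => v z s) Ωᶜ :=
  h.contDiffOn.comp (f := fun z => (z, s)) (contDiff_id.prodMk contDiff_const).contDiffOn
    fun _ hz => ⟨hz, hs⟩

theorem continuousOn (h : IsExteriorHeatSolution k Ω v) :
    ContinuousOn (fun p : EuclideanSpace ℝ (Fin d) × ℝ => v p.1 p.2) (Ωᶜ ×ˢ Ici (0 : ℝ)) :=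
  h.contDiffOn.continuousOn

theorem hasFDerivWithinAt (h : IsExteriorHeatSolution k Ω v)
    {p : EuclideanSpace ℝ (Fin d) × ℝ} (hp : p ∈ Ωᶜ ×ˢ Ici (0 : ℝ)) :
    HasFDerivWithinAt (fun p : EuclideanSpace ℝ (Fin d) × ℝ => v p.1 p.2)
      (fderivWithin ℝ (fun p : EuclideanSpace ℝ (Fin d) × ℝ => v p.1 p.2) (Ωᶜ ×ˢ Ici (0 : ℝ)) p)
      (Ωᶜ ×ˢ Ici (0 : ℝ)) p :=
  (h.contDiffOn.differentiableOn two_ne_zero p hp).hasFDerivWithinAt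

theorem continuousOn_fderivWithin_apply (h : IsExteriorHeatSolution k Ω v)
    (c : EuclideanSpace ℝ (Fin d) × ℝ) :
    ContinuousOn (fun p => fderivWithin ℝ (fun p : EuclideanSpace ℝ (Fin d) × ℝ => v p.1 p.2)
      (Ωᶜ ×ˢ Ici (0 : ℝ)) p c) (Ωᶜ ×ˢ Ici (0 : ℝ)) :=
  (h.contDiffOn.continuousOn_fderivWithin h.uniqueDiffOn one_le_two).clm_apply continuousOn_const

/-- The layer integrand differentiates a fixed time slice, but measurability and bounds are needed
jointly in (s, y). They come from the continuous derivative of v in both variables. -/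
theorem fderivWithin_slice_apply (h : IsExteriorHeatSolution k Ω v)
    {y : EuclideanSpace ℝ (Fin d)} {s : ℝ} (hy : y ∈ Ωᶜ) (hs : 0 ≤ s)
    (c : EuclideanSpace ℝ (Fin d)) :
    fderivWithin ℝ (fun z => v z s) Ωᶜ y c =
      fderivWithin ℝ (fun p : EuclideanSpace ℝ (Fin d) × ℝ => v p.1 p.2)
        (Ωᶜ ×ˢ Ici (0 : ℝ)) (y, s) (c, 0) := by
  have h1 : HasFDerivWithinAt (fun z : EuclideanSpace ℝ (Fin d) => (z, s))
      (ContinuousLinearMap.inl ℝ _ ℝ) Ωᶜ y := (hasFDerivAt_prodMk_left y s).hasFDerivWithinAt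
  have hm : MapsTo (fun z : EuclideanSpace ℝ (Fin d) => (z, s)) Ωᶜ (Ωᶜ ×ˢ Ici (0 : ℝ)) :=
    fun z hz => ⟨hz, hs⟩
  have h2 := (h.hasFDerivWithinAt (p := (y, s)) ⟨hy, hs⟩).comp y h1 hm
  have h3 := h2.fderivWithin (h.lipschitz.uniqueDiffOn_compl y hy)
  change fderivWithin ℝ ((fun p : EuclideanSpace ℝ (Fin d) × ℝ => v p.1 p.2) ∘ fun z => (z, s))
    Ωᶜ y c = _
  rw [h3]
  rfl

/-- The time derivative of the solution, extended continuously to the boundary. -/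
noncomputable def timeDeriv (Ω : Set (EuclideanSpace ℝ (Fin d)))
    (v : EuclideanSpace ℝ (Fin d) → ℝ → ℝ) (p : EuclideanSpace ℝ (Fin d) × ℝ) : ℝ :=
  fderivWithin ℝ (fun p : EuclideanSpace ℝ (Fin d) × ℝ => v p.1 p.2) (Ωᶜ ×ˢ Ici (0 : ℝ)) p (0, 1)

theorem hasDerivAt_time (h : IsExteriorHeatSolution k Ω v)
    {y : EuclideanSpace ℝ (Fin d)} {s : ℝ} (hy : y ∈ Ωᶜ) (hs : 0 < s) :
    HasDerivAt (fun s => v y s) (timeDeriv Ω v (y, s)) s := by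
  have h1 : HasDerivWithinAt (fun s : ℝ => (y, s)) ((0 : EuclideanSpace ℝ (Fin d)), (1 : ℝ))
      (Ici 0) s :=
    ((hasDerivAt_const s y).prodMk (hasDerivAt_id s)).hasDerivWithinAt
  have hm : MapsTo (fun s : ℝ => (y, s)) (Ici 0) (Ωᶜ ×ˢ Ici (0 : ℝ)) := fun r hr => ⟨hy, hr⟩
  have h2 := (h.hasFDerivWithinAt (p := (y, s)) ⟨hy, hs.le⟩).comp_hasDerivWithinAt s h1 hm
  exact h2.hasDerivAt (Ici_mem_nhds hs)

theorem laplacian_eq (h : IsExteriorHeatSolution k Ω v)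
    {y : EuclideanSpace ℝ (Fin d)} {s : ℝ} (hy : y ∉ closure Ω) (hs : 0 < s) :
    k * Laplacian.laplacian (fun z => v z s) y = timeDeriv Ω v (y, s) := by
  rw [← h.heat y hy s hs]
  exact (h.hasDerivAt_time (compl_closure_subset_compl Ω hy) hs).deriv

theorem layerIntegrand_eq (h : IsExteriorHeatSolution k Ω v) (x : EuclideanSpace ℝ (Fin d))
    {y : EuclideanSpace ℝ (Fin d)} {s t : ℝ} (hy : y ∈ Ωᶜ) (hs : 0 ≤ s) (hst : s ≤ t) :
    layerIntegrand k Ω v x t s y =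
      (∑ i, fderivWithin ℝ (fun p : EuclideanSpace ℝ (Fin d) × ℝ => v p.1 p.2)
        (Ωᶜ ×ˢ Ici (0 : ℝ)) (y, s) (EuclideanSpace.basisFun (Fin d) ℝ i, 0) *
        inner ℝ (outwardNormal Ω y) (EuclideanSpace.basisFun (Fin d) ℝ i)) *
          heatKernel k (x - y) (t - s) -
      v y s * (heatKernel k (x - y) (t - s) / (2 * k * (t - s)) *
        inner ℝ (x - y) (outwardNormal Ω y)) := by
  rw [layerIntegrand, ← sum_apply_basis_mul_inner _ (outwardNormal Ω y)]
  simp only [h.fderivWithin_slice_apply hy hs]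
  rcases hst.lt_or_eq with hlt | rfl
  · rw [fderiv_heatKernel_apply h.pos x y _ (sub_pos.2 hlt)]
  -- At s = t the kernel is 0 by definition, so both sides vanish.
  · simp [heatKernel]

/-- The integrand is bounded on a space of finite measure: v and its gradient are bounded on the
compact set ∂Ω × [0, t], and since x keeps a positive distance from ∂Ω, both K and K/τ are bounded
there. -/
theorem integrable_layerIntegrand (h : IsExteriorHeatSolution k Ω v)
    {x : EuclideanSpace ℝ (Fin d)} (hx : x ∉ frontier Ω) {t : ℝ} (ht : 0 < t) :
    Integrable (fun p : ℝ × EuclideanSpace ℝ (Fin d) => layerIntegrand k Ω v x t p.1 p.2)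
      ((volume.restrict (Ioc 0 t)).prod (surfaceMeasure Ω)) := by
  have hk := h.pos
  have := isFiniteMeasure_surfaceMeasure h.isOpen h.isBounded h.lipschitz
  set b := EuclideanSpace.basisFun (Fin d) ℝ with hb
  set DV := fderivWithin ℝ (fun p : EuclideanSpace ℝ (Fin d) × ℝ => v p.1 p.2)
    (Ωᶜ ×ˢ Ici (0 : ℝ)) with hDV
  have hmeas : (volume.restrict (Ioc 0 t)).prod (surfaceMeasure Ω) =
      ((volume : Measure ℝ).prod (surfaceMeasure Ω)).restrict (Ioc 0 t ×ˢ frontier Ω) := by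
    rw [← Measure.prod_restrict]
    congr 1
    rw [surfaceMeasure, Measure.restrict_restrict isClosed_frontier.measurableSet, inter_self]
  have hSm : MeasurableSet (Ioc 0 t ×ˢ frontier Ω) :=
    measurableSet_Ioc.prod isClosed_frontier.measurableSet
  have hmaps : MapsTo (Prod.swap : ℝ × EuclideanSpace ℝ (Fin d) → _) (Ioc 0 t ×ˢ frontier Ω)
      (Ωᶜ ×ˢ Ici (0 : ℝ)) := fun p hp => ⟨frontier_subset_compl h.isOpen hp.2, hp.1.1.le⟩
  have hmaps' : MapsTo (Prod.swap : ℝ × EuclideanSpace ℝ (Fin d) → _) (Ioc 0 t ×ˢ frontier Ω)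
      (frontier Ω ×ˢ Icc 0 t) := fun p hp => ⟨hp.2, hp.1.1.le, hp.1.2⟩
  have hcpt : IsCompact (frontier Ω ×ˢ Icc 0 t) :=
    (isCompact_frontier h.isBounded).prod isCompact_Icc
  have hsubc : frontier Ω ×ˢ Icc 0 t ⊆ Ωᶜ ×ˢ Ici (0 : ℝ) :=
    prod_mono (frontier_subset_compl h.isOpen) Icc_subset_Ici_self
  have hmem : ∀ᵐ p ∂(volume.restrict (Ioc 0 t)).prod (surfaceMeasure Ω),
      p ∈ Ioc 0 t ×ˢ frontier Ω := by
    rw [hmeas]; exact ae_restrict_mem hSm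
  have hcm : ∀ f : EuclideanSpace ℝ (Fin d) × ℝ → ℝ, ContinuousOn f (Ωᶜ ×ˢ Ici (0 : ℝ)) →
      AEStronglyMeasurable (fun p : ℝ × EuclideanSpace ℝ (Fin d) => f (p.2, p.1))
        ((volume.restrict (Ioc 0 t)).prod (surfaceMeasure Ω)) := fun f hf => by
    rw [hmeas]
    exact (hf.comp continuous_swap.continuousOn hmaps).aestronglyMeasurable hSm
  have hnm : AEStronglyMeasurable (fun p : ℝ × EuclideanSpace ℝ (Fin d) => outwardNormal Ω p.2)
      ((volume.restrict (Ioc 0 t)).prod (surfaceMeasure Ω)) :=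
    (aestronglyMeasurable_outwardNormal h.isOpen h.isBounded h.lipschitz).comp_snd
  have hKm : Measurable fun p : ℝ × EuclideanSpace ℝ (Fin d) => heatKernel k (x - p.2) (t - p.1) :=
    (measurable_heatKernel k).comp
      ((measurable_const.sub measurable_snd).prodMk (measurable_const.sub measurable_fst))
  have hae : (fun p : ℝ × EuclideanSpace ℝ (Fin d) =>
      (∑ i, DV (p.2, p.1) (b i, 0) * inner ℝ (outwardNormal Ω p.2) (b i)) *
          heatKernel k (x - p.2) (t - p.1) -
      v p.2 p.1 * (heatKernel k (x - p.2) (t - p.1) / (2 * k * (t - p.1)) *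
        inner ℝ (x - p.2) (outwardNormal Ω p.2))) =ᵐ[(volume.restrict (Ioc 0 t)).prod
          (surfaceMeasure Ω)] fun p => layerIntegrand k Ω v x t p.1 p.2 := by
    filter_upwards [hmem] with p hp
    exact (h.layerIntegrand_eq x (frontier_subset_compl h.isOpen hp.2) hp.1.1.le hp.1.2).symm
  refine Integrable.congr ?_ hae
  -- The empty frontier is treated apart because the distance to an empty set is 0 by convention.
  rcases (frontier Ω).eq_empty_or_nonempty with hemp | hne
  · have : (volume.restrict (Ioc 0 t)).prod (surfaceMeasure Ω) = 0 := by
      rw [hmeas, hemp]; simp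
    rw [this]; exact integrable_zero_measure
  have hδ : 0 < Metric.infDist x (frontier Ω) :=
    (isClosed_frontier.notMem_iff_infDist_pos hne).1 hx
  obtain ⟨C, hC, hCb⟩ := exists_heatKernel_div_le (d := d) hk ht hδ
  obtain ⟨M₀, hM₀⟩ := hcpt.exists_bound_of_continuousOn (h.continuousOn.mono hsubc)
  obtain ⟨R, hR⟩ := (isCompact_frontier h.isBounded).exists_bound_of_continuousOn
    (f := fun y => x - y) (by fun_prop)
  choose M₁ hM₁ using fun i => hcpt.exists_bound_of_continuousOn
    ((h.continuousOn_fderivWithin_apply (b i, 0)).mono hsubc)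
  refine Integrable.of_bound (C := (∑ i, |M₁ i|) * (C * t) + |M₀| * (C / (2 * k) * |R|)) ?_ ?_
  · refine AEStronglyMeasurable.sub (AEStronglyMeasurable.mul ?_ hKm.aestronglyMeasurable)
      ((hcm _ h.continuousOn).mul (AEStronglyMeasurable.mul ?_ ?_))
    · exact Finset.aestronglyMeasurable_fun_sum _ fun i _ =>
        (hcm _ (h.continuousOn_fderivWithin_apply (b i, 0))).mul
          (hnm.inner aestronglyMeasurable_const)
    · exact (hKm.div (by fun_prop)).aestronglyMeasurable
    · exact AEStronglyMeasurable.inner (by fun_prop) hnm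
  · filter_upwards [hmem] with p hp
    obtain ⟨⟨hp1, hp2⟩, hpf⟩ := hp
    have hn := norm_outwardNormal_le Ω p.2
    have hpc : (p.2, p.1) ∈ frontier Ω ×ˢ Icc 0 t := ⟨hpf, hp1.le, hp2⟩
    have hKτ : heatKernel k (x - p.2) (t - p.1) / (t - p.1) ≤ C := by
      rcases hp2.lt_or_eq with hlt | heq
      · refine (hCb (t - p.1) (sub_pos.2 hlt) (by linarith) (x - p.2) ?_).trans ?_
        · rw [← dist_eq_norm]; exact Metric.infDist_le_dist_of_mem hpf
        · refine mul_le_of_le_one_right hC.le (Real.exp_le_one_iff.2 ?_)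
          rw [neg_nonpos]; positivity
      · rw [heq, sub_self, div_zero]; exact hC.le
    have hK0 := heatKernel_nonneg hk (x - p.2) (t - p.1)
    have hK : heatKernel k (x - p.2) (t - p.1) ≤ C * t := by
      rcases hp2.lt_or_eq with hlt | heq
      · have hτ : 0 < t - p.1 := sub_pos.2 hlt
        rw [div_le_iff₀ hτ] at hKτ
        nlinarith
      · rw [heq, sub_self, heatKernel, if_neg (lt_irrefl _)]; positivity
    refine (norm_sub_le _ _).trans (add_le_add ?_ ?_)
    · rw [norm_mul, Real.norm_of_nonneg hK0]
      refine mul_le_mul ?_ hK hK0 (by positivity)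
      refine (norm_sum_le _ _).trans (Finset.sum_le_sum fun i _ => ?_)
      rw [norm_mul]
      have h1 : ‖inner ℝ (outwardNormal Ω p.2) (b i)‖ ≤ 1 := by
        refine (norm_inner_le_norm _ _).trans ?_
        rw [b.norm_eq_one, mul_one]
        exact hn
      have h2 : ‖DV (p.2, p.1) (b i, 0)‖ ≤ |M₁ i| := (hM₁ i _ hpc).trans (le_abs_self _)
      calc _ ≤ |M₁ i| * 1 := mul_le_mul h2 h1 (norm_nonneg _) (abs_nonneg _)
        _ = _ := mul_one _
    · rw [norm_mul, norm_mul]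
      have h1 : ‖v p.2 p.1‖ ≤ |M₀| := (hM₀ _ hpc).trans (le_abs_self _)
      have h2 : ‖heatKernel k (x - p.2) (t - p.1) / (2 * k * (t - p.1))‖ ≤ C / (2 * k) := by
        have e : heatKernel k (x - p.2) (t - p.1) / (2 * k * (t - p.1)) =
            heatKernel k (x - p.2) (t - p.1) / (t - p.1) / (2 * k) := by
          rw [div_div, mul_comm (2 * k)]
        have hτ : 0 ≤ t - p.1 := by linarith
        rw [Real.norm_of_nonneg (by positivity), e]
        gcongr
      have h3 : ‖inner ℝ (x - p.2) (outwardNormal Ω p.2)‖ ≤ |R| := by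
        refine (norm_inner_le_norm _ _).trans ?_
        have := (hR p.2 hpf).trans (le_abs_self R)
        calc _ ≤ |R| * 1 := mul_le_mul this hn (norm_nonneg _) (abs_nonneg _)
          _ = _ := mul_one _
      gcongr

end IsExteriorHeatSolution

/-! ### The backward heat operator on a truncated kernel -/

section Cutoff

variable {d : ℕ} {k : ℝ}

theorem ContDiff.continuous_laplacian {f : EuclideanSpace ℝ (Fin d) → ℝ} (hf : ContDiff ℝ 2 f) :
    Continuous (Laplacian.laplacian f) := by
  have h : Continuous (fderiv ℝ (fderiv ℝ f)) :=
    (hf.fderiv_right (m := 1) (by norm_num)).continuous_fderiv one_ne_zero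
  have e : Laplacian.laplacian f = fun z => ∑ i, fderiv ℝ (fderiv ℝ f) z
      (EuclideanSpace.basisFun (Fin d) ℝ i) (EuclideanSpace.basisFun (Fin d) ℝ i) :=
    funext (laplacian_eq_sum_fderiv f)
  rw [e]
  fun_prop

theorem continuousOn_heatKernel_sub (hk : 0 < k) (x : EuclideanSpace ℝ (Fin d)) (t : ℝ) :
    ContinuousOn (fun p : EuclideanSpace ℝ (Fin d) × ℝ => heatKernel k (x - p.1) (t - p.2))
      {p | p.2 < t} := by
  have h : ContinuousOn (fun p : EuclideanSpace ℝ (Fin d) × ℝ =>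
      (4 * Real.pi * k * (t - p.2)) ^ (-(d : ℝ) / 2) *
        Real.exp (-‖x - p.1‖ ^ 2 / (4 * k * (t - p.2)))) {p | p.2 < t} := by
    have hne : ∀ p ∈ {p : EuclideanSpace ℝ (Fin d) × ℝ | p.2 < t}, 0 < t - p.2 :=
      fun p hp => sub_pos.2 hp
    refine ContinuousOn.mul (ContinuousOn.rpow_const (by fun_prop) fun p hp => Or.inl ?_)
      (Real.continuous_exp.comp_continuousOn (ContinuousOn.div (by fun_prop) (by fun_prop) ?_))
    · have := hne p hp; positivity
    · intro p hp; have := hne p hp; positivity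
  exact h.congr fun p hp => heatKernel_of_pos k _ (sub_pos.2 hp)

/-- The density that results from applying the backward heat operator to the product of a cutoff
function and the heat kernel. -/
noncomputable def cutoffError (k : ℝ) (χ : EuclideanSpace ℝ (Fin d) → ℝ)
    (x : EuclideanSpace ℝ (Fin d)) (τ : ℝ) (y : EuclideanSpace ℝ (Fin d)) : ℝ :=
  heatKernel k (x - y) τ / τ * fderiv ℝ χ y (x - y) +
    k * heatKernel k (x - y) τ * Laplacian.laplacian χ y

/-- The derivative of the heat kernel with respect to the source time. -/
noncomputable def heatKernelTimeDeriv (k : ℝ) (z : EuclideanSpace ℝ (Fin d)) (τ : ℝ) : ℝ :=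
  -(k * ((-d / (2 * k * τ) + ‖z‖ ^ 2 / (2 * k * τ) ^ 2) * heatKernel k z τ))

/-- The operator ∂ₛ + kΔ annihilates K, so only terms with a derivative on χ survive; the cross term
2k∇χ·∇K equals (K/τ)∇χ·(x - y). -/
theorem mul_heatKernelTimeDeriv_add_laplacian (hk : 0 < k) {χ : EuclideanSpace ℝ (Fin d) → ℝ}
    (hχ : ContDiff ℝ 2 χ) (x y : EuclideanSpace ℝ (Fin d)) {τ : ℝ} (hτ : 0 < τ) :
    χ y * heatKernelTimeDeriv k (x - y) τ +
      k * Laplacian.laplacian (fun z => χ z * heatKernel k (x - z) τ) y =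
        cutoffError k χ x τ y := by
  rw [laplacian_mul hχ (contDiff_heatKernel k x τ), laplacian_heatKernel hk x y hτ]
  have e : ∑ i, fderiv ℝ χ y (EuclideanSpace.basisFun (Fin d) ℝ i) *
      fderiv ℝ (fun z => heatKernel k (x - z) τ) y (EuclideanSpace.basisFun (Fin d) ℝ i) =
      heatKernel k (x - y) τ / (2 * k * τ) * fderiv ℝ χ y (x - y) := by
    rw [← sum_apply_basis_mul_inner (fderiv ℝ χ y) (x - y), Finset.mul_sum]
    refine Finset.sum_congr rfl fun i _ => ?_
    rw [fderiv_heatKernel_apply hk x y _ hτ]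
    ring
  rw [e, cutoffError, heatKernelTimeDeriv]
  field_simp
  ring

theorem continuous_cutoffError {χ : EuclideanSpace ℝ (Fin d) → ℝ}
    (hχ : ContDiff ℝ 2 χ) (x : EuclideanSpace ℝ (Fin d)) (τ : ℝ) :
    Continuous (cutoffError k χ x τ) := by
  have h1 : Continuous fun y => heatKernel k (x - y) τ := (contDiff_heatKernel k x τ (n := 0)).continuous
  have h2 := hχ.continuous_fderiv two_ne_zero
  have h3 := hχ.continuous_laplacian
  unfold cutoffError
  fun_prop

theorem laplacian_eq_zero_of_notMem_tsupport {χ : EuclideanSpace ℝ (Fin d) → ℝ}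
    {y : EuclideanSpace ℝ (Fin d)} (hy : y ∉ tsupport χ) : Laplacian.laplacian χ y = 0 := by
  have h0 : fderiv ℝ (fderiv ℝ χ) y = 0 := by
    by_contra h
    exact hy (tsupport_fderiv_subset ℝ (tsupport_fderiv_subset ℝ (subset_tsupport _ h)))
  simp [laplacian_eq_sum_fderiv, h0]

theorem cutoffError_eq_zero_of_notMem_tsupport {χ : EuclideanSpace ℝ (Fin d) → ℝ}
    (x : EuclideanSpace ℝ (Fin d)) (τ : ℝ) {y : EuclideanSpace ℝ (Fin d)} (hy : y ∉ tsupport χ) :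
    cutoffError k χ x τ y = 0 := by
  have h1 : fderiv ℝ χ y = 0 := by
    by_contra h
    exact hy (tsupport_fderiv_subset ℝ (subset_tsupport _ h))
  simp [cutoffError, h1, laplacian_eq_zero_of_notMem_tsupport hy]

end Cutoff

/-! ### The space-time identity for the truncated solution -/

namespace IsExteriorHeatSolution

variable {d : ℕ} {k : ℝ} {Ω : Set (EuclideanSpace ℝ (Fin d))}
  {v : EuclideanSpace ℝ (Fin d) → ℝ → ℝ}

theorem continuousOn_timeDeriv (h : IsExteriorHeatSolution k Ω v) :
    ContinuousOn (timeDeriv Ω v) (Ωᶜ ×ˢ Ici (0 : ℝ)) :=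
  h.continuousOn_fderivWithin_apply (0, 1)

/-- The time derivative of `v y s * (χ y * K (x - y, t - s))`. -/
noncomputable def cutoffDensity (k : ℝ) (Ω : Set (EuclideanSpace ℝ (Fin d)))
    (v : EuclideanSpace ℝ (Fin d) → ℝ → ℝ) (χ : EuclideanSpace ℝ (Fin d) → ℝ)
    (x : EuclideanSpace ℝ (Fin d)) (t : ℝ) (p : EuclideanSpace ℝ (Fin d) × ℝ) : ℝ :=
  timeDeriv Ω v p * (χ p.1 * heatKernel k (x - p.1) (t - p.2)) +
    v p.1 p.2 * (χ p.1 * heatKernelTimeDeriv k (x - p.1) (t - p.2))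

theorem continuousOn_cutoffDensity (h : IsExteriorHeatSolution k Ω v)
    {χ : EuclideanSpace ℝ (Fin d) → ℝ} (hχ : Continuous χ) (x : EuclideanSpace ℝ (Fin d))
    {t T : ℝ} (hT : T < t) : ContinuousOn (cutoffDensity k Ω v χ x t) (Ωᶜ ×ˢ Icc 0 T) := by
  have hk := h.pos
  have hsub : Ωᶜ ×ˢ Icc 0 T ⊆ Ωᶜ ×ˢ Ici (0 : ℝ) := prod_mono_right Icc_subset_Ici_self
  have hK : ContinuousOn (fun p : EuclideanSpace ℝ (Fin d) × ℝ =>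
      heatKernel k (x - p.1) (t - p.2)) (Ωᶜ ×ˢ Icc 0 T) :=
    (continuousOn_heatKernel_sub hk x t).mono fun p hp => hp.2.2.trans_lt hT
  have h1 := h.continuousOn_timeDeriv.mono hsub
  have h2 := h.continuousOn.mono hsub
  have h3 : ContinuousOn (fun p : EuclideanSpace ℝ (Fin d) × ℝ => χ p.1) (Ωᶜ ×ˢ Icc 0 T) :=
    (hχ.comp continuous_fst).continuousOn
  have hne : ∀ p ∈ Ωᶜ ×ˢ Icc 0 T, 2 * k * (t - p.2) ≠ 0 := fun p hp => by
    have : 0 < t - p.2 := by linarith [hp.2.2]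
    positivity
  unfold cutoffDensity heatKernelTimeDeriv
  refine (h1.mul (h3.mul hK)).add (h2.mul (h3.mul (ContinuousOn.neg (continuousOn_const.mul
    (ContinuousOn.mul (ContinuousOn.add (ContinuousOn.div (by fun_prop) (by fun_prop) hne)
      (ContinuousOn.div (by fun_prop) (by fun_prop) fun p hp => pow_ne_zero 2 (hne p hp))) hK)))))

theorem integrable_cutoffDensity (h : IsExteriorHeatSolution k Ω v)
    {χ : EuclideanSpace ℝ (Fin d) → ℝ} (hχ : Continuous χ) (hχs : HasCompactSupport χ)
    (x : EuclideanSpace ℝ (Fin d)) {t T : ℝ} (hT : T < t) :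
    Integrable (cutoffDensity k Ω v χ x t)
      ((volume.restrict (closure Ω)ᶜ).prod (volume.restrict (Ioc 0 T))) := by
  have h1 : IntegrableOn (cutoffDensity k Ω v χ x t) (Ωᶜ ×ˢ Icc 0 T)
      ((volume : Measure (EuclideanSpace ℝ (Fin d))).prod (volume : Measure ℝ)) := by
    refine (h.continuousOn_cutoffDensity hχ x hT).integrableOn_of_eq_zero_off_compact
      (h.isOpen.isClosed_compl.prod isClosed_Icc) (hχs.isCompact.prod (isCompact_Icc (a := 0) (b := T)))
      fun p hp hpK => ?_
    have : p.1 ∉ tsupport χ := fun hm => hpK ⟨hm, hp.2⟩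
    simp [cutoffDensity, image_eq_zero_of_notMem_tsupport this]
  rw [Measure.prod_restrict]
  exact h1.mono_set (prod_mono (compl_closure_subset_compl Ω) Ioc_subset_Icc_self)

theorem integrableOn_slice (h : IsExteriorHeatSolution k Ω v)
    {F : EuclideanSpace ℝ (Fin d) → ℝ} (hF : ContinuousOn F Ωᶜ)
    {K : Set (EuclideanSpace ℝ (Fin d))} (hK : IsCompact K) (h0 : ∀ y ∉ K, F y = 0) :
    IntegrableOn F (closure Ω)ᶜ :=
  (hF.integrableOn_of_eq_zero_off_compact h.isOpen.isClosed_compl hK fun y _ hy => h0 y hy).mono_set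
    (compl_closure_subset_compl Ω)

/-- Fundamental theorem of calculus in s: the initial value zero removes the lower end point, and T
< t avoids the singularity of the kernel. -/
theorem integral_cutoffDensity_time (h : IsExteriorHeatSolution k Ω v)
    {χ : EuclideanSpace ℝ (Fin d) → ℝ} (hχ : Continuous χ)
    (x : EuclideanSpace ℝ (Fin d)) {t T : ℝ} (hT0 : 0 ≤ T) (hT : T < t)
    {y : EuclideanSpace ℝ (Fin d)} (hy : y ∈ Ωᶜ) :
    ∫ s in (0 : ℝ)..T, cutoffDensity k Ω v χ x t (y, s) =
      v y T * (χ y * heatKernel k (x - y) (t - T)) := by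
  have hm : MapsTo (fun s : ℝ => (y, s)) (Icc 0 T) (Ωᶜ ×ˢ Icc 0 T) := fun s hs => ⟨hy, hs⟩
  have hc : ContinuousOn (fun s : ℝ => (y, s)) (Icc 0 T) := by fun_prop
  have hG := (h.continuousOn_cutoffDensity hχ x hT).comp hc hm
  have hv : ContinuousOn (fun s => v y s) (Icc 0 T) :=
    h.continuousOn.comp hc fun s hs => ⟨hy, hs.1⟩
  have hK : ContinuousOn (fun s => heatKernel k (x - y) (t - s)) (Icc 0 T) :=
    (continuousOn_heatKernel_sub h.pos x t).comp hc fun s hs => hs.2.trans_lt hT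
  rw [intervalIntegral.integral_eq_sub_of_hasDerivAt_of_le
    (f := fun s => v y s * (χ y * heatKernel k (x - y) (t - s))) hT0
    (hv.mul (continuousOn_const.mul hK)) ?_ ?_]
  · simp [h.initial_eq_zero y hy]
  · intro s hs
    exact (h.hasDerivAt_time hy hs.1).fun_mul
      ((hasDerivAt_heatKernel_time h.pos (x - y) (hs.2.trans hT)).const_mul (χ y))
  · exact hG.intervalIntegrable_of_Icc hT0

/-- With the heat equation for v, the density minus the truncation error is k(wΔv - vΔw) for w = χK.
Green's identity turns it into a boundary integral, which is the layer integral because χ = 1 near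
∂Ω. -/
theorem integral_cutoffDensity_space (h : IsExteriorHeatSolution k Ω v)
    {χ : EuclideanSpace ℝ (Fin d) → ℝ} (hχ : ContDiff ℝ 2 χ) (hχs : HasCompactSupport χ)
    (hχ1 : ∀ y ∈ frontier Ω, χ =ᶠ[𝓝 y] 1)
    (x : EuclideanSpace ℝ (Fin d)) {t s : ℝ} (hs0 : 0 < s) (hs : s < t) :
    ∫ y in (closure Ω)ᶜ, cutoffDensity k Ω v χ x t (y, s) =
      -k * (∫ y, layerIntegrand k Ω v x t s y ∂surfaceMeasure Ω) +
        ∫ y in (closure Ω)ᶜ, v y s * cutoffError k χ x (t - s) y := by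
  have hv := h.contDiffOn_slice hs0.le
  have hτ : 0 < t - s := sub_pos.2 hs
  set w : EuclideanSpace ℝ (Fin d) → ℝ := fun z => χ z * heatKernel k (x - z) (t - s) with hw
  have hwc : ContDiff ℝ 2 w := hχ.mul (contDiff_heatKernel k x (t - s))
  have hws : HasCompactSupport w := hχs.mul_right
  have hgreen := green_second_identity_exterior h.isOpen h.isBounded h.lipschitz hv hwc hws
  have hsurf : ∫ y, (fderivWithin ℝ (fun z => v z s) Ωᶜ y (outwardNormal Ω y) * w y
        - v y s * fderiv ℝ w y (outwardNormal Ω y)) ∂surfaceMeasure Ω =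
      ∫ y, layerIntegrand k Ω v x t s y ∂surfaceMeasure Ω := by
    refine integral_congr_ae ?_
    filter_upwards [ae_surfaceMeasure_mem_frontier Ω] with y hy
    have e : w =ᶠ[𝓝 y] fun z => heatKernel k (x - z) (t - s) := by
      filter_upwards [hχ1 y hy] with z hz
      simp [hw, hz]
    rw [layerIntegrand, e.fderiv_eq, e.eq_of_nhds]
  have hintg : IntegrableOn (fun y => cutoffDensity k Ω v χ x t (y, s)) (closure Ω)ᶜ := by
    have hm : MapsTo (fun y : EuclideanSpace ℝ (Fin d) => (y, s)) Ωᶜ (Ωᶜ ×ˢ Icc 0 s) :=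
      fun y hy => ⟨hy, hs0.le, le_rfl⟩
    refine h.integrableOn_slice ((h.continuousOn_cutoffDensity hχ.continuous x hs).comp
      (by fun_prop) hm) hχs.isCompact fun y hy => ?_
    simp [cutoffDensity, image_eq_zero_of_notMem_tsupport hy]
  have hintg' : IntegrableOn (fun y => v y s * cutoffError k χ x (t - s) y) (closure Ω)ᶜ :=
    h.integrableOn_slice (hv.continuousOn.mul (continuous_cutoffError hχ x (t - s)).continuousOn)
      hχs.isCompact fun y hy => by rw [cutoffError_eq_zero_of_notMem_tsupport x _ hy, mul_zero]
  have key : ∫ y in (closure Ω)ᶜ, (cutoffDensity k Ω v χ x t (y, s) -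
      v y s * cutoffError k χ x (t - s) y) = ∫ y in (closure Ω)ᶜ,
        k * (w y * Laplacian.laplacian (fun z => v z s) y - v y s * Laplacian.laplacian w y) := by
    refine setIntegral_congr_fun isClosed_closure.isOpen_compl.measurableSet fun y hy => ?_
    simp only [cutoffDensity]
    rw [← mul_heatKernelTimeDeriv_add_laplacian h.pos hχ x y hτ, ← h.laplacian_eq hy hs0]
    ring
  rw [integral_sub hintg hintg', integral_const_mul, hgreen, hsurf] at key
  linarith

/-- The heat potential of a truncated solution equals the layer potential of its boundary values,
up to the error caused by the truncation. -/
theorem abs_integral_add_layer_le (h : IsExteriorHeatSolution k Ω v)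
    {χ : EuclideanSpace ℝ (Fin d) → ℝ} (hχ : ContDiff ℝ 2 χ) (hχs : HasCompactSupport χ)
    (hχ1 : ∀ y ∈ frontier Ω, χ =ᶠ[𝓝 y] 1)
    {x : EuclideanSpace ℝ (Fin d)} (hx : x ∉ frontier Ω) {t T : ℝ} (hT0 : 0 ≤ T) (hT : T < t)
    {q : ℝ} (hq : ∀ s, 0 < s → s ≤ T →
      |∫ y in (closure Ω)ᶜ, v y s * cutoffError k χ x (t - s) y| ≤ q) :
    |(∫ y in (closure Ω)ᶜ, v y T * (χ y * heatKernel k (x - y) (t - T))) +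
      k * ∫ s in (0 : ℝ)..T, ∫ y, layerIntegrand k Ω v x t s y ∂surfaceMeasure Ω| ≤ q * T := by
  have := isFiniteMeasure_surfaceMeasure h.isOpen h.isBounded h.lipschitz
  have hG := h.integrable_cutoffDensity hχ.continuous hχs x hT
  -- Fubini: integrating the density first in time gives the slice at T, first in space the layer
  -- integral and the error.
  have h1 : ∫ y in (closure Ω)ᶜ, v y T * (χ y * heatKernel k (x - y) (t - T)) =
      ∫ s in (0 : ℝ)..T, ∫ y in (closure Ω)ᶜ, cutoffDensity k Ω v χ x t (y, s) := by
    rw [intervalIntegral.integral_of_le hT0, ← integral_integral_swap (f := fun y s =>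
      cutoffDensity k Ω v χ x t (y, s)) hG]
    refine setIntegral_congr_fun isClosed_closure.isOpen_compl.measurableSet fun y hy => ?_
    rw [← intervalIntegral.integral_of_le hT0]
    exact (h.integral_cutoffDensity_time hχ.continuous x hT0 hT
      (compl_closure_subset_compl Ω hy)).symm
  have hI1 : IntervalIntegrable (fun s => ∫ y in (closure Ω)ᶜ, cutoffDensity k Ω v χ x t (y, s))
      volume 0 T := (intervalIntegrable_iff_integrableOn_Ioc_of_le hT0).2 hG.integral_prod_right
  have hI2 : IntervalIntegrable (fun s => ∫ y, layerIntegrand k Ω v x t s y ∂surfaceMeasure Ω)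
      volume 0 T := by
    rw [intervalIntegrable_iff_integrableOn_Ioc_of_le hT0]
    have h2 : IntegrableOn (fun s => ∫ y, layerIntegrand k Ω v x t s y ∂surfaceMeasure Ω)
      (Ioc 0 t) := (h.integrable_layerIntegrand hx (hT0.trans_lt hT)).integral_prod_left
    exact h2.mono_set (Ioc_subset_Ioc_right hT.le)
  rw [h1, ← intervalIntegral.integral_const_mul, ← intervalIntegral.integral_add hI1
    (hI2.const_mul k)]
  rw [← Real.norm_eq_abs]
  refine (intervalIntegral.norm_integral_le_of_norm_le_const (C := q) fun s hs => ?_).trans_eq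
    (by rw [sub_zero, abs_of_nonneg hT0])
  rw [uIoc_of_le hT0] at hs
  rw [h.integral_cutoffDensity_space hχ hχs hχ1 x hs.1 (hs.2.trans_lt hT)]
  refine le_of_eq_of_le ?_ (hq s hs.1 hs.2)
  rw [Real.norm_eq_abs]
  congr 1
  ring

end IsExteriorHeatSolution

/-! ### Cutoff functions and the truncation error -/

/-- A compactly supported `C²` function with values in `[-1, 1]` that equals `1` on the ball of
radius `R`, and whose gradient and Laplacian are bounded by `M`. -/
structure IsCutoff {d : ℕ} (M R : ℝ) (χ : EuclideanSpace ℝ (Fin d) → ℝ) : Prop where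
  contDiff : ContDiff ℝ 2 χ
  hasCompactSupport : HasCompactSupport χ
  eq_one : ∀ y, ‖y‖ < R → χ y = 1
  abs_le_one : ∀ y, |χ y| ≤ 1
  norm_fderiv_le : ∀ y, ‖fderiv ℝ χ y‖ ≤ M
  abs_laplacian_le : ∀ y, |Laplacian.laplacian χ y| ≤ M

theorem laplacian_comp_smul {d : ℕ} {f : EuclideanSpace ℝ (Fin d) → ℝ} (hf : ContDiff ℝ 2 f)
    (c : ℝ) (y : EuclideanSpace ℝ (Fin d)) :
    Laplacian.laplacian (fun z => f (c • z)) y = c ^ 2 * Laplacian.laplacian f (c • y) := by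
  have h1 : fderiv ℝ (fun z => f (c • z)) = fun z => c • fderiv ℝ f (c • z) :=
    funext fun z => fderiv_comp_smul (f := f) c
  have h2 : fderiv ℝ (fun z => c • fderiv ℝ f (c • z)) y =
      c • c • fderiv ℝ (fderiv ℝ f) (c • y) := by
    have hd : Differentiable ℝ (fderiv ℝ f) :=
      (hf.fderiv_right (m := 1) (by norm_num)).differentiable one_ne_zero
    have hc : DifferentiableAt ℝ (fun z => fderiv ℝ f (c • z)) y :=
      (hd.comp (differentiable_id.const_smul c)) y
    rw [fderiv_fun_const_smul hc,
      fderiv_comp_smul (f := fderiv ℝ f) c]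
  rw [laplacian_eq_sum_fderiv, laplacian_eq_sum_fderiv, h1, h2, Finset.mul_sum]
  refine Finset.sum_congr rfl fun i _ => ?_
  simp only [smul_apply, smul_eq_mul]
  ring

/-- All cutoffs are dilations of a single bump. Dilating by R ≥ 1 only decreases derivatives, so M
serves all radii. -/
theorem exists_isCutoff (d : ℕ) :
    ∃ M, 0 ≤ M ∧ ∀ R, 1 ≤ R → ∃ χ : EuclideanSpace ℝ (Fin d) → ℝ, IsCutoff M R χ := by
  let φ : ContDiffBump (0 : EuclideanSpace ℝ (Fin d)) := ⟨1, 2, one_pos, one_lt_two⟩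
  have hφ : ContDiff ℝ 2 φ := φ.contDiff
  have hφs : HasCompactSupport φ := φ.hasCompactSupport
  obtain ⟨M₁, hM₁⟩ := (hφs.fderiv ℝ).exists_bound_of_continuous (hφ.continuous_fderiv two_ne_zero)
  obtain ⟨M₂, hM₂⟩ := (HasCompactSupport.intro hφs.isCompact fun y hy =>
    laplacian_eq_zero_of_notMem_tsupport hy).exists_bound_of_continuous hφ.continuous_laplacian
  refine ⟨max M₁ M₂, ((norm_nonneg _).trans (hM₁ 0)).trans (le_max_left _ _), fun R hR => ?_⟩
  have hR0 : 0 < R := one_pos.trans_le hR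
  have hRi : R⁻¹ ≤ 1 := inv_le_one_of_one_le₀ hR
  refine ⟨fun y => φ (R⁻¹ • y), ⟨hφ.comp (contDiff_const_smul _),
    hφs.comp_smul (inv_ne_zero hR0.ne'), fun y hy => φ.one_of_mem_closedBall ?_, fun y => ?_,
    fun y => ?_, fun y => ?_⟩⟩
  · rw [mem_closedBall_zero_iff, norm_smul, norm_inv, Real.norm_of_nonneg hR0.le]
    exact inv_mul_le_one_of_le₀ hy.le hR0.le
  · rw [abs_of_nonneg φ.nonneg]; exact φ.le_one
  · rw [fderiv_comp_smul (f := φ), norm_smul, norm_inv, Real.norm_of_nonneg hR0.le]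
    exact (mul_le_of_le_one_left (norm_nonneg _) hRi).trans ((hM₁ _).trans (le_max_left _ _))
  · rw [laplacian_comp_smul hφ, abs_mul, abs_of_nonneg (by positivity)]
    exact (mul_le_of_le_one_left (abs_nonneg _) (pow_le_one₀ (by positivity) hRi)).trans
      ((hM₂ _).trans (le_max_right _ _))

namespace IsCutoff

variable {d : ℕ} {k M R : ℝ} {χ : EuclideanSpace ℝ (Fin d) → ℝ}

theorem eventuallyEq_one (hχ : IsCutoff M R χ) {y : EuclideanSpace ℝ (Fin d)} (hy : ‖y‖ < R) :
    χ =ᶠ[𝓝 y] 1 := by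
  filter_upwards [(continuous_norm.tendsto y).eventually (gt_mem_nhds hy)] with z hz
  exact hχ.eq_one z hz

theorem cutoffError_eq_zero (hχ : IsCutoff M R χ) (x : EuclideanSpace ℝ (Fin d)) (τ : ℝ)
    {y : EuclideanSpace ℝ (Fin d)} (hy : ‖y‖ < R) : cutoffError k χ x τ y = 0 := by
  have h1 : fderiv ℝ χ =ᶠ[𝓝 y] 0 := by
    simpa using (hχ.eventuallyEq_one hy).fderiv (𝕜 := ℝ)
  have h2 : Laplacian.laplacian χ y = 0 := by
    rw [laplacian_eq_sum_fderiv, h1.fderiv_eq]; simp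
  rw [cutoffError, h1.eq_of_nhds, h2]
  simp

theorem abs_cutoffError_le (hk : 0 < k) (hχ : IsCutoff M R χ) (x y : EuclideanSpace ℝ (Fin d))
    {τ : ℝ} (hτ : 0 < τ) :
    |cutoffError k χ x τ y| ≤ heatKernel k (x - y) τ / τ * (M * (‖x - y‖ + k * τ)) := by
  have hK := heatKernel_nonneg hk (x - y) τ
  have h1 : |fderiv ℝ χ y (x - y)| ≤ M * ‖x - y‖ :=
    ((fderiv ℝ χ y).le_opNorm _).trans (by gcongr; exact hχ.norm_fderiv_le y)
  have e : heatKernel k (x - y) τ / τ * (M * (‖x - y‖ + k * τ)) =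
      heatKernel k (x - y) τ / τ * (M * ‖x - y‖) + k * heatKernel k (x - y) τ * M := by
    field_simp
  rw [e, cutoffError]
  refine (abs_add_le _ _).trans (add_le_add ?_ ?_)
  · rw [abs_mul, abs_of_nonneg (by positivity)]; gcongr
  · rw [abs_mul, abs_of_nonneg (by positivity)]; gcongr; exact hχ.abs_laplacian_le y

end IsCutoff

/-- The pointwise bound by which the truncation error is controlled. -/
theorem exp_mul_sq_norm_mul_le {V : Type*} [NormedAddCommGroup V] [InnerProductSpace ℝ V]
    {α β c : ℝ} (hα : 0 ≤ α) (hβ : 0 < β) (hαβ : 8 * α ≤ β) (hc : 0 ≤ c) (x y : V)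
    (hxy : 1 ≤ ‖x - y‖) :
    Real.exp (α * ‖y‖ ^ 2) * (Real.exp (-(β * ‖x - y‖ ^ 2)) * (‖x - y‖ + c)) ≤
      Real.exp (2 * α * ‖x‖ ^ 2) * ((1 + c) * (4 / β)) * Real.exp (-(β / 2) * ‖x - y‖ ^ 2) := by
  set ρ := ‖x - y‖
  have hy : ‖y‖ ≤ ‖x‖ + ρ := by
    have := norm_sub_le x (x - y)
    rwa [sub_sub_cancel] at this
  have hy2 : ‖y‖ ^ 2 ≤ 2 * ‖x‖ ^ 2 + 2 * ρ ^ 2 := by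
    have := pow_le_pow_left₀ (norm_nonneg y) hy 2
    nlinarith [sq_nonneg (‖x‖ - ρ)]
  -- The decay rate β is divided up: β/4 pays for the growth in y (here 8α ≤ β is used), β/4 for the
  -- factor ρ + c, and β/2 remains.
  have h1 : Real.exp (α * ‖y‖ ^ 2) ≤
      Real.exp (2 * α * ‖x‖ ^ 2) * Real.exp (β / 4 * ρ ^ 2) := by
    rw [← Real.exp_add]
    refine Real.exp_le_exp.2 ?_
    nlinarith [mul_le_mul_of_nonneg_left hy2 hα, mul_nonneg (sub_nonneg.2 hαβ) (sq_nonneg ρ)]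
  have h2 : ρ + c ≤ (1 + c) * (4 / β) * Real.exp (β / 4 * ρ ^ 2) := by
    have h3 : ρ ^ 2 ≤ 4 / β * Real.exp (β / 4 * ρ ^ 2) := by
      have := Real.add_one_le_exp (β / 4 * ρ ^ 2)
      calc ρ ^ 2 = 4 / β * (β / 4 * ρ ^ 2) := by field_simp
        _ ≤ _ := by gcongr; linarith
    have h4 : ρ + c ≤ (1 + c) * ρ ^ 2 := by
      have h5 : 1 ≤ ρ ^ 2 := one_le_pow₀ hxy
      nlinarith [mul_le_mul_of_nonneg_left h5 hc]
    calc ρ + c ≤ (1 + c) * ρ ^ 2 := h4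
      _ ≤ (1 + c) * (4 / β * Real.exp (β / 4 * ρ ^ 2)) := by gcongr
      _ = _ := by ring
  calc _ ≤ (Real.exp (2 * α * ‖x‖ ^ 2) * Real.exp (β / 4 * ρ ^ 2)) *
        (Real.exp (-(β * ρ ^ 2)) * ((1 + c) * (4 / β) * Real.exp (β / 4 * ρ ^ 2))) := by
        gcongr
    _ = Real.exp (2 * α * ‖x‖ ^ 2) * ((1 + c) * (4 / β)) *
        (Real.exp (β / 4 * ρ ^ 2) * Real.exp (-(β * ρ ^ 2)) * Real.exp (β / 4 * ρ ^ 2)) := by ring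
    _ = _ := by
        rw [← Real.exp_add, ← Real.exp_add]
        congr 2
        ring

namespace IsExteriorHeatSolution

variable {d : ℕ} {k : ℝ} {Ω : Set (EuclideanSpace ℝ (Fin d))}
  {v : EuclideanSpace ℝ (Fin d) → ℝ → ℝ}

/-- D depends on neither R, χ nor s, so the truncation radius and the final time can go to their
limits together. The condition ‖x‖ + 1 ≤ R gives ‖x - y‖ ≥ 1 wherever the error is nonzero.
Sub-Gaussian growth is used with α = β/8, where β = 1/(8kt) is the decay rate of the kernel bound.
-/
theorem exists_abs_mul_cutoffError_le (h : IsExteriorHeatSolution k Ω v)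
    (hg : GrowthCondition k v) (x : EuclideanSpace ℝ (Fin d)) {t M : ℝ} (ht : 0 < t)
    (hM : 0 ≤ M) :
    ∃ D, 0 ≤ D ∧ ∀ R (χ : EuclideanSpace ℝ (Fin d) → ℝ), ‖x‖ + 1 ≤ R → IsCutoff M R χ →
      ∀ s, 0 < s → s < t → ∀ y ∈ Ωᶜ, |v y s * cutoffError k χ x (t - s) y| ≤
        {y | R ≤ ‖y‖}.indicator
          (fun y => D * Real.exp (-(1 / (8 * k * t) / 2) * ‖x - y‖ ^ 2)) y := by
  have hk := h.pos
  set β := 1 / (8 * k * t) with hβdef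
  have hβ : 0 < β := by positivity
  obtain ⟨A, hA, hAb⟩ := hg.exists_bound hk h.isOpen h.isBounded h.contDiffOn t
    (α := β / 8) (by positivity)
  obtain ⟨C, hC, hCb⟩ := exists_heatKernel_div_le (d := d) hk ht one_pos
  refine ⟨A * C * M * (Real.exp (2 * (β / 8) * ‖x‖ ^ 2) * ((1 + k * t) * (4 / β))),
    by positivity, fun R χ hR hχ s hs0 hst y hy => ?_⟩
  by_cases hyR : R ≤ ‖y‖
  · rw [indicator_of_mem (show y ∈ {y | R ≤ ‖y‖} from hyR), abs_mul]
    have hτ : 0 < t - s := sub_pos.2 hst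
    have hxy : 1 ≤ ‖x - y‖ := by
      have := norm_sub_norm_le y x
      rw [norm_sub_rev] at this
      linarith
    have h1 := hAb y hy s hs0 hst.le
    have h2 : |cutoffError k χ x (t - s) y| ≤
        C * Real.exp (-(β * ‖x - y‖ ^ 2)) * (M * (‖x - y‖ + k * t)) := by
      refine (hχ.abs_cutoffError_le hk x y hτ).trans ?_
      have h3 := hCb (t - s) hτ (by linarith) (x - y) hxy
      have e : ‖x - y‖ ^ 2 / (8 * k * t) = β * ‖x - y‖ ^ 2 := by rw [hβdef]; ring
      rw [e] at h3
      gcongr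
      linarith
    calc |v y s| * |cutoffError k χ x (t - s) y| ≤ (A * Real.exp (β / 8 * ‖y‖ ^ 2)) *
          (C * Real.exp (-(β * ‖x - y‖ ^ 2)) * (M * (‖x - y‖ + k * t))) := by gcongr
      _ = A * C * M * (Real.exp (β / 8 * ‖y‖ ^ 2) *
          (Real.exp (-(β * ‖x - y‖ ^ 2)) * (‖x - y‖ + k * t))) := by ring
      _ ≤ A * C * M * (Real.exp (2 * (β / 8) * ‖x‖ ^ 2) * ((1 + k * t) * (4 / β)) *
          Real.exp (-(β / 2) * ‖x - y‖ ^ 2)) := by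
          refine mul_le_mul_of_nonneg_left ?_ (by positivity)
          exact exp_mul_sq_norm_mul_le (by positivity) hβ (by linarith) (by positivity) x y hxy
      _ = _ := by ring
  · rw [indicator_of_notMem (show y ∉ {y | R ≤ ‖y‖} from hyR),
      hχ.cutoffError_eq_zero x _ (not_le.1 hyR), mul_zero, abs_zero]

/-! ### Passage to the limit and the representation formula -/

/-- The layer potential is the limit of the solution, extended by zero into `Ω`. -/
theorem exteriorLayerField_eq_of_tendsto (h : IsExteriorHeatSolution k Ω v)
    (hg : GrowthCondition k v) {x : EuclideanSpace ℝ (Fin d)} (hx : x ∉ frontier Ω) {t : ℝ}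
    (ht : 0 < t) {L : ℝ}
    (hL : Tendsto (fun p : EuclideanSpace ℝ (Fin d) × ℝ =>
      (closure Ω)ᶜ.indicator (fun z => v z p.2) p.1) (𝓝 (x, t)) (𝓝 L)) :
    exteriorLayerField k Ω v x t = L := by
  have hk := h.pos
  have := isFiniteMeasure_surfaceMeasure h.isOpen h.isBounded h.lipschitz
  have hXm : MeasurableSet (closure Ω)ᶜ := isClosed_closure.isOpen_compl.measurableSet
  obtain ⟨M, hM, hcut⟩ := exists_isCutoff d
  obtain ⟨R₀, hR₀⟩ := h.isBounded.closure.subset_ball (0 : EuclideanSpace ℝ (Fin d))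
  set N : ℝ := max R₀ (‖x‖ + 1) with hN
  have hN1 : 1 ≤ N := (le_add_of_nonneg_left (norm_nonneg x)).trans (le_max_right _ _)
  set R : ℕ → ℝ := fun n => N + n with hRdef
  have hNR : ∀ n, N ≤ R n := fun n => le_add_of_nonneg_right n.cast_nonneg
  have hRtop : Tendsto R atTop atTop :=
    tendsto_atTop_add_const_left _ _ tendsto_natCast_atTop_atTop
  choose χ hχ using fun n => hcut (R n) (hN1.trans (hNR n))
  -- The final times t - ε n increase to t; dividing by n + 2 keeps ε n strictly below both t and 1.
  set ε : ℕ → ℝ := fun n => min t 1 / (n + 2) with hεdef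
  have hε : ∀ n, 0 < ε n := fun n => by
    have : 0 < min t 1 := lt_min ht one_pos
    positivity
  have hεm : ∀ n, ε n < min t 1 := fun n =>
    div_lt_self (lt_min ht one_pos) (by have := n.cast_nonneg (α := ℝ); linarith)
  have hεt : ∀ n, ε n < t := fun n => (hεm n).trans_le (min_le_left _ _)
  have hε1 : ∀ n, ε n ≤ 1 := fun n => (hεm n).le.trans (min_le_right _ _)
  have hε0 : Tendsto ε atTop (𝓝 0) :=
    tendsto_const_nhds.div_atTop
      (tendsto_atTop_add_const_right _ _ tendsto_natCast_atTop_atTop)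
  have hTlim : Tendsto (fun n => t - ε n) atTop (𝓝 t) := by
    simpa using tendsto_const_nhds.sub hε0
  -- the heat potential at the final time
  set F : ℕ → EuclideanSpace ℝ (Fin d) → ℝ := fun n =>
    (closure Ω)ᶜ.indicator fun z => v z (t - ε n) * χ n z with hFdef
  have hFlim : Tendsto (fun n => ∫ y, F n y * heatKernel k (x - y) (ε n)) atTop (𝓝 L) := by
    obtain ⟨A, hA, hAb⟩ := hg.exists_bound hk h.isOpen h.isBounded h.contDiffOn t
      (α := 1 / (16 * k)) (by positivity)
    refine tendsto_integral_mul_heatKernel hk hε hε1 (A := A) (by positivity) le_rfl x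
      (fun n => ?_) (fun n y => ?_) fun z => ?_
    · have hc : ContinuousOn (fun z => v z (t - ε n) * χ n z) (closure Ω)ᶜ :=
        ((h.contDiffOn_slice (sub_nonneg.2 (hεt n).le)).continuousOn.mono
          (compl_closure_subset_compl Ω)).mul (hχ n).contDiff.continuous.continuousOn
      classical
      rw [hFdef]
      simp only [← piecewise_eq_indicator]
      exact hc.measurable_piecewise continuousOn_const hXm
    · by_cases hy : y ∈ (closure Ω)ᶜ
      · simp only [hFdef]
        rw [indicator_of_mem hy, abs_mul]
        exact (mul_le_of_le_one_right (abs_nonneg _) ((hχ n).abs_le_one y)).trans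
          (hAb y (compl_closure_subset_compl Ω hy) _ (sub_pos.2 (hεt n)) (by linarith [hε n]))
      · simp only [hFdef]
        rw [indicator_of_notMem hy, abs_zero]
        positivity
    · have hy : Tendsto (fun n => x + √(ε n) • z) atTop (𝓝 x) := by
        have h1 := (Real.continuous_sqrt.tendsto 0).comp hε0
        rw [Real.sqrt_zero] at h1
        simpa using tendsto_const_nhds.add (h1.smul_const z)
      -- The evaluation point x + √ε z and the time t - ε move simultaneously, which is why `hL` is
      -- a joint limit in space and time.
      have h2 := hL.comp (hy.prodMk_nhds hTlim)
      refine h2.congr' ?_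
      have hxN : ‖x‖ < N := (lt_add_one _).trans_le (le_max_right _ _)
      filter_upwards [hy.norm.eventually (gt_mem_nhds hxN)] with n hn
      simp only [Function.comp_apply, hFdef, indicator]
      rw [(hχ n).eq_one _ (hn.trans_le (hNR n)), mul_one]
  -- the boundary term
  have hψ : IntegrableOn (fun s => ∫ y, layerIntegrand k Ω v x t s y ∂surfaceMeasure Ω)
      (Ioc 0 t) := (h.integrable_layerIntegrand hx ht).integral_prod_left
  have hψlim : Tendsto (fun n => ∫ s in (0 : ℝ)..(t - ε n),
      ∫ y, layerIntegrand k Ω v x t s y ∂surfaceMeasure Ω) atTop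
      (𝓝 (∫ s in (0 : ℝ)..t, ∫ y, layerIntegrand k Ω v x t s y ∂surfaceMeasure Ω)) := by
    have hc := intervalIntegral.continuousOn_primitive_interval' (a := 0) (b₁ := 0) (b₂ := t)
      ((intervalIntegrable_iff_integrableOn_Ioc_of_le ht.le).2 hψ) left_mem_uIcc
    rw [uIcc_of_le ht.le] at hc
    exact (hc t ⟨ht.le, le_rfl⟩).tendsto.comp (tendsto_nhdsWithin_iff.2
      ⟨hTlim, .of_forall fun n => ⟨sub_nonneg.2 (hεt n).le, by linarith [hε n]⟩⟩)
  -- the truncation error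
  obtain ⟨D, hD0, hD⟩ := h.exists_abs_mul_cutoffError_le hg x ht hM
  set g : EuclideanSpace ℝ (Fin d) → ℝ :=
    fun y => D * Real.exp (-(1 / (8 * k * t) / 2) * ‖x - y‖ ^ 2) with hgdef
  have hgi : Integrable g :=
    ((integrable_exp_neg_mul_sq_norm (b := 1 / (8 * k * t) / 2)
      (by positivity)).comp_sub_left x).const_mul D
  have hRm : ∀ n, MeasurableSet {y : EuclideanSpace ℝ (Fin d) | R n ≤ ‖y‖} := fun n =>
    measurableSet_le measurable_const measurable_norm
  -- The Gaussian tail beyond radius R n, an error bound that does not depend on s.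
  set q : ℕ → ℝ := fun n => ∫ y, {y | R n ≤ ‖y‖}.indicator g y with hqdef
  have hqlim : Tendsto q atTop (𝓝 0) := by
    have := tendsto_integral_of_dominated_convergence
      (F := fun n => {y : EuclideanSpace ℝ (Fin d) | R n ≤ ‖y‖}.indicator g) (f := fun _ => (0 : ℝ))
      (μ := volume) (fun y => ‖g y‖) (fun n => (hgi.indicator (hRm n)).aestronglyMeasurable) hgi.norm
      (fun n => .of_forall fun y => norm_indicator_le_norm_self _ _)
      (.of_forall fun y => ?_)
    · simpa using this
    · refine tendsto_const_nhds.congr' ?_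
      filter_upwards [hRtop.eventually_gt_atTop ‖y‖] with n hn
      rw [indicator_of_notMem (show y ∉ {y | R n ≤ ‖y‖} from not_le.2 hn)]
  have hbound : ∀ n, ‖(∫ y, F n y * heatKernel k (x - y) (ε n)) +
      k * ∫ s in (0 : ℝ)..(t - ε n), ∫ y, layerIntegrand k Ω v x t s y ∂surfaceMeasure Ω‖ ≤
        q n * (t - ε n) := fun n => by
    have e : ∫ y, F n y * heatKernel k (x - y) (ε n) =
        ∫ y in (closure Ω)ᶜ, v y (t - ε n) * (χ n y * heatKernel k (x - y) (t - (t - ε n))) := by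
      rw [← integral_indicator hXm, sub_sub_cancel]
      refine integral_congr_ae (.of_forall fun y => ?_)
      simp only [hFdef, indicator]
      split_ifs
      · ring
      · exact zero_mul _
    rw [e]
    refine h.abs_integral_add_layer_le (hχ n).contDiff (hχ n).hasCompactSupport (fun y hy => ?_) hx
      (sub_nonneg.2 (hεt n).le) (sub_lt_self t (hε n)) fun s hs0 hsT => ?_
    · have := hR₀ (frontier_subset_closure hy)
      rw [mem_ball_zero_iff] at this
      exact (hχ n).eventuallyEq_one (this.trans_le ((le_max_left _ _).trans (hNR n)))
    · have hpt : ∀ y ∈ Ωᶜ, ‖v y s * cutoffError k (χ n) x (t - s) y‖ ≤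
          {y | R n ≤ ‖y‖}.indicator g y := fun y hy =>
        hD (R n) (χ n) ((le_max_right _ _).trans (hNR n)) (hχ n) s hs0
          (by linarith [hε n]) y hy
      have hg0 : ∀ y, 0 ≤ {y | R n ≤ ‖y‖}.indicator g y := fun y =>
        indicator_nonneg (fun y _ => by positivity) y
      rw [← Real.norm_eq_abs]
      refine (norm_integral_le_of_norm_le (hgi.indicator (hRm n)).integrableOn
        ((ae_restrict_iff' hXm).2 (.of_forall fun y hy =>
          hpt y (compl_closure_subset_compl Ω hy)))).trans ?_
      exact setIntegral_le_integral (hgi.indicator (hRm n)) (.of_forall hg0)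
  have hsum := hFlim.add (hψlim.const_mul k)
  -- The slice integral plus k times the layer integral tends to 0 by the error bound, while the two
  -- terms converge separately to L and to k times the full layer integral.
  have hzero := squeeze_zero_norm hbound (by simpa using hqlim.mul hTlim)
  have := tendsto_nhds_unique hsum hzero
  rw [exteriorLayerField]
  linarith

theorem exteriorLayerField_eq_zero (h : IsExteriorHeatSolution k Ω v)
    (hg : GrowthCondition k v) {x : EuclideanSpace ℝ (Fin d)} (hx : x ∈ Ω) {t : ℝ}
    (ht : 0 < t) : exteriorLayerField k Ω v x t = 0 := by
  refine h.exteriorLayerField_eq_of_tendsto hg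
    (fun hf => frontier_subset_compl h.isOpen hf hx) ht (tendsto_const_nhds.congr' ?_)
  filter_upwards [(continuous_fst.tendsto (x, t)).eventually (h.isOpen.mem_nhds hx)] with p hp
  have hp' : p.1 ∉ (closure Ω)ᶜ := fun hc => hc (subset_closure hp)
  rw [indicator_of_notMem hp']

theorem exteriorLayerField_eq (h : IsExteriorHeatSolution k Ω v)
    (hg : GrowthCondition k v) {x : EuclideanSpace ℝ (Fin d)} (hx : x ∉ closure Ω) {t : ℝ}
    (ht : 0 < t) : exteriorLayerField k Ω v x t = v x t := by
  refine h.exteriorLayerField_eq_of_tendsto hg (fun hf => hx (frontier_subset_closure hf)) ht ?_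
  have hX : (closure Ω)ᶜ ∈ 𝓝 x := isClosed_closure.isOpen_compl.mem_nhds hx
  have hc : ContinuousAt (fun p : EuclideanSpace ℝ (Fin d) × ℝ => v p.1 p.2) (x, t) :=
    h.continuousOn.continuousAt
      (prod_mem_nhds (mem_of_superset hX (compl_closure_subset_compl Ω)) (Ici_mem_nhds ht))
  refine hc.tendsto.congr' ?_
  filter_upwards [(continuous_fst.tendsto (x, t)).eventually hX] with p hp
  have hp' : p.1 ∈ (closure Ω)ᶜ := hp
  rw [indicator_of_mem hp']

end IsExteriorHeatSolution

theorem theorem2p1 (d : ℕ) (hd : 2 ≤ d) (k : ℝ) (hk : 0 < k)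
    (Ω : Set (EuclideanSpace ℝ (Fin d))) (hΩ_open : IsOpen Ω) (hΩ_ne : Ω.Nonempty)
    (hΩ_bdd : Bornology.IsBounded Ω) (hΩ_lip : HasLipschitzBoundary Ω)
    (v h : EuclideanSpace ℝ (Fin d) → ℝ → ℝ)
    (hv_smooth : ContDiffOn ℝ 2 (fun p : EuclideanSpace ℝ (Fin d) × ℝ => v p.1 p.2)
      (Ωᶜ ×ˢ Ici (0 : ℝ)))
    (h_supp : ∀ t > 0, tsupport (fun x => h x t) ⊆ closure Ω)
    (hv_heat : ∀ x ∉ closure Ω, ∀ t > 0,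
      deriv (fun s => v x s) t = k * Laplacian.laplacian (fun z => v z t) x + h x t)
    (hv_init : ∀ x ∉ Ω, v x 0 = 0)
    (hv_growth : GrowthCondition k v) :
    ∀ t > 0,
      (∀ x ∉ frontier Ω,
        Integrable (fun p : ℝ × EuclideanSpace ℝ (Fin d) => layerIntegrand k Ω v x t p.1 p.2)
          ((volume.restrict (Ioc 0 t)).prod (surfaceMeasure Ω))) ∧
      (∀ x ∈ Ω, exteriorLayerField k Ω v x t = 0) ∧
      (∀ x ∉ closure Ω, exteriorLayerField k Ω v x t = v x t) := by
  have hsol : IsExteriorHeatSolution k Ω v :=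
    { pos := hk
      isOpen := hΩ_open
      isBounded := hΩ_bdd
      lipschitz := hΩ_lip
      contDiffOn := hv_smooth
      heat := fun x hx t ht => by
        -- Off the closure of Ω the source vanishes, so v solves the homogeneous equation there.
        have h0 : h x t = 0 :=
          image_eq_zero_of_notMem_tsupport (f := fun x => h x t) fun hm => hx (h_supp t ht hm)
        rw [hv_heat x hx t ht, h0, add_zero]
      initial_eq_zero := hv_init }
  exact fun t ht => ⟨fun x hx => hsol.integrable_layerIntegrand hx ht,
    fun x hx => hsol.exteriorLayerField_eq_zero hv_growth hx ht,
    fun x hx => hsol.exteriorLayerField_eq hv_growth hx ht⟩
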